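/- Let $\kappa>0$, let $d\in\mathbb R^3$ with $|d|=1$, and let $u_{\rm inc}(x)=e^{i\kappa\langle d,x\rangle}$. Let $(\Omega,\mathcal F,\mathbb P)$ be a probability space, let $D(\omega)\subset\mathbb R^3$, $\omega\in\Omega$, be a random obstacle which almost surely is a bounded open set with Lipschitz boundary, and let $u_{\rm s}(\cdot,\omega)$ be the scattered wave of $u_{\rm inc}$ at the sound-soft obstacle $D(\omega)$. That is, almost surely the total wave $u=u_{\rm inc}+u_{\rm s}$ is $C^2$ in $\mathbb R^3\setminus\overline{D(\omega)}$ and continuous on $\mathbb R^3\setminus D(\omega)$, and $$\Delta u+\kappa^2u=0\ \text{ in }\mathbb R^3\setminus\overline{D(\omega)},\qquad u=0\ \text{ on }\partial D(\omega),\qquad r\Big(\frac{\partial u_{\rm s}}{\partial r}-i\kappa u_{\rm s}\Big)\to0\ \text{ as } r=|x|\to\infty,$$ the last limit being uniform in all directions. Let $T=\partial B$ be the boundary of a fixed bounded open set $B\subset\mathbb R^3$ with Lipschitz boundary that almost surely encloses the obstacle, $\overline{D(\omega)}\subset B$. Let $\sigma$ be the surface measure on $T$ and $n$ the outward unit normal.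 Assume that the Cauchy data $u_{\rm s}|_T$ and $\frac{\partial u_{\rm s}}{\partial n}|_T$ belong to $L^2(\Omega\times T,\mathbb P\otimes\sigma)$. Put $$\Phi(x,z)=\frac{e^{i\kappa|x-z|}}{4\pi|x-z|},\qquad \operatorname{Cor}[X,Y](z,z')=\mathbb E\big[X(z)\,\overline{Y(z')}\big],\qquad \operatorname{Cor}[X]=\operatorname{Cor}[X,X].$$ Then for all $x,x'\in\mathbb R^3\setminus\overline B$, that is, for all points outside the interface, the random variables $u_{\rm s}(x)$ and $u_{\rm s}(x')$ have finite second moments, the integrands below are integrable over $T$ and over $T\times T$, respectively, and $$\mathbb E[u_{\rm s}](x)=\int_T\Big\{\frac{\partial\Phi(x,z)}{\partial n_z}\,\mathbb E[u_{\rm s}](z)-\Phi(x,z)\,\mathbb E\Big[\frac{\partial u_{\rm s}}{\partial n}\Big](z)\Big\}\,d\sigma_z,$$ $$\begin{aligned}\operatorname{Cor}[u_{\rm s}](x,x')=\int_T\int_T\Big\{&\Phi(x,z)\overline{\Phi(x',z')}\operatorname{Cor}\Big[\frac{\partial u_{\rm s}}{\partial n}\Big](z,z')-\Phi(x,z)\overline{\frac{\partial\Phi(x',z')}{\partial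 n_{z'}}}\operatorname{Cor}\Big[\frac{\partial u_{\rm s}}{\partial n},u_{\rm s}\Big](z,z')\\&-\frac{\partial\Phi(x,z)}{\partial n_z}\overline{\Phi(x',z')}\operatorname{Cor}\Big[u_{\rm s},\frac{\partial u_{\rm s}}{\partial n}\Big](z,z')+\frac{\partial\Phi(x,z)}{\partial n_z}\overline{\frac{\partial\Phi(x',z')}{\partial n_{z'}}}\operatorname{Cor}[u_{\rm s}](z,z')\Big\}\,d\sigma_{z'}\,d\sigma_z.\end{aligned}$$ Moreover, the covariance $\operatorname{Cov}[u_{\rm s}](x,x')=\mathbb E\big[(u_{\rm s}(x)-\mathbb E[u_{\rm s}](x))\overline{(u_{\rm s}(x')-\mathbb E[u_{\rm s}](x'))}\big]$ equals $\operatorname{Cor}[u_{\rm s}](x,x')-\mathbb E[u_{\rm s}](x)\overline{\mathbb E[u_{\rm s}](x')}$, and the variance $\mathbb V[u_{\rm s}](x)=\mathbb E\big[|u_{\rm s}(x)-\mathbb E[u_{\rm s}](x)|^2\big]$ satisfies $$\mathbb V[u_{\rm s}](x)=\operatorname{Cov}[u_{\rm s}](x,x)=\operatorname{Cor}[u_{\rm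 s}](x,x)-|\mathbb E[u_{\rm s}](x)|^2.$$ -/

import Mathlib

open MeasureTheory
open scoped InnerProductSpace ComplexConjugate

noncomputable section

namespace RandomScattering

/-- Three-dimensional Euclidean space. -/
abbrev E3 : Type := EuclideanSpace ℝ (Fin 3)

/-! ### Lipschitz domains, surface measure, outward normal -/

/-- A bounded open set `B ⊆ ℝ³` with Lipschitz boundary: near each boundary point `z`, in a
direction `e`, the set `B` is the strict subgraph of a Lipschitz function of the component
`y - ⟪e, y⟫ e` of `y` orthogonal to `e`. -/
structure IsLipschitzDomain (B : Set E3) : Prop where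
  isOpen : IsOpen B
  isBounded : Bornology.IsBounded B
  exists_graph : ∀ z ∈ frontier B, ∃ (e : E3) (g : E3 → ℝ) (L : NNReal) (r : ℝ),
    ‖e‖ = 1 ∧ LipschitzWith L g ∧ 0 < r ∧
      ∀ y ∈ Metric.ball z r, y ∈ B ↔ ⟪e, y⟫_ℝ < g (y - ⟪e, y⟫_ℝ • e)

/-- The surface measure on `∂B`: the two-dimensional Hausdorff measure, normalised so that it is
the area on planes, restricted to `∂B`. -/
def surfaceMeasure (B : Set E3) : Measure E3 :=
  (Measure.euclideanHausdorffMeasure 2 : Measure E3).restrict (frontier B)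

/-- `ν` is the outward unit normal of `B` at `z`: outside every double cone around the plane
`z + ν^⊥`, the set `B` coincides near `z` with the half-space on the side of `-ν`. -/
def IsOuterUnitNormal (B : Set E3) (z ν : E3) : Prop :=
  ‖ν‖ = 1 ∧ ∀ ε > 0, ∃ δ > 0, ∀ y ∈ Metric.ball z δ,
    (⟪y - z, ν⟫_ℝ < -ε * ‖y - z‖ → y ∈ B) ∧ (ε * ‖y - z‖ < ⟪y - z, ν⟫_ℝ → y ∉ B)

theorem IsOuterUnitNormal.unique {B : Set E3} {z ν ν' : E3} (h : IsOuterUnitNormal B z ν)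
    (h' : IsOuterUnitNormal B z ν') : ν = ν' := by
  by_contra hne
  have hv : 0 < ‖ν' - ν‖ := norm_pos_iff.2 (sub_ne_zero.2 (Ne.symm hne))
  have e1 : ‖ν' - ν‖ ^ 2 = 2 - 2 * ⟪ν', ν⟫_ℝ := by
    rw [norm_sub_sq_real, h.1, h'.1]; ring
  have e2 : ⟪ν' - ν, ν⟫_ℝ = -(‖ν' - ν‖ ^ 2 / 2) := by
    rw [e1, inner_sub_left, real_inner_self_eq_norm_sq, h.1]; ring
  have e3 : ⟪ν' - ν, ν'⟫_ℝ = ‖ν' - ν‖ ^ 2 / 2 := by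
    rw [e1, inner_sub_left, real_inner_self_eq_norm_sq, h'.1, real_inner_comm]; ring
  obtain ⟨δ, hδ, H⟩ := h.2 (‖ν' - ν‖ / 4) (by positivity)
  obtain ⟨δ', hδ', H'⟩ := h'.2 (‖ν' - ν‖ / 4) (by positivity)
  obtain ⟨m, hm, hmδ, hmδ'⟩ : ∃ m : ℝ, 0 < m ∧ m < δ ∧ m < δ' := by
    refine ⟨min δ δ' / 2, by positivity, ?_, ?_⟩
    · have := min_le_left δ δ'; linarith
    · have := min_le_right δ δ'; linarith
  set t : ℝ := m / ‖ν' - ν‖ with ht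
  have htpos : 0 < t := by positivity
  have htv : t * ‖ν' - ν‖ = m := by rw [ht]; field_simp
  have hnorm : ‖t • (ν' - ν)‖ = t * ‖ν' - ν‖ := by
    rw [norm_smul, Real.norm_of_nonneg htpos.le]
  have hy : z + t • (ν' - ν) - z = t • (ν' - ν) := by abel
  have hpos : 0 < t * ‖ν' - ν‖ ^ 2 := by positivity
  have A := (H (z + t • (ν' - ν)) (by
    rw [mem_ball_iff_norm, hy, hnorm, htv]; exact hmδ)).1 (by
    rw [hy, hnorm, real_inner_smul_left, e2]; nlinarith)
  exact (H' (z + t • (ν' - ν)) (by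
    rw [mem_ball_iff_norm, hy, hnorm, htv]; exact hmδ')).2 (by
    rw [hy, hnorm, real_inner_smul_left, e3]; nlinarith) A

open Classical in
/-- The outward unit normal field on `∂B`; the value at points without a normal is `0`. -/
def outerNormal (B : Set E3) (z : E3) : E3 :=
  if h : ∃ ν, IsOuterUnitNormal B z ν then h.choose else 0

/-- The derivative of `f` at `z` in the direction of the outward unit normal of `B`. -/
def normalDeriv (B : Set E3) (f : E3 → ℂ) (z : E3) : ℂ :=
  fderiv ℝ f z (outerNormal B z)

/-! ### The scattering problem -/

/-- The outgoing fundamental solution `Φ(x, z) = exp(iκ|x - z|) / (4π|x - z|)`. -/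
def greenFun (κ : ℝ) (x z : E3) : ℂ :=
  Complex.exp (Complex.I * (κ * ‖x - z‖ : ℝ)) / (4 * Real.pi * ‖x - z‖ : ℝ)

/-- The kernel `∂Φ(x, z)/∂n_z` for `z ∈ ∂B`. -/
def greenNormal (κ : ℝ) (B : Set E3) (x z : E3) : ℂ :=
  normalDeriv B (fun w => greenFun κ x w) z

/-- The incident plane wave `exp(iκ⟨d, x⟩)`. -/
def planeWave (κ : ℝ) (d x : E3) : ℂ :=
  Complex.exp (Complex.I * (κ * ⟪d, x⟫_ℝ : ℝ))

/-- `us` is the scattered wave of the incident plane wave with wavenumber `κ` and direction `d`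
at the sound-soft obstacle `D` (values of `us` inside `D` are irrelevant): the total wave
`u = u_inc + us` is a classical solution of the exterior Dirichlet problem for the Helmholtz
equation, and `us` satisfies Sommerfeld's radiation condition uniformly in all directions. -/
structure IsScatteredWave (κ : ℝ) (d : E3) (D : Set E3) (us : E3 → ℂ) : Prop where
  contDiffOn : ContDiffOn ℝ 2 (fun x => planeWave κ d x + us x) (closure D)ᶜ
  helmholtz : ∀ x ∈ (closure D)ᶜ,
    Laplacian.laplacian (fun x => planeWave κ d x + us x) x +
      (κ : ℂ) ^ 2 * (planeWave κ d x + us x) = 0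
  continuousOn : ContinuousOn (fun x => planeWave κ d x + us x) Dᶜ
  soundSoft : ∀ x ∈ frontier D, planeWave κ d x + us x = 0
  radiation : Filter.Tendsto
    (fun x : E3 => (‖x‖ : ℂ) * (fderiv ℝ us x (‖x‖⁻¹ • x) - Complex.I * κ * us x))
    (Bornology.cobounded E3) (nhds 0)

/-! ### Moments of complex random fields -/

section Moments

variable {Ω : Type*} [MeasurableSpace Ω]

/-- The mean `𝔼[X](x)`. -/
def mean (P : Measure Ω) (X : Ω → E3 → ℂ) (x : E3) : ℂ :=
  ∫ ω, X ω x ∂P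

/-- The correlation `Cor[X, Y](x, x') = 𝔼[X(x) conj(Y(x'))]`. -/
def cor (P : Measure Ω) (X Y : Ω → E3 → ℂ) (x x' : E3) : ℂ :=
  ∫ ω, X ω x * conj (Y ω x') ∂P

/-- The covariance `Cov[X](x, x')`. -/
def cov (P : Measure Ω) (X : Ω → E3 → ℂ) (x x' : E3) : ℂ :=
  ∫ ω, (X ω x - mean P X x) * conj (X ω x' - mean P X x') ∂P

/-- The variance `𝕍[X](x) = 𝔼[|X(x) - 𝔼[X](x)|²]`. -/
def var (P : Measure Ω) (X : Ω → E3 → ℂ) (x : E3) : ℝ :=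
  ∫ ω, ‖X ω x - mean P X x‖ ^ 2 ∂P

end Moments

/-- The integrand of the boundary integral over `∂B` for the mean at `x`. -/
def meanIntegrand {Ω : Type*} [MeasurableSpace Ω] (κ : ℝ) (B : Set E3) (P : Measure Ω)
    (us : Ω → E3 → ℂ) (x z : E3) : ℂ :=
  greenNormal κ B x z * mean P us z
    - greenFun κ x z * mean P (fun ω => normalDeriv B (us ω)) z

/-- The integrand of the double boundary integral over `∂B × ∂B` for the correlation at
`(x, x')`. -/
def corIntegrand {Ω : Type*} [MeasurableSpace Ω] (κ : ℝ) (B : Set E3) (P : Measure Ω)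
    (us : Ω → E3 → ℂ) (x x' z z' : E3) : ℂ :=
  greenFun κ x z * conj (greenFun κ x' z') *
      cor P (fun ω => normalDeriv B (us ω)) (fun ω => normalDeriv B (us ω)) z z'
    - greenFun κ x z * conj (greenNormal κ B x' z') *
      cor P (fun ω => normalDeriv B (us ω)) us z z'
    - greenNormal κ B x z * conj (greenFun κ x' z') *
      cor P us (fun ω => normalDeriv B (us ω)) z z'
    + greenNormal κ B x z * conj (greenNormal κ B x' z') *
      cor P us us z z'

end RandomScattering

end

open MeasureTheory
open scoped InnerProductSpace ComplexConjugate

noncomputable section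

namespace RandomScattering

open Set Filter Topology
open scoped NNReal ENNReal Gradient

/-! For almost every `ω` the scattered wave is a radiating Helmholtz solution outside the compact
set `closure (D ω) ⊆ B`. Green's representation formula therefore writes its value at `x ∉ closure
B` as an integral over `∂B` of deterministic kernels against the Cauchy data. The kernels are
bounded on `∂B` and the surface measure is finite, so the integrand `waveDensity` is square
integrable on `Ω × ∂B`. Fubini then carries the expectation inside. For the mean this is one
exchange of integrals. For the correlation, the product of two boundary integrals is a double
integral over `∂B × ∂B`, and the expectation of its integrand expands sesquilinearly into the four
correlations. The same argument applied to one density with itself gives the second moments;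
covariance and variance are then algebra.

The analytic weight lies in `IsLipschitzDomain.representation`. It needs the divergence theorem on a
Lipschitz domain with Hausdorff surface measure. A partition of unity reduces this to subgraphs of
Lipschitz functions. A vertical shear flattens such a subgraph; the part of the derivative along the
sheared levels integrates to zero, and the vertical part is integrated by the fundamental theorem of
calculus. The area formula `IsFrame.euclideanHausdorffMeasure_graph` turns the resulting integral
over the plane into a surface integral.

Spheres around the pole and at infinity are replaced by smooth radial cutoffs. For two Helmholtz
solutions the field `u ∇w - w ∇u` is divergence free, so its flux is measured by pairing it with the
gradient of a cutoff. With `w` the fundamental solution, the flux near the pole tends to `u x` by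
rescaling (`tendsto_flux_near_pole`). The flux at infinity tends to zero (`tendsto_flux_far`): the
conserved flux of `u` against its conjugate bounds `u` in mean square on large shells, and both `u`
and the fundamental solution satisfy the radiation condition. -/

/-! ### Orthonormal coordinates with a prescribed vertical axis -/

/-- The Euclidean plane. -/
abbrev E2 : Type := EuclideanSpace ℝ (Fin 2)

/-- Orthonormal coordinates `(p, t)` of `ℝ³` with vertical axis `e`. -/
structure IsFrame (e : E3) (Ψ : (E2 × ℝ) ≃L[ℝ] E3) : Prop where
  measurePreserving : MeasurePreserving Ψ volume volume
  inner_apply : ∀ a b : E2 × ℝ, ⟪Ψ a, Ψ b⟫_ℝ = ⟪a.1, b.1⟫_ℝ + a.2 * b.2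
  apply_vertical : Ψ (0, 1) = e

/-- An orthonormal basis of the plane orthogonal to `e` supplies the horizontal coordinates. The
product `E2 × ℝ` carries the sup norm, so the isometry lives on `WithLp 2 (E2 × ℝ)`; passing between
the two preserves volume, and the inner product survives only as an explicit formula. -/
theorem exists_isFrame {e : E3} (he : ‖e‖ = 1) : ∃ Ψ, IsFrame e Ψ := by
  have he0 : e ≠ 0 := by rintro rfl; simp at he
  have : Fact (Module.finrank ℝ E3 = 2 + 1) := ⟨by simp⟩
  let b := OrthonormalBasis.fromOrthogonalSpanSingleton (𝕜 := ℝ) 2 he0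
  let ι : E2 →ₗᵢ[ℝ] E3 := (ℝ ∙ e)ᗮ.subtypeₗᵢ.comp b.repr.symm.toLinearIsometry
  have hι : ∀ p, ⟪e, ι p⟫_ℝ = 0 := fun p =>
    Submodule.mem_orthogonal_singleton_iff_inner_right.1 (b.repr.symm p).2
  let F : E2 × ℝ →ₗ[ℝ] E3 := ι.toLinearMap.coprod (LinearMap.toSpanSingleton ℝ E3 e)
  have hF : ∀ a, F a = ι a.1 + a.2 • e := fun a => by simp [F]
  have hin : ∀ a b, ⟪F a, F b⟫_ℝ = ⟪a.1, b.1⟫_ℝ + a.2 * b.2 := by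
    intro a b
    have h1 := hι b.1
    have h2 := hι a.1
    rw [real_inner_comm] at h2
    rw [hF, hF, inner_add_left, inner_add_right, inner_add_right, ι.inner_map_map,
      real_inner_smul_left, real_inner_smul_left, real_inner_smul_right, real_inner_smul_right,
      h1, h2, real_inner_self_eq_norm_sq, he]
    ring
  let G : WithLp 2 (E2 × ℝ) →ₗᵢ[ℝ] E3 :=
    (F ∘ₗ (WithLp.linearEquiv 2 ℝ (E2 × ℝ)).toLinearMap).isometryOfInner (by
      intro x y
      simp only [LinearMap.coe_comp, Function.comp_apply, hin]
      simp [mul_comm])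
  have hfr : Module.finrank ℝ (WithLp 2 (E2 × ℝ)) = Module.finrank ℝ E3 := by
    rw [(WithLp.linearEquiv 2 ℝ (E2 × ℝ)).finrank_eq]; simp
  let G' := G.toLinearIsometryEquiv hfr
  let Ψ : (E2 × ℝ) ≃L[ℝ] E3 :=
    (WithLp.prodContinuousLinearEquiv 2 ℝ E2 ℝ).symm.trans G'.toContinuousLinearEquiv
  have hΨ : ∀ a, Ψ a = F a := fun a => rfl
  refine ⟨Ψ, ?_, ?_, ?_⟩
  · exact G'.measurePreserving.comp (WithLp.volume_preserving_toLp E2 ℝ)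
  · intro a b; rw [hΨ, hΨ, hin]
  · rw [hΨ, hF]; simp

namespace IsFrame

variable {e : E3} {Ψ : (E2 × ℝ) ≃L[ℝ] E3}

theorem norm_sq_apply (h : IsFrame e Ψ) (a : E2 × ℝ) : ‖Ψ a‖ ^ 2 = ‖a.1‖ ^ 2 + a.2 ^ 2 := by
  rw [← real_inner_self_eq_norm_sq, h.inner_apply, real_inner_self_eq_norm_sq]; ring

theorem norm_fst_le (h : IsFrame e Ψ) (a : E2 × ℝ) : ‖a.1‖ ≤ ‖Ψ a‖ :=
  (sq_le_sq₀ (norm_nonneg _) (norm_nonneg _)).1 (by rw [h.norm_sq_apply]; nlinarith [sq_nonneg a.2])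

theorem norm_vertical (h : IsFrame e Ψ) (t : ℝ) : ‖Ψ (0, t)‖ = |t| := by
  have := h.norm_sq_apply (0, t)
  simp only [norm_zero] at this
  rw [← abs_norm, ← sq_eq_sq_iff_abs_eq_abs, this]; ring

theorem norm_horizontal (h : IsFrame e Ψ) (p : E2) : ‖Ψ (p, 0)‖ = ‖p‖ := by
  have := h.norm_sq_apply (p, 0)
  rw [← abs_norm, ← abs_norm p, ← sq_eq_sq_iff_abs_eq_abs, this]; ring

theorem inner_vertical (h : IsFrame e Ψ) (a : E2 × ℝ) : ⟪e, Ψ a⟫_ℝ = a.2 := by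
  rw [← h.apply_vertical, h.inner_apply]; simp

theorem apply_eq (h : IsFrame e Ψ) (a : E2 × ℝ) : Ψ a = Ψ (a.1, 0) + a.2 • e := by
  rw [← h.apply_vertical, ← map_smul, ← map_add]; simp

end IsFrame

/-! ### Area formula for Lipschitz graphs -/

/-- The parametrisation of the graph of `γ`. -/
def graphMap (Ψ : (E2 × ℝ) ≃L[ℝ] E3) (γ : E2 → ℝ) (p : E2) : E3 := Ψ (p, γ p)

/-- The hypothesis makes `f` constant on the fibres of `g` in `A`, so `f` factors through `g` by a
`K`-Lipschitz map, and two-dimensional Hausdorff measure grows by at most `K ^ 2`. This allows a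
graph to be compared directly with its linear approximation. -/
theorem euclideanHausdorffMeasure_image_le {f g : E2 → E3} {A : Set E2} {K : ℝ≥0}
    (h : ∀ p ∈ A, ∀ q ∈ A, dist (f p) (f q) ≤ K * dist (g p) (g q)) :
    Measure.euclideanHausdorffMeasure 2 (f '' A) ≤
      (K : ℝ≥0∞) ^ 2 * Measure.euclideanHausdorffMeasure 2 (g '' A) := by
  let k : E3 → E3 := fun y => f (Function.invFunOn g A y)
  have hk : ∀ p ∈ A, k (g p) = f p := by
    intro p hp
    have h1 : Function.invFunOn g A (g p) ∈ A := Function.invFunOn_mem ⟨p, hp, rfl⟩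
    have h2 : g (Function.invFunOn g A (g p)) = g p := Function.invFunOn_eq ⟨p, hp, rfl⟩
    have := h _ h1 p hp
    rw [h2, dist_self, mul_zero] at this
    exact dist_le_zero.1 this
  have himg : f '' A = k '' (g '' A) := by
    rw [image_image]; exact image_congr fun p hp => (hk p hp).symm
  have hL : LipschitzOnWith K k (g '' A) := by
    refine LipschitzOnWith.of_dist_le_mul ?_
    rintro _ ⟨p, hp, rfl⟩ _ ⟨q, hq, rfl⟩
    rw [hk p hp, hk q hq]; exact h p hp q hq
  have := hL.hausdorffMeasure_image_le (d := ((2 : ℕ) : ℝ)) (by norm_num)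
  rw [himg, Measure.euclideanHausdorffMeasure_def, Measure.smul_apply, Measure.smul_apply,
    ENNReal.smul_def, ENNReal.smul_def, smul_eq_mul, smul_eq_mul]
  rw [ENNReal.rpow_natCast] at this
  calc _ ≤ _ := mul_le_mul_right this _
    _ = _ := by ring

/-- The surface element of the graph with slope `A`. -/
def graphDensity (A : E2 →L[ℝ] ℝ) : ℝ := √(1 + ‖A‖ ^ 2)

theorem one_le_graphDensity (A : E2 →L[ℝ] ℝ) : 1 ≤ graphDensity A := by
  unfold graphDensity; rw [Real.one_le_sqrt]; nlinarith [sq_nonneg ‖A‖]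

/-- The surface element is 1-Lipschitz in the slope and at least 1, so an additive error in the
slope becomes a relative error, which combines with the Lipschitz factors of the Hausdorff measure.
-/
theorem graphDensity_le (A A' : E2 →L[ℝ] ℝ) : graphDensity A ≤ (1 + ‖A - A'‖) * graphDensity A' := by
  have h1 := one_le_graphDensity A'
  have h2 : graphDensity A' ^ 2 = 1 + ‖A'‖ ^ 2 := Real.sq_sqrt (by positivity)
  have h3 : ‖A‖ ≤ ‖A - A'‖ + ‖A'‖ := by simpa using norm_add_le (A - A') A'
  have h4 : ‖A'‖ ≤ graphDensity A' := Real.le_sqrt_of_sq_le (by linarith)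
  have h5 := norm_nonneg (A - A')
  have h0 := norm_nonneg A
  unfold graphDensity at h1 h2 h4 ⊢
  rw [Real.sqrt_le_left (by positivity)]
  have : ‖A‖ ^ 2 ≤ (‖A - A'‖ + ‖A'‖) ^ 2 := by gcongr
  have h6 : ‖A - A'‖ * ‖A'‖ ≤ ‖A - A'‖ * √(1 + ‖A'‖ ^ 2) ^ 2 := by
    gcongr; nlinarith
  nlinarith [mul_nonneg h5 h5]

theorem continuous_graphDensity : Continuous graphDensity := by
  unfold graphDensity; fun_prop

/-- The area factor of a linear map is the root of its Gram determinant. Here that determinant is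
`(1 + a²)(1 + b²) - (ab)² = 1 + a² + b²`, with `a`, `b` the components of `A`. -/
theorem euclideanHausdorffMeasure_linear_graph {e : E3} {Ψ : (E2 × ℝ) ≃L[ℝ] E3} (h : IsFrame e Ψ)
    (A : E2 →L[ℝ] ℝ) (s : Set E2) :
    Measure.euclideanHausdorffMeasure 2 (graphMap Ψ A '' s) =
      ENNReal.ofReal (graphDensity A) * volume s := by
  let T : E2 →ₗ[ℝ] E3 := Ψ.toLinearEquiv.toLinearMap ∘ₗ (LinearMap.id.prod A.toLinearMap)
  have hT : ⇑T = graphMap Ψ A := rfl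
  have h1 := T.euclideanHausdorffMeasure_image_eq_normDet_mul_volume s
  have hf : Module.finrank ℝ E2 = 2 := by simp
  rw [hf, hT] at h1
  rw [h1]
  congr 2
  have h2 := T.normDet_sq_eq_det_gram (EuclideanSpace.basisFun (Fin 2) ℝ)
  rw [Matrix.det_fin_two] at h2
  simp only [Matrix.gram_apply, hT, graphMap, h.inner_apply] at h2
  have hA : ‖A‖ ^ 2 = A (EuclideanSpace.basisFun (Fin 2) ℝ 0) ^ 2
      + A (EuclideanSpace.basisFun (Fin 2) ℝ 1) ^ 2 := by
    obtain ⟨w, rfl⟩ := (InnerProductSpace.toDual ℝ E2).surjective A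
    rw [LinearIsometryEquiv.norm_map, EuclideanSpace.norm_sq_eq, Fin.sum_univ_two]
    simp [InnerProductSpace.toDual_apply_apply, EuclideanSpace.inner_single_right]
  unfold graphDensity
  rw [eq_comm, Real.sqrt_eq_iff_eq_sq (by positivity) T.normDet_nonneg, hA]
  simp [EuclideanSpace.inner_single_right] at h2 ⊢
  rw [h2]; ring

section GraphArea

variable {e : E3} {Ψ : (E2 × ℝ) ≃L[ℝ] E3} {γ : E2 → ℝ} {L : ℝ≥0}

theorem continuous_graphMap (hγ : Continuous γ) : Continuous (graphMap Ψ γ) := by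
  unfold graphMap; fun_prop

theorem injective_graphMap : Function.Injective (graphMap Ψ γ) := fun p q h => by
  have := Ψ.injective h
  exact congrArg Prod.fst this

theorem measurableEmbedding_graphMap (hγ : Continuous γ) : MeasurableEmbedding (graphMap Ψ γ) :=
  (continuous_graphMap hγ).measurableEmbedding injective_graphMap

theorem measurable_graphDensity_fderiv :
    Measurable fun p => ENNReal.ofReal (graphDensity (fderiv ℝ γ p)) :=
  (continuous_graphDensity.measurable.comp (measurable_fderiv ℝ γ)).ennreal_ofReal

/-- The two chords differ by a vertical vector of length at most `δ * ‖p - q‖`, and `‖p - q‖` is at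
most the chord of the linear graph. The error is thus relative. -/
theorem IsFrame.norm_graphMap_sub_sub_le (h : IsFrame e Ψ) {A : E2 →L[ℝ] ℝ} {s : Set E2} {δ : ℝ≥0}
    (hA : ApproximatesLinearOn γ A s δ) {p q : E2} (hp : p ∈ s) (hq : q ∈ s) :
    |dist (graphMap Ψ γ p) (graphMap Ψ γ q) - dist (graphMap Ψ A p) (graphMap Ψ A q)|
      ≤ δ * dist (graphMap Ψ A p) (graphMap Ψ A q) := by
  have h1 : graphMap Ψ γ p - graphMap Ψ γ q - (graphMap Ψ A p - graphMap Ψ A q)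
      = Ψ (0, γ p - γ q - A (p - q)) := by
    simp only [graphMap, ← map_sub]
    congr 1
    ext <;> simp
  have h2 : ‖p - q‖ ≤ ‖graphMap Ψ A p - graphMap Ψ A q‖ := by
    simp only [graphMap, ← map_sub]
    exact h.norm_fst_le ((p, A p) - (q, A q))
  rw [dist_eq_norm, dist_eq_norm]
  calc _ ≤ _ := abs_norm_sub_norm_le _ _
    _ = ‖γ p - γ q - A (p - q)‖ := by rw [h1, h.norm_vertical]; rfl
    _ ≤ δ * ‖p - q‖ := hA p hp q hq
    _ ≤ _ := by gcongr

/-- At density points of `s` the linear approximation controls the derivative. The bound invoked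
concerns self-maps of a space, so `γ` is made plane-valued by multiplying with a unit vector `w`,
which leaves operator norms unchanged. -/
theorem ae_norm_fderiv_sub_le {A : E2 →L[ℝ] ℝ} {s : Set E2} {δ : ℝ≥0} (hs : MeasurableSet s)
    (hA : ApproximatesLinearOn γ A s δ) (hd : ∀ p ∈ s, DifferentiableAt ℝ γ p) :
    ∀ᵐ p ∂volume.restrict s, ‖fderiv ℝ γ p - A‖ ≤ δ := by
  let w : E2 := EuclideanSpace.single 0 1
  have hw : ‖w‖ = 1 := by simp [w]
  have h1 : ApproximatesLinearOn (fun p => γ p • w) (A.smulRight w) s δ := by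
    intro p hp q hq
    have : γ p • w - γ q • w - (A.smulRight w) (p - q) = (γ p - γ q - A (p - q)) • w := by
      simp only [ContinuousLinearMap.smulRight_apply, sub_smul]
    rw [this, norm_smul, hw, mul_one]
    exact hA p hp q hq
  have h2 := h1.norm_fderiv_sub_le volume hs (fun p => (fderiv ℝ γ p).smulRight w)
    (fun p hp => ((hd p hp).hasFDerivAt.smul_const w).hasFDerivWithinAt)
  filter_upwards [h2] with p hp
  have : (fderiv ℝ γ p).smulRight w - A.smulRight w = (fderiv ℝ γ p - A).smulRight w := by
    ext; simp [sub_mul]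
  have h3 : ‖(fderiv ℝ γ p - A).smulRight w‖ ≤ δ := by rw [← this]; exact hp
  rwa [ContinuousLinearMap.norm_smulRight_apply, hw, mul_one] at h3

theorem ennreal_le_of_forall_mul_le {x y : ℝ≥0∞} {c : ℝ → ℝ} (hc : ContinuousAt c 0) (hc0 : c 0 = 1)
    (h : ∀ δ : ℝ, 0 < δ → δ < 1 → x ≤ ENNReal.ofReal (c δ) * y) : x ≤ y := by
  have h1 : Tendsto (fun δ => ENNReal.ofReal (c δ) * y) (𝓝[>] 0) (𝓝 (1 * y)) := by
    refine ENNReal.Tendsto.mul_const ?_ (Or.inl one_ne_zero)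
    have := (ENNReal.tendsto_ofReal hc.tendsto).mono_left (nhdsWithin_le_nhds (s := Ioi 0))
    simpa [hc0] using this
  rw [one_mul] at h1
  refine ge_of_tendsto h1 ?_
  filter_upwards [Ioo_mem_nhdsGT (show (0 : ℝ) < 1 by norm_num)] with δ hδ
  exact h δ hδ.1 hδ.2

/-- Both sides are compared with the linear graph of slope `A`. The chord comparison costs a squared
factor `1 + δ` or `(1 - δ)⁻¹`, since areas scale quadratically; replacing one surface element by the
other costs one more factor `1 + δ`. -/
theorem IsFrame.area_graph_piece (h : IsFrame e Ψ) {A : E2 →L[ℝ] ℝ} {s : Set E2} {δ : ℝ≥0}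
    (hδ : δ < 1) (hs : MeasurableSet s) (hA : ApproximatesLinearOn γ A s δ)
    (hd : ∀ p ∈ s, DifferentiableAt ℝ γ p) :
    Measure.euclideanHausdorffMeasure 2 (graphMap Ψ γ '' s) ≤ ENNReal.ofReal ((1 + δ) ^ 3) *
        ∫⁻ p in s, ENNReal.ofReal (graphDensity (fderiv ℝ γ p)) ∧
    ∫⁻ p in s, ENNReal.ofReal (graphDensity (fderiv ℝ γ p)) ≤
      ENNReal.ofReal ((1 + δ) * ((1 - (δ : ℝ))⁻¹) ^ 2) *
        Measure.euclideanHausdorffMeasure 2 (graphMap Ψ γ '' s) := by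
  have hδ' : (δ : ℝ) < 1 := by exact_mod_cast hδ
  have hae := ae_norm_fderiv_sub_le hs hA hd
  have hlin := euclideanHausdorffMeasure_linear_graph h A s
  constructor
  · calc Measure.euclideanHausdorffMeasure 2 (graphMap Ψ γ '' s)
        ≤ ((1 + δ : ℝ≥0) : ℝ≥0∞) ^ 2 * Measure.euclideanHausdorffMeasure 2 (graphMap Ψ A '' s) := by
          refine euclideanHausdorffMeasure_image_le fun p hp q hq => ?_
          have := abs_le.1 (h.norm_graphMap_sub_sub_le hA hp hq)
          push_cast
          linarith [this.2]
      _ = ENNReal.ofReal ((1 + δ) ^ 2) * ∫⁻ p in s, ENNReal.ofReal (graphDensity A) := by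
          rw [hlin, lintegral_const, Measure.restrict_apply_univ, ← ENNReal.ofReal_coe_nnreal,
            ENNReal.ofReal_pow (by positivity)]
          push_cast; rfl
      _ ≤ ENNReal.ofReal ((1 + δ) ^ 2) * ∫⁻ p in s,
            ENNReal.ofReal (1 + δ) * ENNReal.ofReal (graphDensity (fderiv ℝ γ p)) := by
          gcongr ENNReal.ofReal ((1 + δ) ^ 2) * ?_
          refine lintegral_mono_ae ?_
          filter_upwards [hae] with p hp
          rw [← ENNReal.ofReal_mul (by positivity)]
          refine ENNReal.ofReal_le_ofReal ((graphDensity_le A (fderiv ℝ γ p)).trans ?_)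
          rw [norm_sub_rev]
          have := one_le_graphDensity (fderiv ℝ γ p)
          gcongr
      _ = _ := by
          rw [lintegral_const_mul _ measurable_graphDensity_fderiv, ← mul_assoc,
            ← ENNReal.ofReal_mul (by positivity)]
          congr 2
  · have h1 : 0 < 1 - (δ : ℝ) := by linarith
    calc ∫⁻ p in s, ENNReal.ofReal (graphDensity (fderiv ℝ γ p))
        ≤ ∫⁻ p in s, ENNReal.ofReal (1 + δ) * ENNReal.ofReal (graphDensity A) := by
          refine lintegral_mono_ae ?_
          filter_upwards [hae] with p hp
          rw [← ENNReal.ofReal_mul (by positivity)]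
          refine ENNReal.ofReal_le_ofReal ((graphDensity_le (fderiv ℝ γ p) A).trans ?_)
          have := one_le_graphDensity A
          gcongr
      _ = ENNReal.ofReal (1 + δ) * Measure.euclideanHausdorffMeasure 2 (graphMap Ψ A '' s) := by
          rw [hlin, lintegral_const, Measure.restrict_apply_univ, mul_assoc]
      _ ≤ ENNReal.ofReal (1 + δ) * (((1 - δ)⁻¹ : ℝ≥0) ^ 2 *
            Measure.euclideanHausdorffMeasure 2 (graphMap Ψ γ '' s)) := by
          gcongr
          refine euclideanHausdorffMeasure_image_le fun p hp q hq => ?_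
          have := abs_le.1 (h.norm_graphMap_sub_sub_le hA hp hq)
          rw [NNReal.coe_inv, NNReal.coe_sub hδ.le, NNReal.coe_one, ← div_eq_inv_mul,
            le_div_iff₀ h1]
          linarith [this.1]
      _ = _ := by
          rw [← mul_assoc, ENNReal.ofReal_mul (by positivity), ← ENNReal.ofReal_coe_nnreal,
            NNReal.coe_inv, NNReal.coe_sub hδ.le, ENNReal.ofReal_pow (by positivity)]
          rfl

theorem IsFrame.lipschitzWith_graphMap (h : IsFrame e Ψ) (hγ : LipschitzWith L γ) :
    LipschitzWith (1 + L) (graphMap Ψ γ) := by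
  refine LipschitzWith.of_dist_le_mul fun p q => ?_
  have h1 : graphMap Ψ γ p - graphMap Ψ γ q = Ψ (p - q, 0) + Ψ (0, γ p - γ q) := by
    simp only [graphMap, ← map_sub, ← map_add]
    congr 1; ext <;> simp
  rw [dist_eq_norm, h1]
  refine (norm_add_le _ _).trans ?_
  rw [h.norm_horizontal, h.norm_vertical, ← Real.dist_eq, ← dist_eq_norm]
  have := hγ.dist_le_mul p q
  push_cast; linarith

/-- Comparison with the flat graph. It shows that null sets of parameters have null images and that
bounded pieces of the graph have finite area. -/
theorem IsFrame.euclideanHausdorffMeasure_graph_le (h : IsFrame e Ψ) (hγ : LipschitzWith L γ)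
    (s : Set E2) : Measure.euclideanHausdorffMeasure 2 (graphMap Ψ γ '' s) ≤
      ((1 + L : ℝ≥0) : ℝ≥0∞) ^ 2 * volume s := by
  have h1 : Measure.euclideanHausdorffMeasure 2 (graphMap Ψ (0 : E2 →L[ℝ] ℝ) '' s) = volume s := by
    rw [euclideanHausdorffMeasure_linear_graph h]; simp [graphDensity]
  rw [← h1]
  refine euclideanHausdorffMeasure_image_le fun p _ q _ => ?_
  refine ((h.lipschitzWith_graphMap hγ).dist_le_mul p q).trans ?_
  refine mul_le_mul_of_nonneg_left ?_ (NNReal.coe_nonneg _)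
  have h2 : ‖p - q‖ ≤ ‖Ψ (p, 0) - Ψ (q, 0)‖ := by
    rw [← map_sub, Prod.mk_sub_mk, sub_zero, h.norm_horizontal]
  rw [dist_eq_norm, dist_eq_norm]
  simpa only [graphMap, _root_.zero_apply] using h2

/-- The area formula for Lipschitz graphs. -/
theorem IsFrame.euclideanHausdorffMeasure_graph (h : IsFrame e Ψ) (hγ : LipschitzWith L γ)
    {s : Set E2} (hs : MeasurableSet s) :
    Measure.euclideanHausdorffMeasure 2 (graphMap Ψ γ '' s) =
      ∫⁻ p in s, ENNReal.ofReal (graphDensity (fderiv ℝ γ p)) := by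
  -- By Rademacher's theorem the points of non-differentiability are null in the plane, and their
  -- image on the graph is null by the crude Lipschitz bound.
  wlog hd : ∀ p ∈ s, DifferentiableAt ℝ γ p generalizing s
  · set N := {p | DifferentiableAt ℝ γ p} with hN
    have hNm : MeasurableSet N := measurableSet_of_differentiableAt ℝ γ
    have hN0 : volume Nᶜ = 0 := hγ.ae_differentiableAt
    have h1 := this (hs.inter hNm) (fun p hp => hp.2)
    have h2 : volume (s \ N) = 0 := measure_mono_null (fun p hp => hp.2) hN0
    have h3 : Measure.euclideanHausdorffMeasure 2 (graphMap Ψ γ '' (s \ N)) = 0 := by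
      refine le_antisymm ((h.euclideanHausdorffMeasure_graph_le hγ _).trans ?_) zero_le
      rw [h2, mul_zero]
    have h4 : graphMap Ψ γ '' s = graphMap Ψ γ '' (s ∩ N) ∪ graphMap Ψ γ '' (s \ N) := by
      rw [← image_union, inter_union_sdiff]
    rw [h4, measure_congr (union_ae_eq_left_of_ae_eq_empty (ae_eq_empty.2 h3)), h1, ← lintegral_inter_add_sdiff _ s hNm,
      Measure.restrict_eq_zero.2 h2, lintegral_zero_measure, add_zero]
  have key : ∀ δ : ℝ≥0, 0 < δ → δ < 1 →
      Measure.euclideanHausdorffMeasure 2 (graphMap Ψ γ '' s) ≤ ENNReal.ofReal ((1 + δ) ^ 3) *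
        ∫⁻ p in s, ENNReal.ofReal (graphDensity (fderiv ℝ γ p)) ∧
      ∫⁻ p in s, ENNReal.ofReal (graphDensity (fderiv ℝ γ p)) ≤
        ENNReal.ofReal ((1 + δ) * ((1 - (δ : ℝ))⁻¹) ^ 2) *
          Measure.euclideanHausdorffMeasure 2 (graphMap Ψ γ '' s) := by
    intro δ hδ0 hδ1
    -- Countably many disjoint pieces, on each of which `γ` is within `δ` of a linear map; the
    -- two-sided estimate on pieces then sums up with constants that tend to 1 as `δ → 0`.
    obtain ⟨t, A, tdisj, tmeas, tcov, tA, -⟩ :=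
      exists_partition_approximatesLinearOn_of_hasFDerivWithinAt γ s (fderiv ℝ γ)
        (fun p hp => (hd p hp).hasFDerivAt.hasFDerivWithinAt) (fun _ => δ) (fun _ => hδ0.ne')
    have hpiece := fun n => h.area_graph_piece hδ1 (hs.inter (tmeas n)) (tA n)
      (fun p hp => hd p hp.1)
    have hsU : s = ⋃ n, s ∩ t n := by rw [← inter_iUnion, inter_eq_left.2 tcov]
    have hdisj : Pairwise (Function.onFun Disjoint fun n => s ∩ t n) := fun i j hij =>
      (tdisj hij).mono inter_subset_right inter_subset_right
    have e1 : Measure.euclideanHausdorffMeasure 2 (graphMap Ψ γ '' s) =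
        ∑' n, Measure.euclideanHausdorffMeasure 2 (graphMap Ψ γ '' (s ∩ t n)) := by
      conv_lhs => rw [hsU, image_iUnion]
      refine measure_iUnion (fun i j hij => ?_) fun n =>
        (measurableEmbedding_graphMap hγ.continuous).measurableSet_image.2 (hs.inter (tmeas n))
      exact (disjoint_image_iff injective_graphMap).2 (hdisj hij)
    have e2 : ∫⁻ p in s, ENNReal.ofReal (graphDensity (fderiv ℝ γ p)) =
        ∑' n, ∫⁻ p in s ∩ t n, ENNReal.ofReal (graphDensity (fderiv ℝ γ p)) := by
      conv_lhs => rw [hsU]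
      exact lintegral_iUnion (fun n => hs.inter (tmeas n)) hdisj _
    rw [e1, e2, ← ENNReal.tsum_mul_left, ← ENNReal.tsum_mul_left]
    exact ⟨ENNReal.tsum_le_tsum fun n => (hpiece n).1, ENNReal.tsum_le_tsum fun n => (hpiece n).2⟩
  refine le_antisymm ?_ ?_
  · refine ennreal_le_of_forall_mul_le (c := fun δ => (1 + δ) ^ 3) (by fun_prop) (by norm_num) ?_
    intro δ h0 h1
    exact (key ⟨δ, h0.le⟩ h0 h1).1
  · refine ennreal_le_of_forall_mul_le (c := fun δ => (1 + δ) * ((1 - δ)⁻¹) ^ 2) ?_ (by norm_num) ?_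
    · refine ContinuousAt.mul (by fun_prop) (ContinuousAt.pow (ContinuousAt.inv₀ (by fun_prop) ?_) 2)
      norm_num
    intro δ h0 h1
    exact (key ⟨δ, h0.le⟩ h0 h1).2

/-- The surface measure on a Lipschitz graph, as a push-forward from the plane. -/
theorem IsFrame.restrict_range_graphMap (h : IsFrame e Ψ) (hγ : LipschitzWith L γ) :
    (Measure.euclideanHausdorffMeasure 2 : Measure E3).restrict (range (graphMap Ψ γ)) =
      (volume.withDensity fun p => ENNReal.ofReal (graphDensity (fderiv ℝ γ p))).map
        (graphMap Ψ γ) := by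
  have hemb := measurableEmbedding_graphMap (Ψ := Ψ) hγ.continuous
  ext s hs
  rw [hemb.map_apply, Measure.restrict_apply hs, withDensity_apply _ (hemb.measurable hs),
    ← h.euclideanHausdorffMeasure_graph hγ (hemb.measurable hs), image_preimage_eq_inter_range]

end GraphArea

/-! ### Divergence theorem below a Lipschitz graph -/

section Subgraph

variable {γ : E2 → ℝ} {L : ℝ≥0}

/-- Vertical shear by a function of the horizontal variable. -/
def shear (γ : E2 → ℝ) (a : E2 × ℝ) : E2 × ℝ := (a.1, γ a.1 + a.2)

theorem measurePreserving_shear (hγ : Measurable γ) :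
    MeasurePreserving (shear γ) (volume : Measure (E2 × ℝ)) volume := by
  have hm : Measurable (Function.uncurry fun (p : E2) (t : ℝ) => γ p + t) := by
    unfold Function.uncurry; fun_prop
  exact (MeasurePreserving.id (volume : Measure E2)).skew_product hm
    (ae_of_all _ fun p => map_add_left_eq_self volume (γ p))

theorem shear_neg_shear (a : E2 × ℝ) : shear (-γ) (shear γ a) = a := by simp [shear]

theorem shear_shear_neg (a : E2 × ℝ) : shear γ (shear (-γ) a) = a := by simp [shear]

/-- The shear as a homeomorphism. -/
def shearHomeomorph (hγ : Continuous γ) : (E2 × ℝ) ≃ₜ (E2 × ℝ) where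
  toFun := shear γ
  invFun := shear (-γ)
  left_inv := shear_neg_shear
  right_inv := shear_shear_neg
  continuous_toFun := by unfold shear; fun_prop
  continuous_invFun := by
    unfold shear
    have : Continuous (-γ) := hγ.neg
    fun_prop

/-- Integration by parts against the constant 1; the direction `-v` undoes the sign that integration
by parts produces. -/
theorem integral_lineDeriv_eq_zero {φ : E2 → ℝ} {C : ℝ≥0} (hφ : LipschitzWith C φ)
    (hc : HasCompactSupport φ) (v : E2) : ∫ p, lineDeriv ℝ φ p v = 0 := by
  have h := LipschitzWith.integral_lineDeriv_mul_eq (μ := volume)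
    (LipschitzWith.const (α := E2) (1 : ℝ)) hφ hc (-v)
  simpa [lineDeriv] using h.symm

/-- The divergence theorem for the subgraph of a Lipschitz function. -/
theorem integral_subgraph_fderiv (hγ : LipschitzWith L γ) {f : E2 × ℝ → ℝ} (hf : ContDiff ℝ 1 f)
    (hc : HasCompactSupport f) (v : E2 × ℝ) :
    ∫ a in {a : E2 × ℝ | a.2 < γ a.1}, fderiv ℝ f a v =
      ∫ p, f (p, γ p) * (v.2 - fderiv ℝ γ p v.1) := by
  obtain ⟨C, hC⟩ := (hf.lipschitzWith_of_hasCompactSupport hc one_ne_zero)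
  have hfd : ∀ a, DifferentiableAt ℝ f a := fun a => hf.differentiable one_ne_zero a
  have hcont : Continuous (fderiv ℝ f) := hf.continuous_fderiv one_ne_zero
  set S := shearHomeomorph hγ.continuous with hS
  have hSa : ∀ a, S a = (a.1, γ a.1 + a.2) := fun _ => rfl
  set F : E2 × ℝ → ((E2 × ℝ) →L[ℝ] ℝ) := fun a => fderiv ℝ f (S a) with hF
  have hFc : Continuous F := hcont.comp S.continuous
  have hFs : HasCompactSupport F := (hc.fderiv (𝕜 := ℝ)).comp_homeomorph S
  have hFi : Integrable F volume := hFc.integrable_of_hasCompactSupport hFs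
  have hγm : Measurable fun a : E2 × ℝ => fderiv ℝ γ a.1 v.1 :=
    (measurable_fderiv_apply_const ℝ γ v.1).comp measurable_fst
  have hγb : ∀ p, ‖fderiv ℝ γ p v.1‖ ≤ L * ‖v.1‖ := fun p =>
    (ContinuousLinearMap.le_opNorm _ _).trans (by gcongr; exact norm_fderiv_le_of_lipschitz ℝ hγ)
  -- The direction `v` is split into `(v.1, Dγ v.1)`, tangent to the translated graphs, plus a
  -- vertical remainder. `D₂` is the derivative along the remainder and `D₁` the tangential
  -- derivative.
  set D₂ : E2 × ℝ → ℝ := fun a => F a (0, 1) * (v.2 - fderiv ℝ γ a.1 v.1) with hD₂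
  set D₁ : E2 × ℝ → ℝ := fun a => F a v - D₂ a with hD₁
  have hD₂i : Integrable D₂ volume := by
    refine Integrable.mul_bdd (c := |v.2| + L * ‖v.1‖) (hFi.apply_continuousLinearMap _)
      (measurable_const.sub hγm).aestronglyMeasurable (ae_of_all _ fun a => ?_)
    exact (norm_sub_le _ _).trans (add_le_add le_rfl (hγb _))
  have hD₁i : Integrable D₁ volume := (hFi.apply_continuousLinearMap _).sub hD₂i
  have hset : S ⁻¹' {a : E2 × ℝ | a.2 < γ a.1} = univ ×ˢ Iio 0 := by
    ext a; simp [hSa]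
  have h1 : ∫ a in {a : E2 × ℝ | a.2 < γ a.1}, fderiv ℝ f a v =
      ∫ a in univ ×ˢ Iio 0, F a v := by
    rw [← hset]
    exact ((measurePreserving_shear hγ.continuous.measurable).setIntegral_preimage_emb
      S.measurableEmbedding (fun a => fderiv ℝ f a v) _).symm
  have h2 : ∫ a in univ ×ˢ Iio 0, F a v =
      (∫ a in (univ : Set E2) ×ˢ Iio (0 : ℝ), D₁ a) + ∫ a in univ ×ˢ Iio 0, D₂ a := by
    rw [← integral_add hD₁i.integrableOn hD₂i.integrableOn]
    simp [hD₁]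
  have h3 : ∫ a in (univ : Set E2) ×ˢ Iio (0 : ℝ), D₁ a = 0 := by
    have hi : Integrable D₁ (((volume : Measure E2).restrict univ).prod
        ((volume : Measure ℝ).restrict (Iio 0))) := by
      rw [Measure.prod_restrict]; exact hD₁i.integrableOn
    rw [Measure.volume_eq_prod, ← Measure.prod_restrict, integral_prod_symm _ hi]
    rw [Measure.restrict_univ]
    -- On each level `τ` the function `D₁` is almost everywhere the derivative of the compactly
    -- supported Lipschitz function `p ↦ f (p, γ p + τ)`, so its integral over the plane vanishes.
    refine integral_eq_zero_of_ae (ae_of_all _ fun τ => ?_)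
    have hφL : LipschitzWith (C * max 1 L) (fun p => f (p, γ p + τ)) := by
      refine hC.comp (LipschitzWith.id.prodMk ?_)
      exact LipschitzWith.of_dist_le_mul fun p q => by
        simpa [dist_add_right] using hγ.dist_le_mul p q
    have hφc : HasCompactSupport (fun p => f (p, γ p + τ)) := by
      refine HasCompactSupport.intro (hc.image continuous_fst) fun p hp => ?_
      by_contra h0
      exact hp ⟨_, subset_tsupport _ h0, rfl⟩
    have h0 := integral_lineDeriv_eq_zero hφL hφc v.1
    show ∫ p, D₁ (p, τ) = 0
    rw [← h0]
    refine integral_congr_ae ?_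
    filter_upwards [hγ.ae_differentiableAt (μ := volume)] with p hp
    have hd1 : HasFDerivAt (fun p => (p, γ p + τ))
        ((ContinuousLinearMap.id ℝ E2).prod (fderiv ℝ γ p)) p :=
      (hasFDerivAt_id p).prodMk (hp.hasFDerivAt.add_const τ)
    have hd2 := ((hfd (p, γ p + τ)).hasFDerivAt.comp p hd1).hasLineDerivAt v.1
    rw [show (fun p => f (p, γ p + τ)) = f ∘ (fun p => (p, γ p + τ)) from rfl, hd2.lineDeriv]
    have hv : v = (v.1, fderiv ℝ γ p v.1) + (v.2 - fderiv ℝ γ p v.1) • ((0 : E2), (1 : ℝ)) := by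
      ext <;> simp
    simp only [hD₁, hD₂, hF, hSa]
    conv_lhs => rw [hv]
    simp only [map_add, map_smul, smul_eq_mul]
    simp
    ring
  have h4 : ∫ a in (univ : Set E2) ×ˢ Iio (0 : ℝ), D₂ a =
      ∫ p, f (p, γ p) * (v.2 - fderiv ℝ γ p v.1) := by
    rw [Measure.volume_eq_prod, setIntegral_prod _ hD₂i.integrableOn, Measure.restrict_univ]
    congr 1 with p
    simp only [hD₂]
    rw [integral_mul_const]
    congr 1
    -- On the vertical line through `p` the factor containing `Dγ` is constant, and the fundamental
    -- theorem of calculus on `(-∞, 0)` leaves the value of `f` on the graph.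
    have hg : ContDiff ℝ 1 (fun t : ℝ => f (p, γ p + t)) := hf.comp (by fun_prop)
    have hgc : HasCompactSupport (fun t : ℝ => f (p, γ p + t)) := by
      refine HasCompactSupport.intro ((hc.image continuous_snd).image
        (f := fun t => t - γ p) (by fun_prop)) fun t ht => ?_
      by_contra h0
      exact ht ⟨_, ⟨_, subset_tsupport _ h0, rfl⟩, by simp⟩
    have hint := hgc.integral_Iic_deriv_eq hg 0
    rw [add_zero] at hint
    rw [← hint, integral_Iic_eq_integral_Iio]
    congr 1 with t
    have hd1 : HasDerivAt (fun t : ℝ => (p, γ p + t)) ((0 : E2), (1 : ℝ)) t :=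
      (hasDerivAt_const t p).prodMk ((hasDerivAt_id t).const_add _)
    have := ((hfd (p, γ p + t)).hasFDerivAt.comp_hasDerivAt t hd1).deriv
    rw [show (fun t => f (p, γ p + t)) = f ∘ (fun t => (p, γ p + t)) from rfl, this]
    simp only [hF, hSa]
  rw [h1, h2, h3, h4, zero_add]

end Subgraph

/-! ### Normals and boundary patches of a Lipschitz domain -/

/-- The upward unit normal of a graph with slope `A`. -/
def graphNormal (Ψ : (E2 × ℝ) ≃L[ℝ] E3) (A : E2 →L[ℝ] ℝ) : E3 :=
  (graphDensity A)⁻¹ • Ψ (-(InnerProductSpace.toDual ℝ E2).symm A, 1)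

/-- The factor `w.2 - A w.1` is the one in `integral_subgraph_fderiv`, and the reciprocal density
cancels the surface element of the graph. -/
theorem IsFrame.inner_graphNormal {e : E3} {Ψ : (E2 × ℝ) ≃L[ℝ] E3} (h : IsFrame e Ψ)
    (A : E2 →L[ℝ] ℝ) (w : E2 × ℝ) :
    ⟪Ψ w, graphNormal Ψ A⟫_ℝ = (graphDensity A)⁻¹ * (w.2 - A w.1) := by
  rw [graphNormal, real_inner_smul_right, h.inner_apply, inner_neg_right, real_inner_comm,
    InnerProductSpace.toDual_symm_apply]
  ring

theorem IsFrame.norm_graphNormal {e : E3} {Ψ : (E2 × ℝ) ≃L[ℝ] E3} (h : IsFrame e Ψ)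
    (A : E2 →L[ℝ] ℝ) : ‖graphNormal Ψ A‖ = 1 := by
  have h1 := one_le_graphDensity A
  have h2 : graphDensity A ^ 2 = 1 + ‖A‖ ^ 2 := Real.sq_sqrt (by positivity)
  have h3 := h.norm_sq_apply (-(InnerProductSpace.toDual ℝ E2).symm A, 1)
  simp only [norm_neg, LinearIsometryEquiv.norm_map] at h3
  have h4 : ‖graphNormal Ψ A‖ ^ 2 = 1 := by
    rw [graphNormal, norm_smul, mul_pow, h3, norm_inv, Real.norm_of_nonneg (by linarith), inv_pow,
      h2]
    have : 1 + ‖A‖ ^ 2 ≠ 0 := by positivity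
    field_simp
    ring
  nlinarith [norm_nonneg (graphNormal Ψ A)]

theorem IsOuterUnitNormal.outerNormal_eq {B : Set E3} {z ν : E3} (h : IsOuterUnitNormal B z ν) :
    outerNormal B z = ν := by
  have hex : ∃ ν, IsOuterUnitNormal B z ν := ⟨ν, h⟩
  rw [outerNormal, dif_pos hex]
  exact hex.choose_spec.unique h

theorem norm_outerNormal_le (B : Set E3) (z : E3) : ‖outerNormal B z‖ ≤ 1 := by
  by_cases hex : ∃ ν, IsOuterUnitNormal B z ν
  · rw [outerNormal, dif_pos hex]
    exact hex.choose_spec.1.le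
  · rw [outerNormal, dif_neg hex]; simp

/-- In the open set `U`, the set `B` is the strict subgraph of the Lipschitz function `γ`. -/
structure IsPatch (B U : Set E3) (e : E3) (Ψ : (E2 × ℝ) ≃L[ℝ] E3) (γ : E2 → ℝ) (L : ℝ≥0) :
    Prop where
  isFrame : IsFrame e Ψ
  lipschitz : LipschitzWith L γ
  isOpen : IsOpen U
  isBounded : Bornology.IsBounded U
  mem_iff : ∀ a, Ψ a ∈ U → (Ψ a ∈ B ↔ a.2 < γ a.1)

theorem IsLipschitzDomain.exists_isPatch {B : Set E3} (hB : IsLipschitzDomain B) {z : E3}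
    (hz : z ∈ frontier B) : ∃ U e Ψ γ L, z ∈ U ∧ IsPatch B U e Ψ γ L := by
  obtain ⟨e, g, L, r, he, hg, hr, hgr⟩ := hB.exists_graph z hz
  obtain ⟨Ψ, hΨ⟩ := exists_isFrame he
  refine ⟨Metric.ball z r, e, Ψ, fun p => g (Ψ (p, 0)), L, Metric.mem_ball_self hr,
    hΨ, ?_, Metric.isOpen_ball, Metric.isBounded_ball, ?_⟩
  · refine LipschitzWith.of_dist_le_mul fun p q => ?_
    have := hg.dist_le_mul (Ψ (p, 0)) (Ψ (q, 0))
    rwa [dist_eq_norm (Ψ (p, 0)), ← map_sub, Prod.mk_sub_mk, sub_zero, hΨ.norm_horizontal,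
      ← dist_eq_norm] at this
  · intro a ha
    rw [hgr _ ha, hΨ.inner_vertical]
    have : Ψ a - a.2 • e = Ψ (a.1, 0) := by rw [hΨ.apply_eq a]; simp
    rw [this]

namespace IsPatch

variable {B U : Set E3} {e : E3} {Ψ : (E2 × ℝ) ≃L[ℝ] E3} {γ : E2 → ℝ} {L : ℝ≥0}

/-- Strictly above the graph a whole neighbourhood misses `B` by continuity of `γ`; a point on the
graph lies outside `B` but is approached from below by points of `B`. -/
theorem mem_frontier_iff (h : IsPatch B U e Ψ γ L) (hB : IsOpen B) {a : E2 × ℝ} (ha : Ψ a ∈ U) :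
    Ψ a ∈ frontier B ↔ a.2 = γ a.1 := by
  have hγ := h.lipschitz.continuous
  have hev : ∀ᶠ b in 𝓝 a, Ψ b ∈ U := Ψ.continuous.continuousAt (h.isOpen.mem_nhds ha)
  rw [hB.frontier_eq, Set.mem_sdiff]
  constructor
  · rintro ⟨hcl, hnot⟩
    rw [h.mem_iff a ha, not_lt] at hnot
    refine hnot.antisymm' ?_
    by_contra! hlt
    have h1 : ∀ᶠ b in 𝓝 a, γ b.1 < b.2 :=
      (hγ.comp continuous_fst).continuousAt.eventually_lt continuous_snd.continuousAt hlt
    have h2 : ∀ᶠ y in 𝓝 (Ψ a), y ∉ B := by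
      have hs : Tendsto Ψ.symm (𝓝 (Ψ a)) (𝓝 a) := by
        simpa using Ψ.symm.continuous.tendsto (Ψ a)
      filter_upwards [hs.eventually (h1.and hev)] with y hy
      have := h.mem_iff (Ψ.symm y) hy.2
      rw [Ψ.apply_symm_apply] at this
      rw [this]; exact not_lt.2 hy.1.le
    exact (mem_closure_iff_frequently.1 hcl) h2
  · intro heq
    refine ⟨?_, fun hmem => ?_⟩
    · have h1 : Tendsto (fun t : ℝ => Ψ (a.1, a.2 - t)) (𝓝[>] 0) (𝓝 (Ψ a)) := by
        have : Continuous fun t : ℝ => Ψ (a.1, a.2 - t) := by fun_prop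
        simpa using (this.tendsto 0).mono_left nhdsWithin_le_nhds
      refine mem_closure_of_tendsto h1 ?_
      filter_upwards [h1.eventually (h.isOpen.mem_nhds ha), self_mem_nhdsWithin] with t ht ht0
      rw [h.mem_iff _ ht]
      simp only [← heq]
      linarith [mem_Ioi.1 ht0]
    · rw [h.mem_iff a ha, heq] at hmem
      exact lt_irrefl _ hmem

theorem frontier_inter (h : IsPatch B U e Ψ γ L) (hB : IsOpen B) :
    frontier B ∩ U = range (graphMap Ψ γ) ∩ U := by
  ext y
  obtain ⟨a, rfl⟩ := Ψ.surjective y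
  simp only [mem_inter_iff, and_congr_left_iff]
  intro ha
  rw [h.mem_frontier_iff hB ha]
  constructor
  · intro hh; exact ⟨a.1, by rw [graphMap, ← hh]⟩
  · rintro ⟨p, hp⟩
    have := Ψ.injective hp
    rw [← this]

theorem surfaceMeasure_restrict (h : IsPatch B U e Ψ γ L) (hB : IsOpen B) :
    (surfaceMeasure B).restrict U =
      ((volume.withDensity fun p => ENNReal.ofReal (graphDensity (fderiv ℝ γ p))).map
        (graphMap Ψ γ)).restrict U := by
  rw [surfaceMeasure, Measure.restrict_restrict h.isOpen.measurableSet, inter_comm,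
    h.frontier_inter hB, ← h.isFrame.restrict_range_graphMap h.lipschitz,
    Measure.restrict_restrict h.isOpen.measurableSet, inter_comm]

theorem surfaceMeasure_lt_top (h : IsPatch B U e Ψ γ L) (hB : IsOpen B) :
    surfaceMeasure B U < ∞ := by
  have h1 : surfaceMeasure B U =
      Measure.euclideanHausdorffMeasure 2 (graphMap Ψ γ '' (graphMap Ψ γ ⁻¹' U)) := by
    rw [surfaceMeasure, Measure.restrict_apply h.isOpen.measurableSet, inter_comm,
      h.frontier_inter hB, image_preimage_eq_inter_range, inter_comm]
  rw [h1]
  refine (h.isFrame.euclideanHausdorffMeasure_graph_le h.lipschitz _).trans_lt ?_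
  refine ENNReal.mul_lt_top (by simp) (Bornology.IsBounded.measure_lt_top ?_)
  obtain ⟨R, hR⟩ := h.isBounded.exists_norm_le
  refine isBounded_iff_forall_norm_le.2 ⟨R, fun p hp => ?_⟩
  exact (h.isFrame.norm_fst_le (p, γ p)).trans (hR _ hp)

/-- Differentiability of `γ` at `p` confines the graph near `p` to an arbitrarily thin double cone
around its tangent plane. Since `graphDensity` is at least 1, a point beyond the cone of opening `ε`
has a height above the tangent plane exceeding the linearisation error, which decides its side of
the graph. -/
theorem isOuterUnitNormal (h : IsPatch B U e Ψ γ L) {p : E2} (hp : graphMap Ψ γ p ∈ U)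
    (hd : DifferentiableAt ℝ γ p) :
    IsOuterUnitNormal B (graphMap Ψ γ p) (graphNormal Ψ (fderiv ℝ γ p)) := by
  refine ⟨h.isFrame.norm_graphNormal _, fun ε hε => ?_⟩
  have hD := one_le_graphDensity (fderiv ℝ γ p)
  set A := fderiv ℝ γ p with hA
  have ho := (hasFDerivAt_iff_isLittleO.1 hd.hasFDerivAt).bound hε
  have hsym : Tendsto (fun y => (Ψ.symm y).1) (𝓝 (graphMap Ψ γ p)) (𝓝 p) := by
    have : Continuous fun y => (Ψ.symm y).1 := by fun_prop
    simpa [graphMap] using this.tendsto (graphMap Ψ γ p)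
  have hev := (hsym.eventually ho).and (h.isOpen.mem_nhds hp)
  obtain ⟨δ, hδ, hball⟩ := Metric.eventually_nhds_iff_ball.1 hev
  refine ⟨δ, hδ, fun y hy => ?_⟩
  obtain ⟨h1, h2⟩ := hball y hy
  obtain ⟨a, rfl⟩ := Ψ.surjective y
  rw [h.mem_iff a h2]
  simp only [Ψ.symm_apply_apply] at h1
  have hsub : Ψ a - graphMap Ψ γ p = Ψ (a - (p, γ p)) := by rw [graphMap, map_sub]
  rw [hsub, h.isFrame.inner_graphNormal]
  have h3 := h.isFrame.norm_fst_le (a - (p, γ p))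
  simp only [Prod.fst_sub, Prod.snd_sub] at h3 ⊢
  set N := ‖Ψ (a - (p, γ p))‖ with hN
  set q := A (a.1 - p) with hq
  have h4 := abs_le.1 (h1.trans (mul_le_mul_of_nonneg_left h3 hε.le))
  set D := graphDensity A
  have hD0 : 0 < D := by linarith
  have hNn : 0 ≤ ε * N := by positivity
  have h5 : ε * N ≤ D * (ε * N) := le_mul_of_one_le_left hNn hD
  have h6 : D * (D⁻¹ * (a.2 - γ p - q)) = a.2 - γ p - q := by field_simp
  constructor
  · intro hlt
    have := mul_lt_mul_of_pos_left hlt hD0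
    rw [h6] at this
    nlinarith [h4.1]
  · intro hlt
    have := mul_lt_mul_of_pos_left hlt hD0
    rw [h6] at this
    rw [not_lt]
    nlinarith [h4.2]

theorem ae_restrict_of_ae (h : IsPatch B U e Ψ γ L) (hB : IsOpen B) {Q : E3 → Prop}
    (hQ : ∀ᵐ p : E2, graphMap Ψ γ p ∈ U → Q (graphMap Ψ γ p)) :
    ∀ᵐ y ∂(surfaceMeasure B).restrict U, Q y := by
  rw [h.surfaceMeasure_restrict hB, ae_restrict_iff' h.isOpen.measurableSet,
    (measurableEmbedding_graphMap h.lipschitz.continuous).ae_map_iff]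
  exact withDensity_absolutelyContinuous _ _ hQ

theorem ae_outerNormal_eq (h : IsPatch B U e Ψ γ L) (hB : IsOpen B) :
    ∀ᵐ y ∂(surfaceMeasure B).restrict U,
      outerNormal B y = graphNormal Ψ (fderiv ℝ γ (Ψ.symm y).1) := by
  refine h.ae_restrict_of_ae hB ?_
  filter_upwards [h.lipschitz.ae_differentiableAt (μ := volume)] with p hp hU
  rw [(h.isOuterUnitNormal hU hp).outerNormal_eq, graphMap, Ψ.symm_apply_apply]

theorem measurable_graphNormal :
    Measurable fun y => graphNormal Ψ (fderiv ℝ γ (Ψ.symm y).1) := by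
  have h1 : Measurable fun y => fderiv ℝ γ (Ψ.symm y).1 :=
    (measurable_fderiv ℝ γ).comp (by fun_prop : Continuous fun y => (Ψ.symm y).1).measurable
  have h2 : Continuous fun A : E2 →L[ℝ] ℝ => graphNormal Ψ A := by
    unfold graphNormal
    refine Continuous.smul (continuous_graphDensity.inv₀ fun A => ?_) (by fun_prop)
    have := one_le_graphDensity A
    linarith
  exact h2.measurable.comp h1

/-- The normal field is defined by choice, so its measurability comes from almost everywhere
agreement with `graphNormal`, a continuous function of the measurable slope. -/
theorem aestronglyMeasurable_outerNormal (h : IsPatch B U e Ψ γ L) (hB : IsOpen B) :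
    AEStronglyMeasurable (outerNormal B) ((surfaceMeasure B).restrict U) :=
  measurable_graphNormal.aestronglyMeasurable.congr
    ((h.ae_outerNormal_eq hB).mono fun _ hy => hy.symm)

/-- Local divergence theorem: the subgraph version carried over by `Ψ`. The support condition lets
`B` be exchanged for the subgraph and `∂B` for the graph, since nothing is integrated outside `U`.
-/
theorem integral_fderiv (h : IsPatch B U e Ψ γ L) (hB : IsOpen B) {f : E3 → ℝ}
    (hf : ContDiff ℝ 1 f) (hc : HasCompactSupport f) (hU : tsupport f ⊆ U) (v : E3) :
    ∫ y in B, fderiv ℝ f y v = ∫ y, f y * ⟪v, outerNormal B y⟫_ℝ ∂surfaceMeasure B := by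
  obtain ⟨w, rfl⟩ := Ψ.surjective v
  have hemb := measurableEmbedding_graphMap (Ψ := Ψ) h.lipschitz.continuous
  have hf0 : ∀ y, y ∉ U → f y = 0 := fun y hy => image_eq_zero_of_notMem_tsupport fun hh => hy (hU hh)
  have hf0' : ∀ y, y ∉ U → fderiv ℝ f y = 0 := fun y hy =>
    image_eq_zero_of_notMem_tsupport fun hh => hy (hU (tsupport_fderiv_subset ℝ hh))
  have hl : ∫ y in B, fderiv ℝ f y (Ψ w) =
      ∫ p, f (graphMap Ψ γ p) * (w.2 - fderiv ℝ γ p w.1) := by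
    have h1 := integral_subgraph_fderiv h.lipschitz (f := f ∘ Ψ) (hf.comp Ψ.contDiff)
      (hc.comp_homeomorph Ψ.toHomeomorph) w
    refine Eq.trans ?_ h1
    rw [← h.isFrame.measurePreserving.setIntegral_preimage_emb
      Ψ.toHomeomorph.measurableEmbedding, ← integral_indicator, ← integral_indicator]
    · congr 1 with a
      have hfd : fderiv ℝ (f ∘ Ψ) a w = fderiv ℝ f (Ψ a) (Ψ w) := by
        rw [fderiv_comp a (hf.differentiable one_ne_zero _) Ψ.differentiableAt, Ψ.fderiv]
        rfl
      by_cases ha : Ψ a ∈ U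
      · by_cases hm : Ψ a ∈ B
        · have hm' := (h.mem_iff a ha).1 hm
          rw [indicator_of_mem (by exact hm), indicator_of_mem (by exact hm'), hfd]
        · have hm' := fun hh => hm ((h.mem_iff a ha).2 hh)
          rw [indicator_of_notMem (by exact hm), indicator_of_notMem (by exact hm')]
      · have : fderiv ℝ f (Ψ a) (Ψ w) = 0 := by rw [hf0' _ ha]; rfl
        refine Eq.trans (b := 0) (indicator_apply_eq_zero.2 fun _ => ?_)
          (indicator_apply_eq_zero.2 fun _ => ?_).symm
        · exact this
        · exact hfd.trans this
    · exact measurableSet_lt measurable_snd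
        (h.lipschitz.continuous.measurable.comp measurable_fst)
    · exact Ψ.continuous.measurable hB.measurableSet
  have hr : ∫ y, f y * ⟪Ψ w, outerNormal B y⟫_ℝ ∂surfaceMeasure B =
      ∫ p, f (graphMap Ψ γ p) * (w.2 - fderiv ℝ γ p w.1) := by
    have h1 : ∀ y, y ∉ U → f y * ⟪Ψ w, outerNormal B y⟫_ℝ = 0 := fun y hy => by simp [hf0 y hy]
    have h2 : ∀ y, y ∉ U → f y * ⟪Ψ w, graphNormal Ψ (fderiv ℝ γ (Ψ.symm y).1)⟫_ℝ = 0 :=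
      fun y hy => by simp [hf0 y hy]
    rw [← setIntegral_eq_integral_of_forall_compl_eq_zero h1]
    have h3 : ∫ y in U, f y * ⟪Ψ w, outerNormal B y⟫_ℝ ∂surfaceMeasure B =
        ∫ y in U, f y * ⟪Ψ w, graphNormal Ψ (fderiv ℝ γ (Ψ.symm y).1)⟫_ℝ ∂surfaceMeasure B := by
      refine integral_congr_ae ?_
      filter_upwards [h.ae_outerNormal_eq hB] with y hy
      rw [hy]
    rw [h3, h.surfaceMeasure_restrict hB, setIntegral_eq_integral_of_forall_compl_eq_zero h2,
      hemb.integral_map, integral_withDensity_eq_integral_toReal_smul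
        measurable_graphDensity_fderiv (ae_of_all _ fun _ => ENNReal.ofReal_lt_top)]
    congr 1 with p
    have hD := one_le_graphDensity (fderiv ℝ γ p)
    rw [graphMap, Ψ.symm_apply_apply, h.isFrame.inner_graphNormal,
      ENNReal.toReal_ofReal (by linarith), smul_eq_mul]
    have : graphDensity (fderiv ℝ γ p) ≠ 0 := by linarith
    field_simp
  rw [hl, hr]

end IsPatch

/-! ### Divergence theorem on a bounded Lipschitz domain -/

section Divergence

variable {B : Set E3}

theorem surfaceMeasure_compl_frontier (B : Set E3) : surfaceMeasure B (frontier B)ᶜ = 0 := by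
  rw [surfaceMeasure, Measure.restrict_apply isClosed_frontier.isOpen_compl.measurableSet]
  simp

theorem ae_mem_frontier (B : Set E3) : ∀ᵐ z ∂surfaceMeasure B, z ∈ frontier B :=
  surfaceMeasure_compl_frontier B

theorem IsLipschitzDomain.isCompact_frontier (hB : IsLipschitzDomain B) : IsCompact (frontier B) :=
  Metric.isCompact_of_isClosed_isBounded isClosed_frontier
    (hB.isBounded.closure.subset frontier_subset_closure)

/-- Both properties hold on patches and pass to subsets and finite unions, so compactness of the
boundary spreads them over all of it. -/
theorem IsLipschitzDomain.surface_regular (hB : IsLipschitzDomain B) :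
    AEStronglyMeasurable (outerNormal B) ((surfaceMeasure B).restrict (frontier B)) ∧
      surfaceMeasure B (frontier B) < ∞ := by
  refine hB.isCompact_frontier.induction_on (p := fun s =>
    AEStronglyMeasurable (outerNormal B) ((surfaceMeasure B).restrict s) ∧
      surfaceMeasure B s < ∞) ?_ ?_ ?_ ?_
  · simp
  · rintro s t hst ⟨h1, h2⟩
    exact ⟨h1.mono_set hst, (measure_mono hst).trans_lt h2⟩
  · rintro s t ⟨h1, h2⟩ ⟨h3, h4⟩
    exact ⟨aestronglyMeasurable_union_iff.2 ⟨h1, h3⟩,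
      (measure_union_le s t).trans_lt (ENNReal.add_lt_top.2 ⟨h2, h4⟩)⟩
  · intro z hz
    obtain ⟨U, e, Ψ, γ, L, hzU, hp⟩ := hB.exists_isPatch hz
    exact ⟨U, mem_nhdsWithin_of_mem_nhds (hp.isOpen.mem_nhds hzU),
      hp.aestronglyMeasurable_outerNormal hB.isOpen, hp.surfaceMeasure_lt_top hB.isOpen⟩

theorem restrict_frontier_surfaceMeasure (B : Set E3) :
    (surfaceMeasure B).restrict (frontier B) = surfaceMeasure B :=
  Measure.restrict_eq_self_of_ae_mem (ae_mem_frontier B)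

theorem IsLipschitzDomain.aestronglyMeasurable_outerNormal (hB : IsLipschitzDomain B) :
    AEStronglyMeasurable (outerNormal B) (surfaceMeasure B) := by
  have := hB.surface_regular.1
  rwa [restrict_frontier_surfaceMeasure] at this

theorem IsLipschitzDomain.isFiniteMeasure_surfaceMeasure (hB : IsLipschitzDomain B) :
    IsFiniteMeasure (surfaceMeasure B) := by
  refine ⟨?_⟩
  have h := hB.surface_regular.2
  rwa [← Measure.restrict_apply_univ, restrict_frontier_surfaceMeasure] at h

theorem IsLipschitzDomain.integrable_mul_inner (hB : IsLipschitzDomain B) {f : E3 → ℝ}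
    (hf : Continuous f) (hc : HasCompactSupport f) (v : E3) :
    Integrable (fun z => f z * ⟪v, outerNormal B z⟫_ℝ) (surfaceMeasure B) := by
  have := hB.isFiniteMeasure_surfaceMeasure
  refine Integrable.mul_bdd (c := ‖v‖) (hf.integrable_of_hasCompactSupport hc)
    (aestronglyMeasurable_const.inner hB.aestronglyMeasurable_outerNormal)
    (ae_of_all _ fun z => ?_)
  refine (norm_inner_le_norm _ _).trans ?_
  exact mul_le_of_le_one_right (norm_nonneg _) (norm_outerNormal_le B z)

theorem integral_fderiv_apply_eq_zero {F : Type*} [NormedAddCommGroup F] [NormedSpace ℝ F]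
    {f : E3 → F} (hf : ContDiff ℝ 1 f)
    (hc : HasCompactSupport f) (v : E3) : ∫ y, fderiv ℝ f y v = 0 := by
  have h1 : Integrable (fun y => fderiv ℝ f y v) :=
    ((hf.continuous_fderiv one_ne_zero).clm_apply continuous_const).integrable_of_hasCompactSupport
      (hc.fderiv_apply (𝕜 := ℝ) v)
  have h2 : Integrable f := hf.continuous.integrable_of_hasCompactSupport hc
  have := integral_smul_fderiv_eq_neg_fderiv_smul_of_integrable (𝕜 := ℝ) (μ := volume)
    (f := fun _ : E3 => (1 : ℝ)) (g := f) (v := v) (by simp) (by simpa using h1) (by simpa using h2)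
    (fun x _ => by fun_prop) (fun x _ => hf.differentiable one_ne_zero x)
  simpa using this

theorem integrable_fderiv_apply {F : Type*} [NormedAddCommGroup F] [NormedSpace ℝ F]
    {f : E3 → F} (hf : ContDiff ℝ 1 f)
    (hc : HasCompactSupport f) (v : E3) : Integrable (fun y => fderiv ℝ f y v) :=
  ((hf.continuous_fderiv one_ne_zero).clm_apply continuous_const).integrable_of_hasCompactSupport
    (hc.fderiv_apply (𝕜 := ℝ) v)

/-- Integration of derivatives over a Lipschitz domain, real-valued case. -/
theorem IsLipschitzDomain.integral_fderiv_real (hB : IsLipschitzDomain B) {f : E3 → ℝ}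
    (hf : ContDiff ℝ 1 f) (hc : HasCompactSupport f) (v : E3) :
    ∫ y in B, fderiv ℝ f y v = ∫ y, f y * ⟪v, outerNormal B y⟫_ℝ ∂surfaceMeasure B := by
  set Q : (E3 → ℝ) → Prop := fun f => ContDiff ℝ 1 f ∧ HasCompactSupport f ∧
    ∫ y in B, fderiv ℝ f y v = ∫ y, f y * ⟪v, outerNormal B y⟫_ℝ ∂surfaceMeasure B with hQ
  -- Near a boundary point the patch version applies. For support inside `B` or off its closure both
  -- sides vanish: the boundary is not met, and the volume integral is either a total derivative or
  -- zero.
  have hloc : ∀ z : E3, ∃ U : Set E3, IsOpen U ∧ z ∈ U ∧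
      ∀ f : E3 → ℝ, ContDiff ℝ 1 f → HasCompactSupport f → tsupport f ⊆ U → Q f := by
    intro z
    by_cases hz : z ∈ frontier B
    · obtain ⟨U, e, Ψ, γ, L, hzU, hp⟩ := hB.exists_isPatch hz
      exact ⟨U, hp.isOpen, hzU, fun f h1 h2 h3 => ⟨h1, h2, hp.integral_fderiv hB.isOpen h1 h2 h3 v⟩⟩
    have hr : ∀ f : E3 → ℝ, (∀ z ∈ frontier B, f z = 0) →
        ∫ y, f y * ⟪v, outerNormal B y⟫_ℝ ∂surfaceMeasure B = 0 := by
      intro f h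
      refine integral_eq_zero_of_ae ?_
      filter_upwards [ae_mem_frontier B] with y hy
      simp [h y hy]
    by_cases hzB : z ∈ B
    · refine ⟨B, hB.isOpen, hzB, fun f h1 h2 h3 => ⟨h1, h2, ?_⟩⟩
      rw [hr f, setIntegral_eq_integral_of_forall_compl_eq_zero,
        integral_fderiv_apply_eq_zero h1 h2]
      · intro y hy
        rw [image_eq_zero_of_notMem_tsupport fun hh => hy (h3 (tsupport_fderiv_subset ℝ hh))]
        rfl
      · intro y hy
        refine image_eq_zero_of_notMem_tsupport fun hh => ?_
        exact (hB.isOpen.frontier_eq ▸ hy).2 (h3 hh)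
    · refine ⟨(closure B)ᶜ, isClosed_closure.isOpen_compl, fun hcl => hz ?_,
        fun f h1 h2 h3 => ⟨h1, h2, ?_⟩⟩
      · rw [hB.isOpen.frontier_eq]; exact ⟨hcl, hzB⟩
      rw [hr f, setIntegral_eq_zero_of_forall_eq_zero]
      · intro y hy
        rw [image_eq_zero_of_notMem_tsupport fun hh =>
          h3 (tsupport_fderiv_subset ℝ hh) (subset_closure hy)]
        rfl
      · intro y hy
        exact image_eq_zero_of_notMem_tsupport fun hh => h3 hh (frontier_subset_closure hy)
  choose U hUo hUm hUQ using hloc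
  -- Only finitely many members of the partition meet the compact support of `f`, so `f` is a finite
  -- sum of localised functions and additivity finishes the proof.
  obtain ⟨ρ, hρ⟩ := SmoothPartitionOfUnity.exists_isSubordinate (modelWithCornersSelf ℝ E3)
    isClosed_univ U hUo (fun z _ => mem_iUnion.2 ⟨z, hUm z⟩)
  have hfin : {i | (Function.support (ρ i) ∩ tsupport f).Nonempty}.Finite :=
    ρ.locallyFinite.finite_nonempty_inter_compact hc
  have hsum : f = ∑ i ∈ hfin.toFinset, fun y => ρ i y * f y := by
    ext y
    rw [Finset.sum_apply, ← Finset.sum_mul]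
    by_cases hy : y ∈ tsupport f
    · have h1 := ρ.sum_eq_one (mem_univ y)
      rw [finsum_eq_sum_of_support_subset _ (s := hfin.toFinset)] at h1
      · rw [h1, one_mul]
      · intro i hi
        simp only [Finite.coe_toFinset, mem_ofPred_eq]
        exact ⟨y, hi, hy⟩
    · rw [image_eq_zero_of_notMem_tsupport hy, mul_zero]
  have hQf : Q f := by
    rw [hsum]
    refine Finset.sum_induction _ Q ?_ ?_ ?_
    · rintro f g ⟨hf1, hf2, hf3⟩ ⟨hg1, hg2, hg3⟩
      refine ⟨hf1.add hg1, hf2.add hg2, ?_⟩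
      have e1 : ∀ y, fderiv ℝ (f + g) y v = fderiv ℝ f y v + fderiv ℝ g y v := fun y => by
        rw [fderiv_add (hf1.differentiable one_ne_zero y) (hg1.differentiable one_ne_zero y)]; rfl
      simp only [e1, Pi.add_apply, add_mul]
      rw [integral_add (integrable_fderiv_apply hf1 hf2 v).integrableOn
        (integrable_fderiv_apply hg1 hg2 v).integrableOn,
        integral_add (hB.integrable_mul_inner hf1.continuous hf2 v)
        (hB.integrable_mul_inner hg1.continuous hg2 v), hf3, hg3]
    · refine ⟨contDiff_zero_fun, HasCompactSupport.zero, ?_⟩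
      simp
    · intro i _
      refine hUQ i _ ?_ ?_ ?_
      · exact ((contMDiff_iff_contDiff.1 (ρ i).contMDiff).of_le (by simp)).mul hf
      · exact hc.mul_left
      · exact (tsupport_mul_subset_left).trans (hρ i)
  exact hQf.2.2

/-- Integration of derivatives over a Lipschitz domain. -/
theorem IsLipschitzDomain.integral_fderiv (hB : IsLipschitzDomain B) {f : E3 → ℂ}
    (hf : ContDiff ℝ 1 f) (hc : HasCompactSupport f) (v : E3) :
    ∫ y in B, fderiv ℝ f y v = ∫ y, f y * (⟪v, outerNormal B y⟫_ℝ : ℂ) ∂surfaceMeasure B := by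
  have hfd : ∀ y, HasFDerivAt f (fderiv ℝ f y) y := fun y =>
    (hf.differentiable one_ne_zero y).hasFDerivAt
  have hre := hB.integral_fderiv_real (f := fun y => (f y).re)
    (Complex.reCLM.contDiff.comp hf) (hc.comp_left (g := Complex.re) rfl) v
  have him := hB.integral_fderiv_real (f := fun y => (f y).im)
    (Complex.imCLM.contDiff.comp hf) (hc.comp_left (g := Complex.im) rfl) v
  have ere : ∀ y, fderiv ℝ (fun y => (f y).re) y v = (fderiv ℝ f y v).re := fun y => by
    exact congrArg (fun T => T v) (Complex.reCLM.hasFDerivAt.comp y (hfd y)).fderiv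
  have eim : ∀ y, fderiv ℝ (fun y => (f y).im) y v = (fderiv ℝ f y v).im := fun y => by
    exact congrArg (fun T => T v) (Complex.imCLM.hasFDerivAt.comp y (hfd y)).fderiv
  simp only [ere] at hre
  simp only [eim] at him
  have hi1 : Integrable (fun y => fderiv ℝ f y v) (volume.restrict B) :=
    (integrable_fderiv_apply hf hc v).integrableOn
  have hi2 : Integrable (fun y => f y * (⟪v, outerNormal B y⟫_ℝ : ℂ)) (surfaceMeasure B) := by
    have h1 := (hB.integrable_mul_inner (Complex.continuous_re.comp hf.continuous)
      (hc.comp_left (g := Complex.re) rfl) v).ofReal (𝕜 := ℂ)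
    have h2 := (hB.integrable_mul_inner (Complex.continuous_im.comp hf.continuous)
      (hc.comp_left (g := Complex.im) rfl) v).ofReal (𝕜 := ℂ)
    refine (h1.add (h2.mul_const Complex.I)).congr (ae_of_all _ fun y => ?_)
    simp only [Pi.add_apply, Function.comp_apply]
    simp only [Complex.coe_algebraMap, RCLike.ofReal_mul]
    linear_combination (⟪v, outerNormal B y⟫_ℝ : ℂ) * Complex.re_add_im (f y)
  apply Complex.ext
  · have h1 := integral_re hi1
    have h2 := integral_re hi2
    simp only [RCLike.re_eq_complex_re, Complex.re_mul_ofReal] at h1 h2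
    rw [← h1, ← h2, hre]
  · have h1 := integral_im hi1
    have h2 := integral_im hi2
    simp only [RCLike.im_eq_complex_im, Complex.im_mul_ofReal] at h1 h2
    rw [← h1, ← h2, him]

end Divergence

/-! ### Helmholtz solutions and Green's second formula -/

/-- The standard orthonormal basis of `ℝ³`. -/
abbrev basis3 : OrthonormalBasis (Fin 3) ℝ E3 := EuclideanSpace.basisFun (Fin 3) ℝ

/-- `u` is a classical solution of the Helmholtz equation in the open set `U`. -/
structure IsHelmholtzOn (κ : ℝ) (U : Set E3) (u : E3 → ℂ) : Prop where
  isOpen : IsOpen U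
  contDiffOn : ContDiffOn ℝ 2 u U
  laplacian_eq : ∀ y ∈ U, Laplacian.laplacian u y = -(κ : ℂ) ^ 2 * u y

/-- The linear form `u ∇w - w ∇u` at the point `y`. -/
def flux (u w : E3 → ℂ) (y : E3) : E3 →L[ℝ] ℂ := u y • fderiv ℝ w y - w y • fderiv ℝ u y

theorem flux_apply (u w : E3 → ℂ) (y v : E3) :
    flux u w y v = u y * fderiv ℝ w y v - w y * fderiv ℝ u y v := by
  simp [flux]

section

variable {κ : ℝ} {U : Set E3} {u w : E3 → ℂ} {φ : E3 → ℝ}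

namespace IsHelmholtzOn

theorem mono (hu : IsHelmholtzOn κ U u) {V : Set E3} (hV : IsOpen V) (h : V ⊆ U) :
    IsHelmholtzOn κ V u :=
  ⟨hV, hu.contDiffOn.mono h, fun y hy => hu.laplacian_eq y (h hy)⟩

theorem contDiffAt (hu : IsHelmholtzOn κ U u) {y : E3} (hy : y ∈ U) : ContDiffAt ℝ 2 u y :=
  hu.contDiffOn.contDiffAt (hu.isOpen.mem_nhds hy)

theorem differentiableAt (hu : IsHelmholtzOn κ U u) {y : E3} (hy : y ∈ U) :
    DifferentiableAt ℝ u y := (hu.contDiffAt hy).differentiableAt (by norm_num)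

theorem contDiffAt_fderiv (hu : IsHelmholtzOn κ U u) {y : E3} (hy : y ∈ U) :
    ContDiffAt ℝ 1 (fderiv ℝ u) y := (hu.contDiffAt hy).fderiv_right (by norm_num)

theorem continuousOn (hu : IsHelmholtzOn κ U u) : ContinuousOn u U := hu.contDiffOn.continuousOn

theorem continuousOn_fderiv (hu : IsHelmholtzOn κ U u) : ContinuousOn (fderiv ℝ u) U :=
  fun _ hy => (hu.contDiffAt_fderiv hy).continuousAt.continuousWithinAt

theorem sum_fderiv_fderiv (hu : IsHelmholtzOn κ U u) {y : E3} (hy : y ∈ U) :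
    ∑ i, fderiv ℝ (fderiv ℝ u) y (basis3 i) (basis3 i) = -(κ : ℂ) ^ 2 * u y := by
  rw [← hu.laplacian_eq y hy,
    InnerProductSpace.laplacian_eq_iteratedFDeriv_orthonormalBasis u basis3]
  simp [iteratedFDeriv_two_apply]

/-- The wavenumber is real. The flux of `u` against its conjugate is the conserved energy flux used
at infinity. -/
theorem conjugate (hu : IsHelmholtzOn κ U u) : IsHelmholtzOn κ U (fun y => conj (u y)) := by
  refine ⟨hu.isOpen, Complex.conjCLE.contDiff.comp_contDiffOn hu.contDiffOn, fun y hy => ?_⟩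
  have h := (hu.contDiffAt hy).laplacian_CLM_comp_left (l := (Complex.conjCLE : ℂ →L[ℝ] ℂ))
  have h2 : ((Complex.conjCLE : ℂ →L[ℝ] ℂ) ∘ u) = fun y => (starRingEnd ℂ) (u y) := rfl
  rw [h2] at h
  rw [h, Function.comp_apply, hu.laplacian_eq y hy]
  simp

end IsHelmholtzOn

theorem continuousOn_flux (hu : IsHelmholtzOn κ U u) (hw : IsHelmholtzOn κ U w) :
    ContinuousOn (flux u w) U :=
  (hu.continuousOn.smul hw.continuousOn_fderiv).sub (hw.continuousOn.smul hu.continuousOn_fderiv)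

/-- The components of the field `φ (u ∇w - w ∇u)`. -/
def fluxComponent (φ : E3 → ℝ) (u w : E3 → ℂ) (i : Fin 3) (y : E3) : ℂ :=
  φ y • flux u w y (basis3 i)

theorem tsupport_fluxComponent_subset (i : Fin 3) :
    tsupport (fluxComponent φ u w i) ⊆ tsupport φ := by
  refine closure_mono fun y hy => ?_
  rw [Function.mem_support] at hy ⊢
  intro h; exact hy (by simp [fluxComponent, h])

/-- Off its support the function is locally zero. Hence a cutoff supported in `U` extends a field
that is regular only on `U` to all of space. -/
theorem contDiff_of_contDiffAt_tsupport {F : Type*} [NormedAddCommGroup F] [NormedSpace ℝ F]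
    {f : E3 → F} (h : ∀ y ∈ tsupport f, ContDiffAt ℝ 1 f y) : ContDiff ℝ 1 f := by
  refine contDiff_iff_contDiffAt.2 fun y => ?_
  by_cases hy : y ∈ tsupport f
  · exact h y hy
  · have : f =ᶠ[𝓝 y] fun _ => 0 := notMem_tsupport_iff_eventuallyEq.1 hy
    exact contDiffAt_const.congr_of_eventuallyEq this

theorem contDiffAt_flux (hu : IsHelmholtzOn κ U u) (hw : IsHelmholtzOn κ U w) {y : E3}
    (hy : y ∈ U) : ContDiffAt ℝ 1 (flux u w) y :=
  (((hu.contDiffAt hy).of_le (by norm_num)).smul (hw.contDiffAt_fderiv hy)).sub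
    (((hw.contDiffAt hy).of_le (by norm_num)).smul (hu.contDiffAt_fderiv hy))

theorem contDiff_fluxComponent (hu : IsHelmholtzOn κ U u) (hw : IsHelmholtzOn κ U w)
    (hφ : ContDiff ℝ 1 φ) (hU : tsupport φ ⊆ U) (i : Fin 3) :
    ContDiff ℝ 1 (fluxComponent φ u w i) := by
  refine contDiff_of_contDiffAt_tsupport fun y hy => ?_
  have hyU := hU (tsupport_fluxComponent_subset i hy)
  exact hφ.contDiffAt.smul ((contDiffAt_flux hu hw hyU).clm_apply contDiffAt_const)

theorem hasCompactSupport_fluxComponent (hc : HasCompactSupport φ) (i : Fin 3) :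
    HasCompactSupport (fluxComponent φ u w i) :=
  hc.mono' (subset_trans (subset_tsupport _) (tsupport_fluxComponent_subset i))

theorem sum_fderiv_smul_basis (φ : E3 → ℝ) (y : E3) :
    ∑ i, fderiv ℝ φ y (basis3 i) • basis3 i = ∇ φ y := by
  conv_rhs => rw [← basis3.sum_repr (∇ φ y)]
  refine Finset.sum_congr rfl fun i _ => ?_
  rw [basis3.repr_apply_apply, real_inner_comm, ← toDual_gradient,
    InnerProductSpace.toDual_apply_apply]

/-- The divergence of `φ (u ∇w - w ∇u)` for two solutions of the Helmholtz equation. -/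
theorem sum_fderiv_fluxComponent (hu : IsHelmholtzOn κ U u) (hw : IsHelmholtzOn κ U w)
    (hφ : ContDiff ℝ 1 φ) (hU : tsupport φ ⊆ U) (y : E3) :
    ∑ i, fderiv ℝ (fluxComponent φ u w i) y (basis3 i) = flux u w y (∇ φ y) := by
  by_cases hy : y ∈ tsupport φ
  swap
  · have h1 : ∀ i, fderiv ℝ (fluxComponent φ u w i) y = 0 := fun i =>
      image_eq_zero_of_notMem_tsupport fun hh =>
        hy (tsupport_fluxComponent_subset i (tsupport_fderiv_subset ℝ hh))
    have h2 : fderiv ℝ φ y = 0 :=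
      image_eq_zero_of_notMem_tsupport fun hh => hy (tsupport_fderiv_subset ℝ hh)
    simp [h1, gradient, h2]
  have hyU := hU hy
  have hφd := (hφ.differentiable one_ne_zero y).hasFDerivAt
  have hud := (hu.differentiableAt hyU).hasFDerivAt
  have hwd := (hw.differentiableAt hyU).hasFDerivAt
  have hud2 := ((hu.contDiffAt_fderiv hyU).differentiableAt one_ne_zero).hasFDerivAt
  have hwd2 := ((hw.contDiffAt_fderiv hyU).differentiableAt one_ne_zero).hasFDerivAt
  -- In the product rule the terms `Du Dw` cancel; summing over `i` turns the second-order terms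
  -- into `u Δw - w Δu`, which vanishes because both functions have the same `κ`.
  have key : ∀ i, fderiv ℝ (fluxComponent φ u w i) y (basis3 i) =
      flux u w y (fderiv ℝ φ y (basis3 i) • basis3 i) + (φ y : ℂ) *
        (u y * fderiv ℝ (fderiv ℝ w) y (basis3 i) (basis3 i) -
          w y * fderiv ℝ (fderiv ℝ u) y (basis3 i) (basis3 i)) := by
    intro i
    have h1 := hφd.smul (((hud.mul (hwd2.clm_apply (hasFDerivAt_const (basis3 i) y))).sub
      (hwd.mul (hud2.clm_apply (hasFDerivAt_const (basis3 i) y)))))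
    have h2 : fluxComponent φ u w i = fun y =>
        φ y • (u y * fderiv ℝ w y (basis3 i) - w y * fderiv ℝ u y (basis3 i)) := by
      ext y; rw [fluxComponent, flux_apply]
    rw [h2]
    refine (congrArg (fun T => T (basis3 i)) h1.fderiv).trans ?_
    rw [map_smul, flux_apply]
    simp only [_root_.add_apply, _root_.sub_apply, _root_.smul_apply,
      ContinuousLinearMap.smulRight_apply, ContinuousLinearMap.comp_apply,
      ContinuousLinearMap.flip_apply, _root_.zero_apply, map_zero, smul_eq_mul,
      Complex.real_smul, Pi.sub_apply, Pi.mul_apply]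
    ring
  rw [Finset.sum_congr rfl fun i _ => key i, Finset.sum_add_distrib, ← map_sum,
    sum_fderiv_smul_basis, ← Finset.mul_sum, Finset.sum_sub_distrib, ← Finset.mul_sum,
    ← Finset.mul_sum, hu.sum_fderiv_fderiv hyU, hw.sum_fderiv_fderiv hyU]
  ring

theorem integrable_flux_gradient (hu : IsHelmholtzOn κ U u) (hw : IsHelmholtzOn κ U w)
    (hφ : ContDiff ℝ 1 φ) (hc : HasCompactSupport φ) (hU : tsupport φ ⊆ U) :
    Integrable fun y => flux u w y (∇ φ y) := by
  simp only [← sum_fderiv_fluxComponent hu hw hφ hU]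
  exact integrable_finsetSum _ fun i _ => integrable_fderiv_apply
    (contDiff_fluxComponent hu hw hφ hU i) (hasCompactSupport_fluxComponent hc i) _

theorem integral_flux_gradient_eq_zero (hu : IsHelmholtzOn κ U u) (hw : IsHelmholtzOn κ U w)
    (hφ : ContDiff ℝ 1 φ) (hc : HasCompactSupport φ) (hU : tsupport φ ⊆ U) :
    ∫ y, flux u w y (∇ φ y) = 0 := by
  simp only [← sum_fderiv_fluxComponent hu hw hφ hU]
  rw [integral_finsetSum _ fun i _ => integrable_fderiv_apply
    (contDiff_fluxComponent hu hw hφ hU i) (hasCompactSupport_fluxComponent hc i) _]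
  exact Finset.sum_eq_zero fun i _ => integral_fderiv_apply_eq_zero
    (contDiff_fluxComponent hu hw hφ hU i) (hasCompactSupport_fluxComponent hc i) _

/-- Green's second formula in the exterior of a Lipschitz domain, with a cutoff. -/
theorem IsLipschitzDomain.integral_compl_flux_gradient {B : Set E3} (hB : IsLipschitzDomain B)
    (hu : IsHelmholtzOn κ U u) (hw : IsHelmholtzOn κ U w)
    (hφ : ContDiff ℝ 1 φ) (hc : HasCompactSupport φ) (hU : tsupport φ ⊆ U)
    (hφ1 : ∀ z ∈ frontier B, φ z = 1) :
    ∫ y in Bᶜ, flux u w y (∇ φ y) =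
      -∫ z, (u z * normalDeriv B w z - w z * normalDeriv B u z) ∂surfaceMeasure B := by
  have hfin := hB.isFiniteMeasure_surfaceMeasure
  -- The integral over the whole space is zero, so the exterior integral is minus the one over `B`,
  -- where the divergence theorem applies to the cut-off field; this produces the sign.
  have h1 := integral_add_compl hB.isOpen.measurableSet
    (integrable_flux_gradient hu hw hφ hc hU)
  rw [integral_flux_gradient_eq_zero hu hw hφ hc hU] at h1
  have h2 : ∫ y in B, flux u w y (∇ φ y) =
      ∫ z, (u z * normalDeriv B w z - w z * normalDeriv B u z) ∂surfaceMeasure B := by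
    simp only [← sum_fderiv_fluxComponent hu hw hφ hU]
    rw [integral_finsetSum _ fun i _ => (integrable_fderiv_apply
      (contDiff_fluxComponent hu hw hφ hU i) (hasCompactSupport_fluxComponent hc i) _).integrableOn]
    rw [Finset.sum_congr rfl fun i _ => hB.integral_fderiv (contDiff_fluxComponent hu hw hφ hU i)
      (hasCompactSupport_fluxComponent hc i) _]
    rw [← integral_finsetSum]
    · refine integral_congr_ae ?_
      filter_upwards [ae_mem_frontier B] with z hz
      simp only [fluxComponent, hφ1 z hz, one_smul, normalDeriv]
      rw [← flux_apply]
      conv_rhs => rw [← basis3.sum_repr (outerNormal B z), map_sum]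
      refine Finset.sum_congr rfl fun i _ => ?_
      rw [map_smul, basis3.repr_apply_apply, Complex.real_smul, mul_comm]
    · intro i _
      refine Integrable.mul_bdd (c := ‖basis3 i‖) ((contDiff_fluxComponent hu hw hφ hU
        i).continuous.integrable_of_hasCompactSupport (hasCompactSupport_fluxComponent hc i)) ?_
        (ae_of_all _ fun z => ?_)
      · exact Complex.continuous_ofReal.comp_aestronglyMeasurable
          (aestronglyMeasurable_const.inner hB.aestronglyMeasurable_outerNormal)
      · rw [Complex.norm_real]
        exact (norm_inner_le_norm _ _).trans
          (mul_le_of_le_one_right (norm_nonneg _) (norm_outerNormal_le B z))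
  rw [h2] at h1
  exact (neg_eq_of_add_eq_zero_right h1).symm

end

/-! ### The plane wave and the fundamental solution -/

section Laplacian

theorem laplacian_eq_sum {u : E3 → ℂ} {y : E3} (hu : ContDiffAt ℝ 2 u y)
    {T : Fin 3 → E3 →L[ℝ] ℂ}
    (hT : ∀ i, HasFDerivAt (fun z => fderiv ℝ u z (basis3 i)) (T i) y) :
    Laplacian.laplacian u y = ∑ i, T i (basis3 i) := by
  rw [InnerProductSpace.laplacian_eq_iteratedFDeriv_orthonormalBasis u basis3]
  refine Finset.sum_congr rfl fun i _ => ?_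
  have h1 : HasFDerivAt (fderiv ℝ u) (fderiv ℝ (fderiv ℝ u) y) y :=
    ((hu.fderiv_right (m := 1) (by norm_num)).differentiableAt one_ne_zero).hasFDerivAt
  have h2 := (h1.clm_apply (hasFDerivAt_const (basis3 i) y)).unique (hT i)
  rw [← h2, iteratedFDeriv_two_apply]
  simp

theorem sum_inner_basis_sq (v : E3) : ∑ i, ⟪v, basis3 i⟫_ℝ * ⟪v, basis3 i⟫_ℝ = ‖v‖ ^ 2 := by
  rw [← real_inner_self_eq_norm_sq, ← basis3.sum_inner_mul_inner v v]
  refine Finset.sum_congr rfl fun i _ => ?_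
  rw [real_inner_comm v]

theorem hasFDerivAt_planeWave (κ : ℝ) (d y : E3) :
    HasFDerivAt (planeWave κ d)
      ((innerSL ℝ d).smulRight (Complex.I * κ * planeWave κ d y)) y := by
  have h1 : HasFDerivAt (fun y => ((κ * ⟪d, y⟫_ℝ : ℝ) : ℂ))
      (Complex.ofRealCLM.comp (κ • innerSL ℝ d)) y :=
    Complex.ofRealCLM.hasFDerivAt.comp y ((innerSL ℝ d).hasFDerivAt.const_mul κ)
  have h2 : HasFDerivAt (planeWave κ d) _ y := (h1.const_mul Complex.I).cexp
  refine h2.congr_fderiv ?_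
  ext v
  simp [planeWave]
  ring

theorem contDiff_planeWave (κ : ℝ) (d : E3) : ContDiff ℝ 2 (planeWave κ d) := by
  unfold planeWave
  have : ContDiff ℝ 2 fun y : E3 => ((κ * ⟪d, y⟫_ℝ : ℝ) : ℂ) :=
    Complex.ofRealCLM.contDiff.comp (contDiff_const.mul (contDiff_const.inner ℝ contDiff_id))
  exact (contDiff_const.mul this).cexp

theorem isHelmholtzOn_planeWave (κ : ℝ) {d : E3} (hd : ‖d‖ = 1) :
    IsHelmholtzOn κ univ (planeWave κ d) := by
  refine ⟨isOpen_univ, (contDiff_planeWave κ d).contDiffOn, fun y _ => ?_⟩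
  have h1 : ∀ v, (fun z => fderiv ℝ (planeWave κ d) z v) =
      fun z => (⟪d, v⟫_ℝ * (Complex.I * κ)) * planeWave κ d z := by
    intro v; ext z
    rw [(hasFDerivAt_planeWave κ d z).fderiv]
    simp; ring
  rw [laplacian_eq_sum (contDiff_planeWave κ d).contDiffAt (T := fun i =>
    (⟪d, basis3 i⟫_ℝ * (Complex.I * κ) : ℂ) •
      (innerSL ℝ d).smulRight (Complex.I * κ * planeWave κ d y))]
  · have h2 := sum_inner_basis_sq d
    rw [hd, one_pow] at h2
    have h3 : (∑ i, (⟪d, basis3 i⟫_ℝ : ℂ) * ⟪d, basis3 i⟫_ℝ) = 1 := by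
      exact_mod_cast h2
    calc _ = ∑ i, ((⟪d, basis3 i⟫_ℝ : ℂ) * ⟪d, basis3 i⟫_ℝ) *
          (Complex.I ^ 2 * κ ^ 2 * planeWave κ d y) := by
          refine Finset.sum_congr rfl fun i _ => ?_
          simp only [_root_.smul_apply, ContinuousLinearMap.smulRight_apply, innerSL_apply_apply,
            Complex.real_smul, smul_eq_mul]
          ring
      _ = _ := by rw [← Finset.sum_mul, h3, Complex.I_sq]; ring
  · intro i
    rw [h1]
    exact (hasFDerivAt_planeWave κ d y).const_mul _

/-- The radial derivative of the fundamental solution divided by the radius. -/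
def greenSlope (κ r : ℝ) : ℂ :=
  Complex.exp (Complex.I * (κ * r : ℝ)) * (Complex.I * κ * r - 1) / (4 * Real.pi * r ^ 3 : ℝ)

theorem hasFDerivAt_norm_sub {x z : E3} (hz : z ≠ x) :
    HasFDerivAt (fun z => ‖x - z‖) (‖x - z‖⁻¹ • innerSL ℝ (z - x)) z := by
  have h0 : ‖x - z‖ ≠ 0 := norm_ne_zero_iff.2 (sub_ne_zero.2 hz.symm)
  have h1 : HasFDerivAt (fun z => ‖z - x‖ ^ 2) (2 • (innerSL ℝ (z - x)).comp
      (ContinuousLinearMap.id ℝ E3)) z := ((hasFDerivAt_id z).sub_const x).norm_sq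
  have h2 := h1.sqrt (by rw [norm_sub_rev]; positivity)
  have h3 : (fun z => ‖x - z‖) = fun z => √(‖z - x‖ ^ 2) := by
    ext z; rw [Real.sqrt_sq (norm_nonneg _), norm_sub_rev]
  rw [h3]
  refine h2.congr_fderiv ?_
  rw [Real.sqrt_sq (norm_nonneg _), norm_sub_rev z x]
  ext v
  simp only [_root_.smul_apply, ContinuousLinearMap.comp_apply, ContinuousLinearMap.id_apply,
    smul_eq_mul, nsmul_eq_mul]
  push_cast
  field_simp

theorem hasDerivAt_cexp_mul (κ r : ℝ) :
    HasDerivAt (fun r : ℝ => Complex.exp (Complex.I * (κ * r : ℝ)))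
      (Complex.I * κ * Complex.exp (Complex.I * (κ * r : ℝ))) r := by
  have h1 : HasDerivAt (fun r : ℝ => Complex.I * ((κ * r : ℝ) : ℂ)) (Complex.I * κ) r := by
    have := ((hasDerivAt_id r).const_mul κ).ofReal_comp.const_mul Complex.I
    simpa using this
  have := h1.cexp
  rwa [mul_comm] at this

theorem hasFDerivAt_greenFun (κ : ℝ) {x z : E3} (hz : z ≠ x) :
    HasFDerivAt (greenFun κ x) ((innerSL ℝ (z - x)).smulRight (greenSlope κ ‖x - z‖)) z := by
  have h0 : ‖x - z‖ ≠ 0 := norm_ne_zero_iff.2 (sub_ne_zero.2 hz.symm)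
  set r := ‖x - z‖ with hr
  have hrc : (r : ℂ) ≠ 0 := by exact_mod_cast h0
  have hpi : (Real.pi : ℂ) ≠ 0 := by exact_mod_cast Real.pi_ne_zero
  have h1 : HasDerivAt (fun r : ℝ => ((4 * Real.pi * r : ℝ) : ℂ)) (4 * Real.pi : ℂ) r := by
    simpa using ((hasDerivAt_id r).const_mul (4 * Real.pi)).ofReal_comp
  have h2 := (hasDerivAt_cexp_mul κ r).div h1 (by push_cast; simp [hrc, hpi])
  have h3 := h2.hasFDerivAt.comp z (hasFDerivAt_norm_sub hz)
  refine h3.congr_fderiv ?_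
  ext v
  simp only [ContinuousLinearMap.smulRight_apply, _root_.smul_apply, Complex.real_smul, greenSlope,
    smul_eq_mul, ← hr, ContinuousLinearMap.comp_apply, ContinuousLinearMap.toSpanSingleton_apply]
  push_cast
  field_simp

theorem contDiffAt_greenFun (κ : ℝ) {x z : E3} (hz : z ≠ x) : ContDiffAt ℝ 2 (greenFun κ x) z := by
  have h0 : x - z ≠ 0 := sub_ne_zero.2 hz.symm
  have h1 : ContDiffAt ℝ 2 (fun z => ‖x - z‖) z := (contDiffAt_const.sub contDiffAt_id).norm ℝ h0
  have h2 : ∀ c : ℝ, ContDiffAt ℝ 2 (fun z => ((c * ‖x - z‖ : ℝ) : ℂ)) z := fun c =>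
    Complex.ofRealCLM.contDiff.contDiffAt.comp z (contDiffAt_const.mul h1)
  unfold greenFun
  simp only [div_eq_mul_inv]
  refine (contDiffAt_const.mul (h2 κ)).cexp.mul ((h2 _).inv ?_)
  have := norm_ne_zero_iff.2 h0
  have := Real.pi_ne_zero
  simp [*]

/-- The gradient is `s(r) (z - x)` with `s = greenSlope κ`, hence the Laplacian is `r s'(r) + 3
s(r)`, which the explicit formulas reduce to `-κ²` times the function. -/
theorem isHelmholtzOn_greenFun (κ : ℝ) (x : E3) : IsHelmholtzOn κ {x}ᶜ (greenFun κ x) := by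
  refine ⟨isOpen_compl_singleton, fun z hz => (contDiffAt_greenFun κ hz).contDiffWithinAt,
    fun z hz => ?_⟩
  have hz : z ≠ x := hz
  have h0 : ‖x - z‖ ≠ 0 := norm_ne_zero_iff.2 (sub_ne_zero.2 hz.symm)
  set r := ‖x - z‖ with hr
  have hrc : (r : ℂ) ≠ 0 := by exact_mod_cast h0
  have hpi : (Real.pi : ℂ) ≠ 0 := by exact_mod_cast Real.pi_ne_zero
  -- `S` is the radial derivative of `greenSlope κ`.
  set S : ℂ := Complex.exp (Complex.I * (κ * r : ℝ)) *
    (-κ ^ 2 * r ^ 2 - 3 * Complex.I * κ * r + 3) / (4 * Real.pi * r ^ 4) with hS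
  have hG : HasDerivAt (greenSlope κ) S r := by
    have h1 : HasDerivAt (fun r : ℝ => ((4 * Real.pi * r ^ 3 : ℝ) : ℂ)) (12 * Real.pi * r ^ 2 : ℂ) r := by
      have := ((hasDerivAt_pow 3 r).const_mul (4 * Real.pi)).ofReal_comp
      convert this using 1
      push_cast; ring
    have h2 : HasDerivAt (fun r : ℝ => (Complex.I * κ * r - 1 : ℂ)) (Complex.I * κ) r := by
      simpa using ((hasDerivAt_id r).ofReal_comp.const_mul (Complex.I * κ)).sub_const 1
    have h3 := ((hasDerivAt_cexp_mul κ r).mul h2).div h1 (by push_cast; simp [hrc, hpi])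
    refine h3.congr_deriv ?_
    rw [hS, Pi.mul_apply]
    push_cast
    field_simp
    ring_nf
    simp only [Complex.I_sq]
    ring
  have hd : ∀ v, (fun y => fderiv ℝ (greenFun κ x) y v) =ᶠ[𝓝 z]
      fun y => ⟪y - x, v⟫_ℝ • greenSlope κ ‖x - y‖ := by
    intro v
    filter_upwards [isOpen_compl_singleton.mem_nhds (show z ∈ ({x} : Set E3)ᶜ from hz)] with y hy
    rw [(hasFDerivAt_greenFun κ hy).fderiv, ContinuousLinearMap.smulRight_apply,
      innerSL_apply_apply]
  have hT : ∀ v, HasFDerivAt (fun y => fderiv ℝ (greenFun κ x) y v)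
      (⟪z - x, v⟫_ℝ • (r⁻¹ • innerSL ℝ (z - x)).smulRight S +
        (innerSL ℝ v).smulRight (greenSlope κ r)) z := by
    intro v
    refine HasFDerivAt.congr_of_eventuallyEq ?_ (hd v)
    have h1 : HasFDerivAt (fun y => ⟪y - x, v⟫_ℝ) (innerSL ℝ v) z := by
      have := ((innerSL ℝ v).hasFDerivAt (x := z - x)).comp z ((hasFDerivAt_id z).sub_const x)
      refine HasFDerivAt.congr_of_eventuallyEq (this.congr_fderiv ?_) (Eventually.of_forall ?_)
      · ext; simp
      · intro y; simp [real_inner_comm]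
    have h2 : HasFDerivAt (fun y => greenSlope κ ‖x - y‖)
        ((r⁻¹ • innerSL ℝ (z - x)).smulRight S) z := by
      have h3 := HasFDerivAt.comp z (f := fun y => ‖x - y‖) hG.hasFDerivAt
        (hasFDerivAt_norm_sub hz)
      exact h3.congr_fderiv (by ext; simp [hr]; ring)
    exact h1.smul h2
  rw [laplacian_eq_sum (contDiffAt_greenFun κ hz) fun i => hT (basis3 i)]
  have h2 := sum_inner_basis_sq (z - x)
  rw [norm_sub_rev, ← hr] at h2
  have h3 : (∑ i, (⟪z - x, basis3 i⟫_ℝ : ℂ) * ⟪z - x, basis3 i⟫_ℝ) = r ^ 2 := by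
    exact_mod_cast h2
  calc _ = ∑ i, (((⟪z - x, basis3 i⟫_ℝ : ℂ) * ⟪z - x, basis3 i⟫_ℝ) * (r⁻¹ * S) +
        greenSlope κ r) := by
        refine Finset.sum_congr rfl fun i _ => ?_
        simp only [_root_.smul_apply, _root_.add_apply, ContinuousLinearMap.smulRight_apply,
          innerSL_apply_apply, Complex.real_smul, smul_eq_mul, real_inner_self_eq_norm_sq,
          basis3.norm_eq_one]
        push_cast
        ring
    _ = r ^ 2 * (r⁻¹ * S) + 3 * greenSlope κ r := by
        rw [Finset.sum_add_distrib, ← Finset.sum_mul, h3]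
        simp
    _ = _ := by
        rw [hS, greenSlope, greenFun, ← hr]
        push_cast
        field_simp
        ring

end Laplacian

/-! ### Smooth radial cutoffs -/

section Cutoff

/-- A smooth cutoff function, equal to `1` on `(-∞, 1]` and to `0` on `[2, ∞)`. -/
def cutoff (t : ℝ) : ℝ := Real.smoothTransition (2 - t)

theorem contDiff_cutoff {n : ℕ∞} : ContDiff ℝ n cutoff :=
  Real.smoothTransition.contDiff.comp (contDiff_const.sub contDiff_id)

theorem cutoff_eq_one {t : ℝ} (ht : t ≤ 1) : cutoff t = 1 :=
  Real.smoothTransition.one_of_one_le (by linarith)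

theorem cutoff_eq_zero {t : ℝ} (ht : 2 ≤ t) : cutoff t = 0 :=
  Real.smoothTransition.zero_of_nonpos (by linarith)

theorem antitone_cutoff : Antitone cutoff := fun _ _ h =>
  Real.smoothTransition.monotone (by linarith)

theorem hasDerivAt_cutoff (t : ℝ) : HasDerivAt cutoff (deriv cutoff t) t :=
  ((contDiff_cutoff (n := 1)).differentiable one_ne_zero t).hasDerivAt

theorem continuous_deriv_cutoff : Continuous (deriv cutoff) :=
  (contDiff_cutoff (n := 1)).continuous_deriv le_rfl

theorem deriv_cutoff_nonpos (t : ℝ) : deriv cutoff t ≤ 0 := antitone_cutoff.deriv_nonpos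

theorem deriv_cutoff_of_lt {t : ℝ} (ht : t < 1) : deriv cutoff t = 0 := by
  have : cutoff =ᶠ[𝓝 t] fun _ => 1 := by
    filter_upwards [Iio_mem_nhds ht] with s hs using cutoff_eq_one (le_of_lt hs)
  rw [this.deriv_eq, deriv_const]

theorem deriv_cutoff_of_gt {t : ℝ} (ht : 2 < t) : deriv cutoff t = 0 := by
  have : cutoff =ᶠ[𝓝 t] fun _ => 0 := by
    filter_upwards [Ioi_mem_nhds ht] with s hs using cutoff_eq_zero (le_of_lt hs)
  rw [this.deriv_eq, deriv_const]

theorem exists_deriv_cutoff_bound : ∃ M : ℝ, 0 < M ∧ ∀ t, |deriv cutoff t| ≤ M := by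
  obtain ⟨M, hM⟩ := isCompact_Icc.exists_bound_of_continuousOn
    (continuous_deriv_cutoff.continuousOn (s := Icc 1 2))
  refine ⟨max M 1, by positivity, fun t => ?_⟩
  by_cases ht : t ∈ Icc 1 2
  · exact (hM t ht).trans (le_max_left _ _)
  · have : deriv cutoff t = 0 := by
      rw [mem_Icc, not_and_or, not_le, not_le] at ht
      exact ht.elim deriv_cutoff_of_lt deriv_cutoff_of_gt
    rw [this, abs_zero]; positivity

/-- The integrand has the primitive `cutoff (r ^ 2) / 2`, which falls from `1 / 2` to `0`; the value
does not depend on the profile of the cutoff. -/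
theorem integral_mul_deriv_cutoff_sq :
    ∫ r in Ioi (0 : ℝ), r * deriv cutoff (r ^ 2) = -(1 / 2) := by
  have hd : ∀ r : ℝ, HasDerivAt (fun r => cutoff (r ^ 2) / 2) (r * deriv cutoff (r ^ 2)) r := by
    intro r
    have := ((hasDerivAt_cutoff (r ^ 2)).comp r (hasDerivAt_pow 2 r)).div_const 2
    refine this.congr_deriv ?_
    push_cast; ring
  have hint : IntegrableOn (fun r => r * deriv cutoff (r ^ 2)) (Ioi 0) := by
    have hc : Continuous fun r : ℝ => r * deriv cutoff (r ^ 2) :=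
      continuous_id.mul (continuous_deriv_cutoff.comp (continuous_pow 2))
    refine (hc.integrable_of_hasCompactSupport ?_).integrableOn
    refine HasCompactSupport.intro (isCompact_Icc (a := -2) (b := 2)) fun r hr => ?_
    have : 2 < r ^ 2 := by
      rw [mem_Icc, not_and_or, not_le, not_le] at hr
      rcases hr with h | h <;> nlinarith
    rw [deriv_cutoff_of_gt this, mul_zero]
  have ht : Tendsto (fun r : ℝ => cutoff (r ^ 2) / 2) atTop (𝓝 0) := by
    refine tendsto_const_nhds.congr' ?_
    filter_upwards [eventually_ge_atTop 2] with r hr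
    rw [cutoff_eq_zero (by nlinarith), zero_div]
  rw [integral_Ioi_of_hasDerivAt_of_tendsto' (fun r _ => hd r) hint ht]
  norm_num [cutoff_eq_one]

/-- The radial cutoff function around `c` at scale `R`. -/
def radialCutoff (c : E3) (R : ℝ) (y : E3) : ℝ := cutoff (‖y - c‖ ^ 2 / R ^ 2)

variable {c y : E3} {R : ℝ}

/-- Squaring the norm in the definition avoids its singularity at `c`. -/
theorem contDiff_radialCutoff : ContDiff ℝ 1 (radialCutoff c R) :=
  (contDiff_cutoff (n := 1)).comp
    (((contDiff_id.sub contDiff_const).norm_sq ℝ).div_const _)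

theorem radialCutoff_eq_one (hR : 0 < R) (h : ‖y - c‖ ≤ R) : radialCutoff c R y = 1 := by
  refine cutoff_eq_one ?_
  rw [div_le_one (by positivity)]
  gcongr

theorem radialCutoff_eq_zero (hR : 0 < R) (h : 2 * R ≤ ‖y - c‖) : radialCutoff c R y = 0 := by
  refine cutoff_eq_zero ?_
  rw [le_div_iff₀ (by positivity)]
  nlinarith [norm_nonneg (y - c)]

theorem tsupport_radialCutoff_subset (hR : 0 < R) :
    tsupport (radialCutoff c R) ⊆ Metric.closedBall c (2 * R) := by
  refine closure_minimal (fun y hy => ?_) Metric.isClosed_closedBall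
  rw [mem_closedBall_iff_norm]
  by_contra! h
  exact hy (radialCutoff_eq_zero hR h.le)

theorem hasCompactSupport_radialCutoff (hR : 0 < R) : HasCompactSupport (radialCutoff c R) :=
  (isCompact_closedBall c (2 * R)).of_isClosed_subset isClosed_closure
    (tsupport_radialCutoff_subset hR)

theorem gradient_radialCutoff :
    ∇ (radialCutoff c R) y = (2 / R ^ 2 * deriv cutoff (‖y - c‖ ^ 2 / R ^ 2)) • (y - c) := by
  refine HasGradientAt.gradient (hasGradientAt_iff_hasFDerivAt.2 ?_)
  have h1 : HasFDerivAt (fun y => ‖y - c‖ ^ 2) (2 • (innerSL ℝ (y - c)).comp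
      (ContinuousLinearMap.id ℝ E3)) y := ((hasFDerivAt_id y).sub_const c).norm_sq
  have h2 := (hasDerivAt_cutoff (‖y - c‖ ^ 2 / R ^ 2)).hasFDerivAt.comp y
    (h1.mul_const (R ^ 2)⁻¹)
  refine (HasFDerivAt.congr_fderiv h2 ?_)
  ext v
  simp only [ContinuousLinearMap.comp_apply, _root_.smul_apply, ContinuousLinearMap.id_apply,
    ContinuousLinearMap.toSpanSingleton_apply, innerSL_apply_apply, smul_eq_mul, nsmul_eq_mul,
    InnerProductSpace.toDual_apply_apply, real_inner_smul_left]
  push_cast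
  ring

theorem gradient_radialCutoff_eq_zero (hR : 0 < R)
    (h : y ∉ Metric.closedBall c (2 * R) \ Metric.ball c R) : ∇ (radialCutoff c R) y = 0 := by
  rw [gradient_radialCutoff]
  rw [Set.mem_sdiff, not_and_or, not_not, mem_ball_iff_norm, mem_closedBall_iff_norm, not_le] at h
  rcases h with h | h
  · rw [deriv_cutoff_of_gt, mul_zero, zero_smul]
    rw [lt_div_iff₀ (by positivity)]
    nlinarith [norm_nonneg (y - c)]
  · rw [deriv_cutoff_of_lt, mul_zero, zero_smul]
    rw [div_lt_one (by positivity)]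
    gcongr

theorem continuous_gradient_radialCutoff : Continuous (∇ (radialCutoff c R)) := by
  have : ∇ (radialCutoff c R) =
      fun y => (2 / R ^ 2 * deriv cutoff (‖y - c‖ ^ 2 / R ^ 2)) • (y - c) := by
    ext1 y; exact gradient_radialCutoff
  rw [this]
  have h := continuous_deriv_cutoff.comp
    (by fun_prop : Continuous fun y : E3 => ‖y - c‖ ^ 2 / R ^ 2)
  exact (continuous_const.mul h).smul (by fun_prop)

theorem isCompact_annulus (c : E3) (R : ℝ) :
    IsCompact (Metric.closedBall c (2 * R) \ Metric.ball c R) :=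
  (isCompact_closedBall c (2 * R)).diff Metric.isOpen_ball

/-- The gradient of the cutoff vanishes off the annulus, so regularity of `u` and `w` is needed only
there, and a pole inside the inner ball does no harm. -/
theorem continuous_flux_gradient_radialCutoff {κ : ℝ} {U : Set E3} {u w : E3 → ℂ}
    (hu : IsHelmholtzOn κ U u) (hw : IsHelmholtzOn κ U w) (hR : 0 < R)
    (hU : Metric.closedBall c (2 * R) \ Metric.ball c R ⊆ U) :
    Continuous fun y => flux u w y (∇ (radialCutoff c R) y) := by
  rw [continuous_iff_continuousAt]
  intro y
  by_cases hy : y ∈ Metric.closedBall c (2 * R) \ Metric.ball c R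
  · exact ((continuousOn_flux hu hw).continuousAt (hu.isOpen.mem_nhds (hU hy))).clm_apply
      continuous_gradient_radialCutoff.continuousAt
  · have h1 := (isCompact_annulus c R).isClosed.isOpen_compl.mem_nhds hy
    refine (continuousAt_const (y := (0 : ℂ))).congr ?_
    filter_upwards [h1] with z hz
    rw [gradient_radialCutoff_eq_zero hR hz, map_zero]

end Cutoff

/-! ### Flux around the pole -/

/-- In polar coordinates this is `4π` times the radial integral of `r * deriv cutoff (r ^ 2)`, which
is `-1/2`. -/
theorem integral_deriv_cutoff_div_norm :
    ∫ t : E3, deriv cutoff (‖t‖ ^ 2) / ‖t‖ = -(2 * Real.pi) := by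
  have h := integral_fun_norm_addHaar (volume : Measure E3)
    (fun r : ℝ => deriv cutoff (r ^ 2) / r)
  rw [h]
  have h1 : ∫ y in Ioi (0 : ℝ), y ^ (Module.finrank ℝ E3 - 1) • (deriv cutoff (y ^ 2) / y) =
      ∫ r in Ioi (0 : ℝ), r * deriv cutoff (r ^ 2) := by
    refine setIntegral_congr_fun measurableSet_Ioi fun r hr => ?_
    have hr0 : r ≠ 0 := (mem_Ioi.1 hr).ne'
    simp only [finrank_euclideanSpace, Fintype.card_fin, smul_eq_mul]
    field_simp
  rw [h1, integral_mul_deriv_cutoff_sq, Measure.real, EuclideanSpace.volume_ball_fin_three]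
  simp only [finrank_euclideanSpace, Fintype.card_fin, ENNReal.ofReal_one, one_pow, one_mul,
    smul_eq_mul, nsmul_eq_mul]
  rw [ENNReal.toReal_ofReal (by positivity)]
  push_cast
  ring

/-- The flux of `u ∇Φ - Φ ∇u` through small spheres around the pole `x` of `Φ`. -/
theorem tendsto_flux_near_pole {κ : ℝ} {V : Set E3} {u : E3 → ℂ} (hu : IsHelmholtzOn κ V u)
    {x : E3} (hx : x ∈ V) :
    Tendsto (fun ε : ℝ => ∫ y, flux u (greenFun κ x) y (∇ (radialCutoff x ε) y)) (𝓝[>] 0)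
      (𝓝 (u x)) := by
  obtain ⟨δ, hδ, hball⟩ := Metric.isOpen_iff.1 hu.isOpen x hx
  set K := Metric.closedBall x (δ / 2) with hK
  have hKV : K ⊆ V := (Metric.closedBall_subset_ball (by linarith)).trans hball
  have hKc : IsCompact K := isCompact_closedBall _ _
  obtain ⟨M₀, hM₀⟩ := hKc.exists_bound_of_continuousOn (hu.continuousOn.mono hKV)
  obtain ⟨M₁, hM₁⟩ := hKc.exists_bound_of_continuousOn (hu.continuousOn_fderiv.mono hKV)
  obtain ⟨M, hM, hMb⟩ := exists_deriv_cutoff_bound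
  have hxK : x ∈ K := Metric.mem_closedBall_self (by linarith)
  have hM₀0 : 0 ≤ M₀ := (norm_nonneg _).trans (hM₀ x hxK)
  have hM₁0 : 0 ≤ M₁ := (norm_nonneg _).trans (hM₁ x hxK)
  -- the rescaled integrand
  set F : ℝ → E3 → ℂ := fun ε t => (2 * deriv cutoff (‖t‖ ^ 2) / (4 * Real.pi * ‖t‖) : ℝ) *
    (Complex.exp (Complex.I * (κ * (ε * ‖t‖) : ℝ)) *
      (u (x + ε • t) * (Complex.I * κ * (ε * ‖t‖) - 1) - ε * fderiv ℝ u (x + ε • t) t)) with hF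
  -- Substituting `y = x + ε t`, the Jacobian `ε ^ 3` absorbs the factor `ε⁻¹` of the cutoff
  -- gradient and `ε⁻²` of the gradient of the fundamental solution; the term with the derivative of
  -- `u` keeps a factor `ε`.
  have hscale : ∀ ε : ℝ, 0 < ε → ∀ t : E3,
      (ε : ℂ) ^ 3 * flux u (greenFun κ x) (x + ε • t) (∇ (radialCutoff x ε) (x + ε • t)) = F ε t := by
    intro ε hε t
    have hεc : (ε : ℂ) ≠ 0 := by exact_mod_cast hε.ne'
    have hpi : (Real.pi : ℂ) ≠ 0 := by exact_mod_cast Real.pi_ne_zero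
    rcases eq_or_ne t 0 with rfl | ht
    · have h0 : deriv cutoff (‖(0 : E3)‖ ^ 2) = 0 := deriv_cutoff_of_lt (by simp)
      simp only [hF, h0, gradient_radialCutoff]
      simp
    have htn : ‖t‖ ≠ 0 := norm_ne_zero_iff.2 ht
    have htc : (‖t‖ : ℂ) ≠ 0 := by exact_mod_cast htn
    have hne : x + ε • t ≠ x := by simp [hε.ne', ht]
    have hsub : x + ε • t - x = ε • t := by abel
    have hsub' : ‖x - (x + ε • t)‖ = ε * ‖t‖ := by
      rw [norm_sub_rev, hsub, norm_smul, Real.norm_of_nonneg hε.le]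
    have hg : ∇ (radialCutoff x ε) (x + ε • t) = (2 / ε * deriv cutoff (‖t‖ ^ 2)) • t := by
      rw [gradient_radialCutoff, hsub, norm_smul, Real.norm_of_nonneg hε.le, mul_pow,
        mul_div_cancel_left₀ _ (by positivity), smul_smul]
      congr 1
      field_simp
    rw [hg, map_smul, flux_apply, (hasFDerivAt_greenFun κ hne).fderiv,
      ContinuousLinearMap.smulRight_apply, innerSL_apply_apply, hsub, real_inner_smul_left,
      real_inner_self_eq_norm_sq, hsub', greenFun, hsub', greenSlope]
    simp only [hF, Complex.real_smul]
    push_cast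
    field_simp
  have hint : ∀ ε : ℝ, 0 < ε →
      ∫ y, flux u (greenFun κ x) y (∇ (radialCutoff x ε) y) = ∫ t, F ε t := by
    intro ε hε
    have h1 := integral_add_left_eq_self (μ := (volume : Measure E3))
      (fun y => flux u (greenFun κ x) y (∇ (radialCutoff x ε) y)) x
    have h2 := Measure.integral_comp_smul (volume : Measure E3)
      (fun y => flux u (greenFun κ x) (x + y) (∇ (radialCutoff x ε) (x + y))) ε
    rw [h1] at h2
    simp only [finrank_euclideanSpace, Fintype.card_fin] at h2
    rw [abs_of_pos (by positivity), Complex.real_smul] at h2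
    simp only [← hscale ε hε]
    rw [integral_const_mul, h2, ← mul_assoc]
    push_cast
    rw [mul_inv_cancel₀ (by exact_mod_cast (pow_pos hε 3).ne'), one_mul]
  have hev : ∀ᶠ ε : ℝ in 𝓝[>] 0, 0 < ε ∧ ε < 1 ∧ 2 * ε ≤ δ / 2 := by
    filter_upwards [Ioo_mem_nhdsGT (show (0 : ℝ) < min 1 (δ / 4) by positivity)] with ε hε
    have h1 := lt_of_lt_of_le hε.2 (min_le_left _ _)
    have h2 := lt_of_lt_of_le hε.2 (min_le_right _ _)
    exact ⟨hε.1, h1, by linarith⟩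
  have hlim : Tendsto (fun ε : ℝ => ∫ t, F ε t) (𝓝[>] 0) (𝓝 (∫ t, F 0 t)) := by
    -- The integrand vanishes for `‖t‖ < 1`, which tames the factor `1 / ‖t‖`, and for `‖t‖ > 2`; in
    -- between it is bounded through the bounds of `u` and its derivative on `K`.
    refine tendsto_integral_filter_of_dominated_convergence
      ((Metric.closedBall (0 : E3) 2).indicator fun _ =>
        2 * M / (4 * Real.pi) * (M₀ * (|κ| * 2 + 1) + M₁ * 2)) ?_ ?_ ?_ ?_
    · filter_upwards [hev] with ε ⟨hε, hε1, hεδ⟩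
      have hc := continuous_flux_gradient_radialCutoff (c := x) (R := ε)
        (U := V ∩ {x}ᶜ) (hu.mono (hu.isOpen.inter isOpen_compl_singleton) inter_subset_left)
        ((isHelmholtzOn_greenFun κ x).mono (hu.isOpen.inter isOpen_compl_singleton)
          inter_subset_right) hε (by
          intro y hy
          refine ⟨hKV (Metric.closedBall_subset_closedBall hεδ hy.1), ?_⟩
          rintro rfl
          exact hy.2 (Metric.mem_ball_self hε))
      have h2 : Continuous fun t => F ε t := by
        simp only [← hscale ε hε]
        exact continuous_const.mul (hc.comp (by fun_prop : Continuous fun t : E3 => x + ε • t))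
      exact h2.aestronglyMeasurable
    · filter_upwards [hev] with ε ⟨hε, hε1, hεδ⟩
      refine ae_of_all _ fun t => ?_
      by_cases ht2 : ‖t‖ ≤ 2
      swap
      · have : deriv cutoff (‖t‖ ^ 2) = 0 := deriv_cutoff_of_gt (by nlinarith)
        simp only [hF, this]
        simp only [mul_zero, zero_div, Complex.ofReal_zero, zero_mul, norm_zero]
        exact indicator_nonneg (fun _ _ => by positivity) _
      by_cases ht1 : ‖t‖ < 1
      · have : deriv cutoff (‖t‖ ^ 2) = 0 := deriv_cutoff_of_lt (by nlinarith [norm_nonneg t])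
        simp only [hF, this]
        simp only [mul_zero, zero_div, Complex.ofReal_zero, zero_mul, norm_zero]
        exact indicator_nonneg (fun _ _ => by positivity) _
      rw [not_lt] at ht1
      have hxt : x + ε • t ∈ K := by
        rw [hK, mem_closedBall_iff_norm, add_sub_cancel_left, norm_smul,
          Real.norm_of_nonneg hε.le]
        nlinarith
      rw [indicator_of_mem (by simpa using ht2)]
      have hexp : ‖Complex.exp (Complex.I * (κ * (ε * ‖t‖) : ℝ))‖ = 1 := by
        rw [mul_comm, Complex.norm_exp_ofReal_mul_I]
      simp only [hF]
      rw [norm_mul, norm_mul, hexp, one_mul, Complex.norm_real]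
      have hεt : ε * ‖t‖ ≤ 2 := by nlinarith
      have hn0 := norm_nonneg t
      gcongr
      · rw [norm_div, Real.norm_eq_abs, Real.norm_eq_abs, abs_mul, abs_of_pos (show (0 : ℝ) < 2 by norm_num),
          abs_of_nonneg (by positivity : (0 : ℝ) ≤ 4 * Real.pi * ‖t‖)]
        refine div_le_div₀ (by positivity) ?_ (by positivity) ?_
        · exact mul_le_mul_of_nonneg_left (hMb _) (by norm_num)
        · exact le_mul_of_one_le_right (by positivity) ht1
      · refine (norm_sub_le _ _).trans (add_le_add ?_ ?_)
        · rw [norm_mul]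
          gcongr
          · exact hM₀ _ hxt
          · refine (norm_sub_le _ _).trans ?_
            rw [norm_one]
            gcongr
            rw [norm_mul, norm_mul, Complex.norm_I, one_mul, Complex.norm_real,
              ← Complex.ofReal_mul, Complex.norm_real, Real.norm_eq_abs, Real.norm_eq_abs,
              abs_of_nonneg (by positivity : (0 : ℝ) ≤ ε * ‖t‖)]
            gcongr
        · rw [norm_mul, Complex.norm_real, Real.norm_of_nonneg hε.le]
          calc ε * ‖fderiv ℝ u (x + ε • t) t‖ ≤ 1 * (M₁ * 2) := by
                gcongr
                exact (ContinuousLinearMap.le_opNorm _ _).trans (by gcongr; exact hM₁ _ hxt)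
            _ = _ := one_mul _
    · exact (integrable_indicator_iff Metric.isClosed_closedBall.measurableSet).2
        (integrableOn_const (isCompact_closedBall _ _).measure_lt_top.ne)
    · refine ae_of_all _ fun t => ?_
      have hxc : Tendsto (fun ε : ℝ => x + ε • t) (𝓝[>] 0) (𝓝 x) := by
        have : Continuous fun ε : ℝ => x + ε • t := by fun_prop
        simpa using (this.tendsto 0).mono_left (nhdsWithin_le_nhds (s := Ioi 0))
      have hid : Tendsto (fun ε : ℝ => (ε : ℂ)) (𝓝[>] 0) (𝓝 ((0 : ℝ) : ℂ)) :=
        (Complex.continuous_ofReal.tendsto 0).mono_left nhdsWithin_le_nhds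
      have hu1 : Tendsto (fun ε : ℝ => u (x + ε • t)) (𝓝[>] 0) (𝓝 (u (x + (0 : ℝ) • t))) := by
        rw [zero_smul, add_zero]
        exact (hu.differentiableAt hx).continuousAt.tendsto.comp hxc
      have hu2 : Tendsto (fun ε : ℝ => fderiv ℝ u (x + ε • t) t) (𝓝[>] 0)
          (𝓝 (fderiv ℝ u (x + (0 : ℝ) • t) t)) := by
        rw [zero_smul, add_zero]
        exact (((hu.contDiffAt_fderiv hx).continuousAt.clm_apply continuousAt_const).tendsto).comp
          hxc
      have he : Tendsto (fun ε : ℝ => Complex.exp (Complex.I * (κ * (ε * ‖t‖) : ℝ))) (𝓝[>] 0)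
          (𝓝 (Complex.exp (Complex.I * (κ * (0 * ‖t‖) : ℝ)))) := by
        have : Continuous fun ε : ℝ => Complex.exp (Complex.I * (κ * (ε * ‖t‖) : ℝ)) := by fun_prop
        exact (this.tendsto 0).mono_left nhdsWithin_le_nhds
      exact (he.mul ((hu1.mul (((hid.mul_const _).const_mul _).sub_const 1)).sub
        (hid.mul hu2))).const_mul _
  -- In the limit only `u ∇Φ` survives, and its constant is `-(2 / (4π)) * (-2π) = 1`.
  have hF0 : ∫ t, F 0 t = u x := by
    have h1 : ∀ t, F 0 t = (-(2 / (4 * Real.pi)) * (deriv cutoff (‖t‖ ^ 2) / ‖t‖) : ℝ) * u x := by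
      intro t
      simp only [hF, zero_smul, add_zero, zero_mul, mul_zero, Complex.ofReal_zero, Complex.exp_zero,
        one_mul, sub_zero, zero_sub]
      push_cast
      rcases eq_or_ne ‖t‖ 0 with h | h
      · simp [h]
      have hpi := Real.pi_ne_zero
      have : (‖t‖ : ℂ) ≠ 0 := by exact_mod_cast h
      field_simp
    simp only [h1]
    rw [integral_mul_const, integral_complex_ofReal, integral_const_mul, integral_deriv_cutoff_div_norm]
    have hpi := Real.pi_ne_zero
    have : -(2 / (4 * Real.pi)) * -(2 * Real.pi) = 1 := by field_simp; norm_num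
    rw [this]; simp
  rw [hF0] at hlim
  refine hlim.congr' ?_
  filter_upwards [self_mem_nhdsWithin] with ε hε
  exact (hint ε hε).symm

/-! ### Flux through large shells and the radiation condition -/

section FarField

/-- The closed shell between the radii `R` and `2 * R`. -/
def shell (R : ℝ) : Set E3 := Metric.closedBall 0 (2 * R) \ Metric.ball 0 R

theorem isCompact_shell (R : ℝ) : IsCompact (shell R) := isCompact_annulus 0 R

theorem mem_shell {R : ℝ} {y : E3} : y ∈ shell R ↔ ‖y‖ ≤ 2 * R ∧ R ≤ ‖y‖ := by
  simp [shell]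

/-- The length of the gradient of the radial cutoff at scale `R`. -/
def shellWeight (R : ℝ) (y : E3) : ℝ := -(2 / R ^ 2 * deriv cutoff (‖y‖ ^ 2 / R ^ 2) * ‖y‖)

theorem shellWeight_nonneg (R : ℝ) (y : E3) : 0 ≤ shellWeight R y := by
  have h := deriv_cutoff_nonpos (‖y‖ ^ 2 / R ^ 2)
  have : 0 ≤ 2 / R ^ 2 * (-deriv cutoff (‖y‖ ^ 2 / R ^ 2)) * ‖y‖ := by
    have : 0 ≤ -deriv cutoff (‖y‖ ^ 2 / R ^ 2) := by linarith
    positivity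
  unfold shellWeight; linarith

theorem continuous_shellWeight (R : ℝ) : Continuous (shellWeight R) := by
  have h := continuous_deriv_cutoff.comp
    (by fun_prop : Continuous fun y : E3 => ‖y‖ ^ 2 / R ^ 2)
  exact ((continuous_const.mul h).mul continuous_norm).neg

/-- The weight is `O(1 / R)` on a shell of volume `O(R ^ 3)`, which mimics the area of a sphere of
radius `R`. -/
theorem exists_setIntegral_shellWeight_le :
    ∃ C : ℝ, 0 < C ∧ ∀ R, 0 < R → ∫ y in shell R, shellWeight R y ≤ C * R ^ 2 := by
  obtain ⟨M, hM, hMb⟩ := exists_deriv_cutoff_bound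
  refine ⟨4 * M * (8 * (Real.pi * 4 / 3)), by positivity, fun R hR => ?_⟩
  have hb : ∀ y ∈ shell R, shellWeight R y ≤ 4 * M / R := by
    intro y hy
    have h1 := hMb (‖y‖ ^ 2 / R ^ 2)
    have h2 := (mem_shell.1 hy).1
    calc shellWeight R y ≤ |shellWeight R y| := le_abs_self _
      _ = 2 / R ^ 2 * |deriv cutoff (‖y‖ ^ 2 / R ^ 2)| * ‖y‖ := by
          rw [shellWeight, abs_neg, abs_mul, abs_mul, abs_of_nonneg (by positivity : 0 ≤ 2 / R ^ 2),
            abs_norm]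
      _ ≤ 2 / R ^ 2 * M * (2 * R) := by gcongr
      _ = 4 * M / R := by field_simp; norm_num
  have hfin : volume (shell R) ≠ ∞ := (isCompact_shell R).measure_lt_top.ne
  calc ∫ y in shell R, shellWeight R y ≤ ∫ y in shell R, 4 * M / R :=
        setIntegral_mono_on ((continuous_shellWeight R).continuousOn.integrableOn_compact
          (isCompact_shell R)) (integrableOn_const hfin) (isCompact_shell R).measurableSet hb
    _ = volume.real (shell R) * (4 * M / R) := by rw [setIntegral_const, smul_eq_mul]
    _ ≤ (8 * R ^ 3 * (Real.pi * 4 / 3)) * (4 * M / R) := by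
        gcongr
        have h1 : volume.real (shell R) ≤ volume.real (Metric.closedBall (0 : E3) (2 * R)) :=
          measureReal_mono sdiff_subset (isCompact_closedBall _ _).measure_lt_top.ne
        refine h1.trans (le_of_eq ?_)
        rw [Measure.real, EuclideanSpace.volume_closedBall_fin_three,
          ENNReal.toReal_mul, ENNReal.toReal_pow, ENNReal.toReal_ofReal (by positivity),
          ENNReal.toReal_ofReal (by positivity)]
        ring
    _ = _ := by field_simp

/-- The cutoff gradient is radial and points inwards, so the smoothed flux involves only the radial
derivatives that occur in the radiation condition. -/
theorem flux_gradient_radialCutoff_zero (u w : E3 → ℂ) {R : ℝ} {y : E3} (hy : y ≠ 0) :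
    flux u w y (∇ (radialCutoff 0 R) y) = -(shellWeight R y : ℂ) * flux u w y (‖y‖⁻¹ • y) := by
  have hn : ‖y‖ ≠ 0 := norm_ne_zero_iff.2 hy
  have : ∇ (radialCutoff 0 R) y = (-shellWeight R y) • (‖y‖⁻¹ • y) := by
    rw [gradient_radialCutoff, sub_zero, shellWeight, neg_neg, smul_smul]
    congr 1
    field_simp
  rw [this, map_smul, Complex.real_smul]
  push_cast; rfl

theorem integral_flux_gradient_eq_setIntegral_shell (u w : E3 → ℂ) {R : ℝ} (hR : 0 < R) :
    ∫ y, flux u w y (∇ (radialCutoff 0 R) y) =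
      ∫ y in shell R, flux u w y (∇ (radialCutoff 0 R) y) := by
  refine (setIntegral_eq_integral_of_forall_compl_eq_zero fun y hy => ?_).symm
  rw [gradient_radialCutoff_eq_zero hR hy, map_zero]

variable {κ : ℝ} {V : Set E3} {u : E3 → ℂ} {R₀ : ℝ}

theorem shell_subset (hV : (Metric.closedBall 0 R₀)ᶜ ⊆ V) {R : ℝ} (hR : R₀ < R) :
    shell R ⊆ V := fun y hy => hV (by
  simp only [mem_compl_iff, mem_closedBall_zero_iff, not_le]
  exact lt_of_lt_of_le hR (mem_shell.1 hy).2)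

theorem integrable_flux_gradient_radialCutoff {w : E3 → ℂ} (hu : IsHelmholtzOn κ V u)
    (hw : IsHelmholtzOn κ V w) (hV : (Metric.closedBall 0 R₀)ᶜ ⊆ V) {R : ℝ} (hR0 : 0 < R)
    (hR : R₀ < R) : Integrable fun y => flux u w y (∇ (radialCutoff 0 R) y) := by
  refine (continuous_flux_gradient_radialCutoff hu hw hR0
    (shell_subset hV hR)).integrable_of_hasCompactSupport ?_
  refine HasCompactSupport.intro (isCompact_shell R) fun y hy => ?_
  rw [gradient_radialCutoff_eq_zero hR0 hy, map_zero]

/-- The flux through large spheres does not depend on the radius. -/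
theorem integral_flux_gradient_radialCutoff_eq {w : E3 → ℂ} (hu : IsHelmholtzOn κ V u)
    (hw : IsHelmholtzOn κ V w) (hV : (Metric.closedBall 0 R₀)ᶜ ⊆ V) {R R' : ℝ} (hR0 : 0 < R)
    (hR : R₀ < R) (hRR' : R ≤ R') :
    ∫ y, flux u w y (∇ (radialCutoff 0 R') y) = ∫ y, flux u w y (∇ (radialCutoff 0 R) y) := by
  have hR0' : 0 < R' := hR0.trans_le hRR'
  -- The difference vanishes on the ball of radius `R`, hence is supported where both functions
  -- solve the equation, and its total flux is zero.
  set φ : E3 → ℝ := fun y => radialCutoff 0 R' y - radialCutoff 0 R y with hφ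
  have hφd : ContDiff ℝ 1 φ := contDiff_radialCutoff.sub contDiff_radialCutoff
  have hφc : HasCompactSupport φ :=
    (hasCompactSupport_radialCutoff hR0').sub (hasCompactSupport_radialCutoff hR0)
  have hφs : tsupport φ ⊆ V := by
    have h1 : tsupport φ ⊆ (Metric.ball 0 R)ᶜ := by
      refine closure_minimal (fun y hy hyb => hy ?_) Metric.isOpen_ball.isClosed_compl
      rw [mem_ball_zero_iff] at hyb
      simp only [hφ]
      rw [radialCutoff_eq_one hR0' (by rw [sub_zero]; linarith),
        radialCutoff_eq_one hR0 (by rw [sub_zero]; linarith), sub_self]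
    refine h1.trans (Subset.trans ?_ hV)
    exact compl_subset_compl.2 (Metric.closedBall_subset_ball hR)
  have h0 := integral_flux_gradient_eq_zero hu hw hφd hφc hφs
  have hg : ∀ y, ∇ φ y = ∇ (radialCutoff 0 R') y - ∇ (radialCutoff 0 R) y := by
    intro y
    simp only [gradient, hφ]
    rw [← map_sub]
    congr 1
    exact fderiv_sub (contDiff_radialCutoff.differentiable one_ne_zero y)
      (contDiff_radialCutoff.differentiable one_ne_zero y)
  simp only [hg, map_sub] at h0
  rw [integral_sub (integrable_flux_gradient_radialCutoff hu hw hV hR0' (hR.trans_le hRR'))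
    (integrable_flux_gradient_radialCutoff hu hw hV hR0 hR)] at h0
  exact sub_eq_zero.1 h0

theorem exists_radiation_bound
    (hrad : Tendsto (fun y : E3 => (‖y‖ : ℂ) *
      (fderiv ℝ u y (‖y‖⁻¹ • y) - Complex.I * κ * u y)) (Bornology.cobounded E3) (𝓝 0))
    {δ : ℝ} (hδ : 0 < δ) : ∃ R₁ : ℝ, 0 < R₁ ∧ ∀ y : E3, R₁ ≤ ‖y‖ →
      ‖fderiv ℝ u y (‖y‖⁻¹ • y) - Complex.I * κ * u y‖ ≤ δ / ‖y‖ := by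
  have h1 := (Metric.tendsto_nhds.1 hrad) δ hδ
  rw [← comap_norm_atTop, eventually_comap] at h1
  obtain ⟨R, hR⟩ := eventually_atTop.1 h1
  refine ⟨max R 1, by positivity, fun y hy => ?_⟩
  have h2 := hR ‖y‖ ((le_max_left _ _).trans hy) y rfl
  have h3 : 0 < ‖y‖ := lt_of_lt_of_le (by positivity) hy
  rw [dist_zero_right, norm_mul, Complex.norm_real, norm_norm] at h2
  rw [le_div_iff₀ h3, mul_comm]
  exact h2.le

/-- Radiating solutions are bounded in mean square on large shells. -/
theorem exists_setIntegral_shell_norm_sq_le (hκ : 0 < κ) (hu : IsHelmholtzOn κ V u)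
    (hV : (Metric.closedBall 0 R₀)ᶜ ⊆ V)
    (hrad : Tendsto (fun y : E3 => (‖y‖ : ℂ) *
      (fderiv ℝ u y (‖y‖⁻¹ • y) - Complex.I * κ * u y)) (Bornology.cobounded E3) (𝓝 0)) :
    ∃ C R₁ : ℝ, 0 < C ∧ ∀ R, R₁ ≤ R → ∫ y in shell R, shellWeight R y * ‖u y‖ ^ 2 ≤ C := by
  obtain ⟨R₂, hR₂, hb⟩ := exists_radiation_bound hrad one_pos
  obtain ⟨Cg, hCg, hg⟩ := exists_setIntegral_shellWeight_le
  set R₁ := max R₂ (R₀ + 1) with hR₁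
  have hR₁0 : 0 < R₁ := lt_of_lt_of_le hR₂ (le_max_left _ _)
  have hR₁0' : R₀ < R₁ := lt_of_lt_of_le (lt_add_one _) (le_max_right _ _)
  -- The conserved energy flux: the bound comes from its being the same for all `R ≥ R₁`.
  set c₀ := ∫ y, flux u (fun y => conj (u y)) y (∇ (radialCutoff 0 R₁) y) with hc₀
  refine ⟨(‖c₀‖ + Cg / κ) / κ, R₁, by positivity, fun R hR => ?_⟩
  have hR0 : 0 < R := hR₁0.trans_le hR
  have hRR₀ : R₀ < R := hR₁0'.trans_le hR
  have hc : ∫ y in shell R, flux u (fun y => conj (u y)) y (∇ (radialCutoff 0 R) y) = c₀ := by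
    rw [← integral_flux_gradient_eq_setIntegral_shell _ _ hR0]
    exact integral_flux_gradient_radialCutoff_eq hu hu.conjugate hV hR₁0 hR₁0' hR
  have hfi : IntegrableOn (fun y => flux u (fun y => conj (u y)) y (∇ (radialCutoff 0 R) y))
      (shell R) :=
    (integrable_flux_gradient_radialCutoff hu hu.conjugate hV hR0 hRR₀).integrableOn
  have hsub := shell_subset hV hRR₀
  have hui : IntegrableOn (fun y => shellWeight R y * ‖u y‖ ^ 2) (shell R) := by
    refine ContinuousOn.integrableOn_compact (isCompact_shell R) ?_
    exact (continuous_shellWeight R).continuousOn.mul (((hu.continuousOn.mono hsub).norm).pow 2)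
  have hgi : IntegrableOn (shellWeight R) (shell R) :=
    (continuous_shellWeight R).continuousOn.integrableOn_compact (isCompact_shell R)
  have hpt : ∀ y ∈ shell R, κ * (shellWeight R y * ‖u y‖ ^ 2) ≤
      (flux u (fun y => conj (u y)) y (∇ (radialCutoff 0 R) y)).im +
        1 / (κ * R ^ 2) * shellWeight R y := by
    intro y hy
    have hyR := (mem_shell.1 hy).2
    have hy0 : y ≠ 0 := norm_pos_iff.1 (hR0.trans_le hyR)
    rw [flux_gradient_radialCutoff_zero _ _ hy0, flux_apply]
    have hconj : ∀ v, fderiv ℝ (fun y => conj (u y)) y v = conj (fderiv ℝ u y v) := by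
      intro v
      have := (Complex.conjCLE : ℂ →L[ℝ] ℂ).hasFDerivAt.comp y
        (hu.differentiableAt (hsub hy)).hasFDerivAt
      exact congrArg (fun T => T v) this.fderiv
    rw [hconj]
    have hh := hb y ((le_max_left _ _).trans (hR.trans hyR))
    set a := fderiv ℝ u y (‖y‖⁻¹ • y) with ha
    set h := a - Complex.I * κ * u y with hh'
    have hhR : ‖h‖ ≤ 1 / R := hh.trans (by gcongr)
    have haeq : a = h + Complex.I * κ * u y := by rw [hh']; ring
    -- With the radial derivative written as `iκu + h`, the imaginary part of the flux is coercive
    -- in `‖u y‖ ^ 2` because `κ > 0`. The cross term with `h = O(1 / R)` is absorbed by Young's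
    -- inequality, at the price of half the coercive term.
    have him : (-(shellWeight R y : ℂ) * (u y * conj a - conj (u y) * a)).im =
        2 * shellWeight R y * (κ * ‖u y‖ ^ 2 + (conj (u y) * h).im) := by
      rw [haeq, ← Complex.normSq_eq_norm_sq, Complex.normSq_apply]
      simp
      ring
    rw [him]
    have h1 : -(‖u y‖ * ‖h‖) ≤ (conj (u y) * h).im := by
      have := Complex.abs_im_le_norm (conj (u y) * h)
      rw [norm_mul, RCLike.norm_conj] at this
      exact neg_le_of_abs_le this
    have hw := shellWeight_nonneg R y
    have h2 : κ * ‖u y‖ ^ 2 ≤ 2 * (κ * ‖u y‖ ^ 2 + (conj (u y) * h).im) + 1 / (κ * R ^ 2) := by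
      have h3 : 2 * (‖u y‖ * ‖h‖) ≤ κ * ‖u y‖ ^ 2 + ‖h‖ ^ 2 / κ := by
        have : κ * ‖u y‖ ^ 2 + ‖h‖ ^ 2 / κ - 2 * (‖u y‖ * ‖h‖) = (κ * ‖u y‖ - ‖h‖) ^ 2 / κ := by
          field_simp; ring
        have : 0 ≤ (κ * ‖u y‖ - ‖h‖) ^ 2 / κ := by positivity
        linarith
      have h4 : ‖h‖ ^ 2 / κ ≤ 1 / (κ * R ^ 2) := by
        calc ‖h‖ ^ 2 / κ ≤ (1 / R) ^ 2 / κ := by gcongr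
          _ = _ := by field_simp
      linarith
    calc κ * (shellWeight R y * ‖u y‖ ^ 2) = shellWeight R y * (κ * ‖u y‖ ^ 2) := by ring
      _ ≤ shellWeight R y * (2 * (κ * ‖u y‖ ^ 2 + (conj (u y) * h).im) + 1 / (κ * R ^ 2)) := by
          gcongr
      _ = _ := by ring
  have hfim : IntegrableOn (fun y => (flux u (fun y => conj (u y)) y
      (∇ (radialCutoff 0 R) y)).im) (shell R) := hfi.im
  have hI : ∫ y in shell R, κ * (shellWeight R y * ‖u y‖ ^ 2) ≤
      ∫ y in shell R, ((flux u (fun y => conj (u y)) y (∇ (radialCutoff 0 R) y)).im +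
        1 / (κ * R ^ 2) * shellWeight R y) := setIntegral_mono_on (hui.const_mul κ) (hfim.add (hgi.const_mul (1 / (κ * R ^ 2))))
    (isCompact_shell R).measurableSet hpt
  rw [integral_const_mul] at hI
  have hsum : ∫ y in shell R, ((flux u (fun y => conj (u y)) y (∇ (radialCutoff 0 R) y)).im +
        1 / (κ * R ^ 2) * shellWeight R y) =
      c₀.im + 1 / (κ * R ^ 2) * ∫ y in shell R, shellWeight R y := by
    rw [integral_add hfim (hgi.const_mul _), integral_const_mul, ← hc]
    congr 1
    exact integral_im hfi
  rw [hsum] at hI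
  rw [le_div_iff₀ hκ, mul_comm]
  refine hI.trans (add_le_add ((le_abs_self _).trans (Complex.abs_im_le_norm _)) ?_)
  calc 1 / (κ * R ^ 2) * ∫ y in shell R, shellWeight R y ≤ 1 / (κ * R ^ 2) * (Cg * R ^ 2) := by
        gcongr; exact hg R hR0
    _ = _ := by field_simp

theorem norm_greenFun (κ : ℝ) (x y : E3) : ‖greenFun κ x y‖ = 1 / (4 * Real.pi * ‖x - y‖) := by
  rw [greenFun, norm_div, mul_comm Complex.I, Complex.norm_exp_ofReal_mul_I, Complex.norm_real,
    Real.norm_of_nonneg (by positivity)]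

/-- Bounds for the fundamental solution far from its pole. -/
theorem greenFun_far_bounds (κ : ℝ) {x y : E3} {R : ℝ} (hR : 0 < R) (hx : 2 * ‖x‖ ≤ R)
    (hy : R ≤ ‖y‖) : ‖greenFun κ x y‖ ≤ 2 / R ∧
      ‖fderiv ℝ (greenFun κ x) y (‖y‖⁻¹ • y) - Complex.I * κ * greenFun κ x y‖ ≤
        4 * (2 * |κ| * ‖x‖ + 1) / R ^ 2 := by
  have hy0 : 0 < ‖y‖ := hR.trans_le hy
  set ρ := ‖x - y‖ with hρ
  have hρ1 : ‖y‖ ≤ ρ + ‖x‖ := by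
    have := norm_sub_norm_le y x
    rw [norm_sub_rev] at this; linarith
  have hρ2 : R / 2 ≤ ρ := by linarith
  have hρ0 : 0 < ρ := by linarith
  have hpi : 1 ≤ 4 * Real.pi := by linarith [Real.pi_gt_three]
  constructor
  · rw [norm_greenFun, ← hρ]
    calc 1 / (4 * Real.pi * ρ) ≤ 1 / (1 * (R / 2)) := by gcongr
      _ = 2 / R := by field_simp
  · have hne : y ≠ x := by
      rintro rfl
      rw [sub_self, norm_zero] at hρ
      exact hρ0.ne' hρ
    -- `c` is the cosine of the angle between `y - x` and `y`; its distance from 1 is `O(1 / ρ)`, so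
    -- differentiating along `y` rather than along `y - x` costs no order of decay.
    set c := ⟪y - x, ‖y‖⁻¹ • y⟫_ℝ / ρ with hc
    have hunit : ‖‖y‖⁻¹ • y‖ = 1 := by
      rw [norm_smul, norm_inv, norm_norm, inv_mul_cancel₀ hy0.ne']
    have hc1 : |c| ≤ 1 := by
      rw [hc, abs_div, abs_of_pos hρ0, div_le_one hρ0]
      refine (abs_real_inner_le_norm _ _).trans ?_
      rw [hunit, mul_one, norm_sub_rev]
    have hc2 : |c - 1| ≤ 2 * ‖x‖ / ρ := by
      have h1 : ⟪y - x, ‖y‖⁻¹ • y⟫_ℝ = ‖y‖ - ⟪x, ‖y‖⁻¹ • y⟫_ℝ := by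
        rw [inner_sub_left, real_inner_smul_right, real_inner_self_eq_norm_sq]
        congr 1
        field_simp
      have h2 : |⟪x, ‖y‖⁻¹ • y⟫_ℝ| ≤ ‖x‖ := by
        refine (abs_real_inner_le_norm _ _).trans ?_
        rw [hunit, mul_one]
      have h3 : |‖y‖ - ρ| ≤ ‖x‖ := by
        have := abs_norm_sub_norm_le y (y - x)
        rwa [sub_sub_cancel, norm_sub_rev y x] at this
      have h4 : c - 1 = ((‖y‖ - ρ) - ⟪x, ‖y‖⁻¹ • y⟫_ℝ) / ρ := by
        rw [hc, h1]; field_simp; ring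
      rw [h4, abs_div, abs_of_pos hρ0]
      gcongr
      refine (abs_sub _ _).trans ?_
      linarith
    have hρc : (ρ : ℂ) ≠ 0 := by exact_mod_cast hρ0.ne'
    have hpic : (Real.pi : ℂ) ≠ 0 := by exact_mod_cast Real.pi_ne_zero
    have hcρ : ⟪y - x, ‖y‖⁻¹ • y⟫_ℝ = c * ρ := by rw [hc]; field_simp
    have hexpr : fderiv ℝ (greenFun κ x) y (‖y‖⁻¹ • y) - Complex.I * κ * greenFun κ x y =
        greenFun κ x y * (Complex.I * κ * ((c - 1 : ℝ) : ℂ) - ((c / ρ : ℝ) : ℂ)) := by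
      rw [(hasFDerivAt_greenFun κ hne).fderiv, ContinuousLinearMap.smulRight_apply,
        innerSL_apply_apply, hcρ, greenSlope, greenFun, Complex.real_smul, ← hρ]
      push_cast
      field_simp
      ring
    rw [hexpr, norm_mul, norm_greenFun, ← hρ]
    have h5 : ‖Complex.I * κ * ((c - 1 : ℝ) : ℂ) - ((c / ρ : ℝ) : ℂ)‖ ≤
        (2 * |κ| * ‖x‖ + 1) / ρ := by
      refine (norm_sub_le _ _).trans ?_
      rw [norm_mul, norm_mul, Complex.norm_I, one_mul, Complex.norm_real, Complex.norm_real,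
        Complex.norm_real, Real.norm_eq_abs, Real.norm_eq_abs, Real.norm_eq_abs, abs_div,
        abs_of_pos hρ0]
      calc |κ| * |c - 1| + |c| / ρ ≤ |κ| * (2 * ‖x‖ / ρ) + 1 / ρ := by gcongr
        _ = _ := by field_simp
    calc 1 / (4 * Real.pi * ρ) * ‖Complex.I * κ * ((c - 1 : ℝ) : ℂ) - ((c / ρ : ℝ) : ℂ)‖
        ≤ 1 / (1 * (R / 2)) * ((2 * |κ| * ‖x‖ + 1) / (R / 2)) := by
          gcongr
          exact h5.trans (by gcongr)
      _ = _ := by field_simp; norm_num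

/-- The flux of `u ∇Φ - Φ ∇u` through large spheres vanishes for radiating `u`. -/
theorem tendsto_flux_far (hκ : 0 < κ) (hu : IsHelmholtzOn κ V u)
    (hV : (Metric.closedBall 0 R₀)ᶜ ⊆ V)
    (hrad : Tendsto (fun y : E3 => (‖y‖ : ℂ) *
      (fderiv ℝ u y (‖y‖⁻¹ • y) - Complex.I * κ * u y)) (Bornology.cobounded E3) (𝓝 0)) (x : E3) :
    Tendsto (fun R : ℝ => ∫ y, flux u (greenFun κ x) y (∇ (radialCutoff 0 R) y)) atTop (𝓝 0) := by
  obtain ⟨C, R₁, hC, hCb⟩ := exists_setIntegral_shell_norm_sq_le hκ hu hV hrad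
  obtain ⟨Cg, hCg, hg⟩ := exists_setIntegral_shellWeight_le
  set k := 4 * (2 * |κ| * ‖x‖ + 1) with hk
  have hk0 : 0 < k := by positivity
  rw [Metric.tendsto_nhds]
  intro ε hε
  -- The radiation error of `u` contributes at most `2 * δ * Cg = ε / 2` in the end.
  set δ := ε / (4 * Cg) with hδ
  have hδ0 : 0 < δ := by positivity
  obtain ⟨R₂, hR₂, hb⟩ := exists_radiation_bound hrad hδ0
  have hsmall : ∀ᶠ R : ℝ in atTop, (C + k ^ 2 * Cg) / R < ε / 2 :=
    (tendsto_const_nhds.div_atTop tendsto_id).eventually_lt_const (by positivity)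
  filter_upwards [hsmall, eventually_ge_atTop R₁, eventually_ge_atTop R₂, eventually_gt_atTop R₀,
    eventually_ge_atTop (2 * ‖x‖)] with R hRs hR1 hR2 hR0 hRx
  have hRp : 0 < R := hR₂.trans_le hR2
  have hsub := shell_subset hV hR0
  have hui : IntegrableOn (fun y => shellWeight R y * ‖u y‖ ^ 2) (shell R) := by
    refine ContinuousOn.integrableOn_compact (isCompact_shell R) ?_
    exact (continuous_shellWeight R).continuousOn.mul (((hu.continuousOn.mono hsub).norm).pow 2)
  have hgi : IntegrableOn (shellWeight R) (shell R) :=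
    (continuous_shellWeight R).continuousOn.integrableOn_compact (isCompact_shell R)
  have hpt : ∀ y ∈ shell R, ‖flux u (greenFun κ x) y (∇ (radialCutoff 0 R) y)‖ ≤
      1 / R * (shellWeight R y * ‖u y‖ ^ 2) +
        (k ^ 2 / R ^ 3 + 2 * δ / R ^ 2) * shellWeight R y := by
    intro y hy
    have hyR := (mem_shell.1 hy).2
    have hy0 : y ≠ 0 := norm_pos_iff.1 (hRp.trans_le hyR)
    have hw := shellWeight_nonneg R y
    obtain ⟨hΦ, hkb⟩ := greenFun_far_bounds κ hRp hRx hyR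
    have hh : ‖fderiv ℝ u y (‖y‖⁻¹ • y) - Complex.I * κ * u y‖ ≤ δ / R :=
      (hb y (hR2.trans hyR)).trans (by gcongr)
    rw [flux_gradient_radialCutoff_zero _ _ hy0, flux_apply, norm_mul, norm_neg, Complex.norm_real,
      Real.norm_of_nonneg hw]
    -- Subtracting `iκ` times the function from either radial derivative adds terms that cancel, so
    -- both radiation defects can be used.
    have h1 : u y * fderiv ℝ (greenFun κ x) y (‖y‖⁻¹ • y) -
        greenFun κ x y * fderiv ℝ u y (‖y‖⁻¹ • y) =
        u y * (fderiv ℝ (greenFun κ x) y (‖y‖⁻¹ • y) - Complex.I * κ * greenFun κ x y) -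
        greenFun κ x y * (fderiv ℝ u y (‖y‖⁻¹ • y) - Complex.I * κ * u y) := by ring
    -- Only a mean square bound on `u` is available, so the product is split by Young's inequality;
    -- both resulting integrals over the shell are `O(1 / R)`.
    have h2 : ‖u y‖ * (k / R ^ 2) ≤ 1 / R * ‖u y‖ ^ 2 + k ^ 2 / R ^ 3 := by
      have h3 : 1 / R * ‖u y‖ ^ 2 + k ^ 2 / R ^ 3 - ‖u y‖ * (k / R ^ 2) =
          1 / R * ((‖u y‖ - k / R / 2) ^ 2 + 3 / 4 * (k / R) ^ 2) := by
        field_simp; ring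
      have : 0 ≤ 1 / R * ((‖u y‖ - k / R / 2) ^ 2 + 3 / 4 * (k / R) ^ 2) := by positivity
      linarith
    rw [h1]
    calc shellWeight R y * ‖_ - _‖ ≤ shellWeight R y *
          (‖u y‖ * (k / R ^ 2) + 2 / R * (δ / R)) := by
          gcongr
          refine (norm_sub_le _ _).trans ?_
          rw [norm_mul, norm_mul]
          gcongr
      _ ≤ shellWeight R y * (1 / R * ‖u y‖ ^ 2 + k ^ 2 / R ^ 3 + 2 / R * (δ / R)) := by gcongr
      _ = _ := by field_simp; ring
  rw [dist_zero_right, integral_flux_gradient_eq_setIntegral_shell _ _ hRp]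
  have hI := norm_integral_le_of_norm_le ((hui.const_mul (1 / R)).add
    (hgi.const_mul (k ^ 2 / R ^ 3 + 2 * δ / R ^ 2)))
    ((ae_restrict_iff' (isCompact_shell R).measurableSet).2 (ae_of_all _ hpt))
  rw [integral_add' (hui.const_mul _) (hgi.const_mul _), integral_const_mul,
    integral_const_mul] at hI
  refine hI.trans_lt ?_
  calc 1 / R * (∫ y in shell R, shellWeight R y * ‖u y‖ ^ 2) +
        (k ^ 2 / R ^ 3 + 2 * δ / R ^ 2) * ∫ y in shell R, shellWeight R y
      ≤ 1 / R * C + (k ^ 2 / R ^ 3 + 2 * δ / R ^ 2) * (Cg * R ^ 2) := by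
        gcongr
        · exact hCb R hR1
        · exact hg R hRp
    _ = (C + k ^ 2 * Cg) / R + ε / 2 := by
        rw [hδ]; field_simp; ring
    _ < ε := by linarith

end FarField

/-! ### Green's representation formula in the exterior -/

theorem IsScatteredWave.isHelmholtzOn {κ : ℝ} {d : E3} (hd : ‖d‖ = 1) {D : Set E3} {us : E3 → ℂ}
    (h : IsScatteredWave κ d D us) : IsHelmholtzOn κ (closure D)ᶜ us := by
  have hopen : IsOpen (closure D)ᶜ := isClosed_closure.isOpen_compl
  have heq : us = fun y => (planeWave κ d y + us y) - planeWave κ d y := by ext y; ring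
  refine ⟨hopen, ?_, fun y hy => ?_⟩
  · rw [heq]
    exact h.contDiffOn.sub (contDiff_planeWave κ d).contDiffOn
  · have h1 := (h.contDiffOn.contDiffAt (hopen.mem_nhds hy)).laplacian_sub
      (contDiff_planeWave κ d).contDiffAt
    have h2 : ((fun y => planeWave κ d y + us y) - planeWave κ d) = us := by
      ext y; simp
    rw [h2] at h1
    rw [h1, (isHelmholtzOn_planeWave κ hd).laplacian_eq y (mem_univ y)]
    linear_combination h.helmholtz y hy

/-- A smooth function vanishing near the compact set `K` and equal to `1` near the complement of
the open set `B`. -/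
theorem exists_contDiff_zero_one {K B : Set E3} (hK : IsCompact K) (hB : IsOpen B) (h : K ⊆ B) :
    ∃ τ : E3 → ℝ, ContDiff ℝ 1 τ ∧ (∀ y ∈ K, ∀ᶠ z in 𝓝 y, τ z = 0) ∧
      ∀ y, y ∉ B → ∀ᶠ z in 𝓝 y, τ z = 1 := by
  obtain ⟨K', hK', hKK', hK'B⟩ := exists_compact_between hK hB h
  obtain ⟨f, hf1, hf0, -⟩ := exists_contMDiffMap_one_nhds_of_subset_interior
    (modelWithCornersSelf ℝ E3) (n := 1) hK.isClosed hKK'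
  refine ⟨fun y => 1 - f y, contDiff_const.sub (contMDiff_iff_contDiff.1 f.contMDiff), ?_, ?_⟩
  · intro y hy
    filter_upwards [(eventually_nhdsSet_iff_forall.1 hf1) y hy] with z hz
    rw [hz, sub_self]
  · intro y hy
    filter_upwards [hK'.isClosed.isOpen_compl.mem_nhds fun hh => hy (hK'B hh)] with z hz
    rw [hf0 z hz, sub_zero]

/-- Green's representation formula for radiating solutions of the Helmholtz equation in the
exterior of a Lipschitz domain. -/
theorem IsLipschitzDomain.representation {κ : ℝ} (hκ : 0 < κ) {B K : Set E3}
    (hB : IsLipschitzDomain B) (hK : IsCompact K) (hKB : K ⊆ B) {u : E3 → ℂ}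
    (hu : IsHelmholtzOn κ Kᶜ u)
    (hrad : Tendsto (fun y : E3 => (‖y‖ : ℂ) *
      (fderiv ℝ u y (‖y‖⁻¹ • y) - Complex.I * κ * u y)) (Bornology.cobounded E3) (𝓝 0))
    {x : E3} (hx : x ∉ closure B) :
    u x = ∫ z, (u z * greenNormal κ B x z - greenFun κ x z * normalDeriv B u z)
      ∂surfaceMeasure B := by
  obtain ⟨τ, hτ, hτ0, hτ1⟩ := exists_contDiff_zero_one hK hB.isOpen hKB
  obtain ⟨R', hR'⟩ := hB.isBounded.closure.exists_norm_le
  set R₀ := max R' 0 + ‖x‖ + 1 with hR₀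
  have hBR : ∀ y ∈ closure B, ‖y‖ < R₀ := fun y hy => by
    have := (hR' y hy).trans (le_max_left R' 0)
    have := norm_nonneg x
    linarith
  have hxR : ‖x‖ + 1 ≤ R₀ := by
    have := le_max_right R' 0
    linarith
  have hR₀0 : 0 < R₀ := by
    have := norm_nonneg x
    linarith
  obtain ⟨δ, hδ, hδB⟩ := Metric.isOpen_iff.1 (isClosed_closure (s := B)).isOpen_compl x hx
  have hxK : x ∈ Kᶜ := fun hh => hx (subset_closure (hKB hh))
  set U : Set E3 := Kᶜ ∩ {x}ᶜ with hU
  have hUo : IsOpen U := hu.isOpen.inter isOpen_compl_singleton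
  have huU : IsHelmholtzOn κ U u := hu.mono hUo inter_subset_left
  have hΦU : IsHelmholtzOn κ U (greenFun κ x) :=
    (isHelmholtzOn_greenFun κ x).mono hUo inter_subset_right
  have hUR : (Metric.closedBall 0 R₀)ᶜ ⊆ U := by
    intro y hy
    simp only [mem_compl_iff, mem_closedBall_zero_iff, not_le] at hy
    refine ⟨fun hh => ?_, ?_⟩
    · exact (hBR y (subset_closure (hKB hh))).not_gt hy
    · rintro rfl; linarith
  set X := ∫ z, (u z * greenNormal κ B x z - greenFun κ x z * normalDeriv B u z)
      ∂surfaceMeasure B with hX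
  have key : ∀ ε R : ℝ, 0 < ε → ε ≤ 1 → 2 * ε < δ → R₀ < R →
      (∫ y, flux u (greenFun κ x) y (∇ (radialCutoff 0 R) y)) -
        ∫ y, flux u (greenFun κ x) y (∇ (radialCutoff x ε) y) = -X := by
    intro ε R hε hε1 hεδ hR
    have hR0 : 0 < R := hR₀0.trans hR
    have hfarB : ∀ y ∈ closure B, 2 * ε < ‖y - x‖ := by
      intro y hy
      by_contra! hh
      exact hδB (mem_ball_iff_norm.2 (hh.trans_lt hεδ)) hy
    -- The second cutoff removes the pole `x` and the first truncates at infinity; the factor `τ`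
    -- below removes `K` while leaving everything outside `B` untouched.
    set ψ : E3 → ℝ := fun y => radialCutoff 0 R y - radialCutoff x ε y with hψ
    have hψd : ContDiff ℝ 1 ψ := contDiff_radialCutoff.sub contDiff_radialCutoff
    have hψc : HasCompactSupport ψ :=
      (hasCompactSupport_radialCutoff hR0).sub (hasCompactSupport_radialCutoff hε)
    set φ : E3 → ℝ := fun y => τ y * ψ y with hφ
    have hφd : ContDiff ℝ 1 φ := hτ.mul hψd
    have hφc : HasCompactSupport φ := hψc.mul_left
    have hφU : tsupport φ ⊆ U := by
      intro y hy
      refine ⟨fun hyK => ?_, fun hyx => ?_⟩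
      · refine (notMem_tsupport_iff_eventuallyEq.2 ?_) hy
        filter_upwards [hτ0 y hyK] with z hz
        simp [hφ, hz]
      · rw [mem_singleton_iff] at hyx
        subst hyx
        refine (notMem_tsupport_iff_eventuallyEq.2 ?_) hy
        filter_upwards [Metric.ball_mem_nhds y hε] with z hz
        rw [mem_ball_iff_norm] at hz
        have hzn : ‖z‖ ≤ R := by
          have := norm_le_norm_add_norm_sub' z y
          linarith
        simp only [hφ, hψ, Pi.zero_apply]
        rw [radialCutoff_eq_one hR0 (by rwa [sub_zero]), radialCutoff_eq_one hε hz.le, sub_self,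
          mul_zero]
    have hφ1 : ∀ z ∈ frontier B, φ z = 1 := by
      intro z hz
      have hzc := frontier_subset_closure hz
      have hzB : z ∉ B := by rw [hB.isOpen.frontier_eq] at hz; exact hz.2
      simp only [hφ, hψ]
      rw [(hτ1 z hzB).self_of_nhds, radialCutoff_eq_one hR0 (by
          rw [sub_zero]; exact ((hBR z hzc).trans hR).le),
        radialCutoff_eq_zero hε (hfarB z hzc).le]
      norm_num
    have h1 := hB.integral_compl_flux_gradient huU hΦU hφd hφc hφU hφ1
    have hgrad : ∀ y ∈ Bᶜ, flux u (greenFun κ x) y (∇ φ y) =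
        flux u (greenFun κ x) y (∇ (radialCutoff 0 R) y) -
          flux u (greenFun κ x) y (∇ (radialCutoff x ε) y) := by
      intro y hy
      have h2 : φ =ᶠ[𝓝 y] ψ := by
        filter_upwards [hτ1 y hy] with z hz
        simp only [hφ, hz, one_mul]
      rw [← map_sub]
      congr 1
      simp only [gradient]
      rw [h2.fderiv_eq, ← map_sub]
      congr 1
      exact fderiv_sub (contDiff_radialCutoff.differentiable one_ne_zero y)
        (contDiff_radialCutoff.differentiable one_ne_zero y)
    have hi1 : Integrable fun y => flux u (greenFun κ x) y (∇ (radialCutoff 0 R) y) :=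
      integrable_flux_gradient_radialCutoff huU hΦU hUR hR0 hR
    have hi2 : Integrable fun y => flux u (greenFun κ x) y (∇ (radialCutoff x ε) y) := by
      refine (continuous_flux_gradient_radialCutoff huU hΦU hε ?_).integrable_of_hasCompactSupport ?_
      · intro y hy
        refine ⟨fun hh => ?_, ?_⟩
        · exact (hfarB y (subset_closure (hKB hh))).not_ge (mem_closedBall_iff_norm.1 hy.1)
        · rintro rfl
          exact hy.2 (Metric.mem_ball_self hε)
      · refine HasCompactSupport.intro (isCompact_annulus x ε) fun y hy => ?_
        rw [gradient_radialCutoff_eq_zero hε hy, map_zero]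
    -- Both cutoff gradients vanish on `B`: the large ball contains it and the small annulus misses
    -- it. The integrals over the complement of `B` are therefore integrals over the whole space.
    rw [setIntegral_congr_fun hB.isOpen.measurableSet.compl hgrad,
      integral_sub hi1.integrableOn hi2.integrableOn,
      setIntegral_eq_integral_of_forall_compl_eq_zero,
      setIntegral_eq_integral_of_forall_compl_eq_zero] at h1
    · rw [h1]; rfl
    · intro y hy
      rw [notMem_compl_iff] at hy
      rw [gradient_radialCutoff_eq_zero hε, map_zero]
      intro hh
      exact (hfarB y (subset_closure hy)).not_ge (mem_closedBall_iff_norm.1 hh.1)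
    · intro y hy
      rw [notMem_compl_iff] at hy
      rw [gradient_radialCutoff_eq_zero hR0, map_zero]
      intro hh
      exact hh.2 (mem_ball_zero_iff.2 ((hBR y (subset_closure hy)).trans hR))
  have hfar := tendsto_flux_far hκ huU hUR hrad x
  have hnear := tendsto_flux_near_pole hu hxK
  -- For fixed small `ε`, letting `R → ∞` identifies the flux around the pole with the boundary
  -- integral exactly; only afterwards does `ε` tend to zero.
  have hev : ∀ᶠ ε : ℝ in 𝓝[>] 0,
      ∫ y, flux u (greenFun κ x) y (∇ (radialCutoff x ε) y) = X := by
    filter_upwards [Ioo_mem_nhdsGT (show (0 : ℝ) < min 1 (δ / 2) by positivity)] with ε hε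
    have h1 := lt_of_lt_of_le hε.2 (min_le_left _ _)
    have h2 := lt_of_lt_of_le hε.2 (min_le_right _ _)
    have h3 : Tendsto (fun _ : ℝ =>
        (∫ y, flux u (greenFun κ x) y (∇ (radialCutoff x ε) y)) - X) atTop (𝓝 0) := by
      refine hfar.congr' ?_
      filter_upwards [eventually_gt_atTop R₀] with R hR
      have := key ε R hε.1 h1.le (by linarith) hR
      linear_combination this
    exact sub_eq_zero.1 (tendsto_nhds_unique tendsto_const_nhds h3)
  exact tendsto_nhds_unique hnear (tendsto_const_nhds.congr' (hev.mono fun ε h => h.symm))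

/-! ### Fubini for square integrable random fields and their moments -/

theorem integral_sub_sub_add {Ω : Type*} [MeasurableSpace Ω] {P : Measure Ω} {f g h k : Ω → ℂ}
    (hf : Integrable f P) (hg : Integrable g P) (hh : Integrable h P) (hk : Integrable k P) :
    ∫ ω, (f ω - g ω - h ω + k ω) ∂P =
      (∫ ω, f ω ∂P) - (∫ ω, g ω ∂P) - (∫ ω, h ω ∂P) + ∫ ω, k ω ∂P := by
  have hfg : Integrable (fun ω => f ω - g ω) P := hf.sub hg
  have hfgh : Integrable (fun ω => f ω - g ω - h ω) P := hfg.sub hh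
  rw [integral_add hfgh hk, integral_sub hfg hh, integral_sub hf hg]

section Fubini

variable {Ω S : Type*} [MeasurableSpace Ω] [MeasurableSpace S] {P : Measure Ω} {σ : Measure S}

theorem MemLp.bdd_snd_mul {k : S → ℂ} (hk : AEStronglyMeasurable k σ) {C : ℝ}
    (hC : ∀ᵐ z ∂σ, ‖k z‖ ≤ C) {X : Ω × S → ℂ} (hX : MemLp X 2 (P.prod σ)) :
    MemLp (fun p => k p.2 * X p) 2 (P.prod σ) := by
  refine hX.of_le_mul (c := C)
    ((hk.comp_quasiMeasurePreserving Measure.quasiMeasurePreserving_snd).mul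
      hX.aestronglyMeasurable) ?_
  filter_upwards [Measure.quasiMeasurePreserving_snd.ae hC] with p hp
  rw [norm_mul]
  exact mul_le_mul_of_nonneg_right hp (norm_nonneg _)

variable [IsFiniteMeasure P] [IsFiniteMeasure σ]

theorem MemLp.ae_section {X : Ω × S → ℂ} (hX : MemLp X 2 (P.prod σ)) :
    ∀ᵐ z ∂σ, MemLp (fun ω => X (ω, z)) 2 P := by
  have h1 := ((memLp_two_iff_integrable_sq_norm hX.aestronglyMeasurable).1 hX).prod_left_ae
  have h2 := hX.aestronglyMeasurable.prod_swap.prodMk_left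
  filter_upwards [h1, h2] with z hz1 hz2
  exact (memLp_two_iff_integrable_sq_norm hz2).2 hz1

/-- Because `σ` is finite, both factors stay square integrable when an idle variable is added, and a
product of two such functions is integrable. This justifies every later exchange of integrals for
the correlation. -/
theorem MemLp.integrable_mul_conj {X Y : Ω × S → ℂ} (hX : MemLp X 2 (P.prod σ))
    (hY : MemLp Y 2 (P.prod σ)) :
    Integrable (fun p : Ω × (S × S) => X (p.1, p.2.1) * conj (Y (p.1, p.2.2)))
      (P.prod (σ.prod σ)) := by
  have key : ∀ Z : Ω × S → ℂ, MemLp Z 2 (P.prod σ) →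
      MemLp (fun p : Ω × (S × S) => Z (p.1, p.2.1)) 2 (P.prod (σ.prod σ)) := fun Z hZ =>
    (hZ.comp_fst σ).comp_measurePreserving
      ((measurePreserving_prodAssoc P σ σ).symm MeasurableEquiv.prodAssoc)
  have h2 : MemLp (fun p : Ω × (S × S) => Y (p.1, p.2.2)) 2 (P.prod (σ.prod σ)) :=
    (key Y hY).comp_measurePreserving
      ((MeasurePreserving.id P).prod (Measure.measurePreserving_swap (μ := σ) (ν := σ)))
  exact (key X hX).integrable_mul h2.star

theorem MemLp.integrable_expectation_mul_conj {X Y : Ω × S → ℂ} (hX : MemLp X 2 (P.prod σ))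
    (hY : MemLp Y 2 (P.prod σ)) :
    Integrable (fun q : S × S => ∫ ω, X (ω, q.1) * conj (Y (ω, q.2)) ∂P) (σ.prod σ) :=
  (MemLp.integrable_mul_conj hX hY).integral_prod_right

theorem integral_prod_mul_conj (f g : S → ℂ) :
    ∫ q : S × S, f q.1 * conj (g q.2) ∂(σ.prod σ) = (∫ z, f z ∂σ) * conj (∫ z, g z ∂σ) := by
  rw [integral_prod_mul f fun z => conj (g z), integral_conj]

theorem MemLp.integral_integral_expectation_mul_conj {X Y : Ω × S → ℂ}
    (hX : MemLp X 2 (P.prod σ)) (hY : MemLp Y 2 (P.prod σ)) :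
    ∫ z, ∫ z', ∫ ω, X (ω, z) * conj (Y (ω, z')) ∂P ∂σ ∂σ =
      ∫ ω, (∫ z, X (ω, z) ∂σ) * conj (∫ z, Y (ω, z) ∂σ) ∂P := by
  rw [← integral_prod (fun q : S × S => ∫ ω, X (ω, q.1) * conj (Y (ω, q.2)) ∂P)
    (MemLp.integrable_expectation_mul_conj hX hY)]
  rw [← integral_integral_swap (MemLp.integrable_mul_conj hX hY)]
  exact integral_congr_ae (ae_of_all _ fun ω =>
    integral_prod_mul_conj (fun z => X (ω, z)) fun z => Y (ω, z))

/-- The squared modulus of the inner integral is the norm of a double integral of `X` times its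
conjugate, which is integrable in `ω` by Fubini. -/
theorem MemLp.integral_prod_right {X : Ω × S → ℂ} (hX : MemLp X 2 (P.prod σ)) :
    MemLp (fun ω => ∫ z, X (ω, z) ∂σ) 2 P := by
  have h1 := (MemLp.integrable_mul_conj hX hX).integral_prod_left
  refine (memLp_two_iff_integrable_sq_norm hX.aestronglyMeasurable.integral_prod_right').2
    (h1.norm.congr (ae_of_all _ fun ω => ?_))
  dsimp only
  rw [integral_prod_mul_conj (fun z => X (ω, z)) fun z => X (ω, z), norm_mul, RCLike.norm_conj, sq]

end Fubini

section Moments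

variable {Ω : Type*} [MeasurableSpace Ω] {P : Measure Ω}

theorem var_eq_cov (X : Ω → E3 → ℂ) (x : E3) : (var P X x : ℂ) = cov P X x x := by
  simp only [var, cov, Complex.mul_conj, Complex.normSq_eq_norm_sq]
  exact integral_complex_ofReal.symm

variable [IsProbabilityMeasure P]

theorem cov_eq_cor_sub {X : Ω → E3 → ℂ} {x x' : E3} (hx : MemLp (fun ω => X ω x) 2 P)
    (hx' : MemLp (fun ω => X ω x') 2 P) :
    cov P X x x' = cor P X X x x' - mean P X x * conj (mean P X x') := by
  have h1 : Integrable (fun ω => X ω x) P := hx.integrable one_le_two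
  have h2 : Integrable (fun ω => conj (X ω x')) P := hx'.star.integrable one_le_two
  have h12 : Integrable (fun ω => X ω x * conj (X ω x')) P := hx.integrable_mul hx'.star
  have e1 : ∫ ω, X ω x ∂P = mean P X x := rfl
  have e2 : ∫ ω, conj (X ω x') ∂P = conj (mean P X x') := integral_conj
  have e : ∀ ω, (X ω x - mean P X x) * conj (X ω x' - mean P X x') =
      X ω x * conj (X ω x') - X ω x * conj (mean P X x') - mean P X x * conj (X ω x') +
        mean P X x * conj (mean P X x') := fun ω => by rw [map_sub]; ring
  simp only [cov, e]
  rw [integral_sub_sub_add h12 (h1.mul_const _) (h2.const_mul _) (integrable_const _),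
    integral_mul_const, integral_const_mul, e1, e2, integral_const, probReal_univ, one_smul, cor]
  ring

end Moments

/-! ### Boundary kernels and the random boundary density -/

section Kernels

variable {κ : ℝ} {B : Set E3} {x : E3}

theorem IsLipschitzDomain.greenFun_bdd (hB : IsLipschitzDomain B) (κ : ℝ) (hx : x ∉ closure B) :
    AEStronglyMeasurable (greenFun κ x) (surfaceMeasure B) ∧
      ∃ C : ℝ, ∀ᵐ z ∂surfaceMeasure B, ‖greenFun κ x z‖ ≤ C := by
  have hsub : frontier B ⊆ {x}ᶜ := by
    rintro z hz rfl
    exact hx (frontier_subset_closure hz)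
  have hc := (isHelmholtzOn_greenFun κ x).continuousOn.mono hsub
  obtain ⟨C, hC⟩ := hB.isCompact_frontier.exists_bound_of_continuousOn hc
  refine ⟨hc.aestronglyMeasurable isClosed_frontier.measurableSet, C, ?_⟩
  filter_upwards [ae_mem_frontier B] with z hz using hC z hz

/-- The gradient of the fundamental solution is continuous on the compact boundary, which avoids the
pole `x`; pairing with a measurable normal of length at most 1 preserves measurability and the
bound. -/
theorem IsLipschitzDomain.greenNormal_bdd (hB : IsLipschitzDomain B) (κ : ℝ)
    (hx : x ∉ closure B) :
    AEStronglyMeasurable (greenNormal κ B x) (surfaceMeasure B) ∧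
      ∃ C : ℝ, ∀ᵐ z ∂surfaceMeasure B, ‖greenNormal κ B x z‖ ≤ C := by
  have hsub : frontier B ⊆ {x}ᶜ := by
    rintro z hz rfl
    exact hx (frontier_subset_closure hz)
  have hc := (isHelmholtzOn_greenFun κ x).continuousOn_fderiv.mono hsub
  obtain ⟨C, hC⟩ := hB.isCompact_frontier.exists_bound_of_continuousOn hc
  have hm : AEStronglyMeasurable (fderiv ℝ (greenFun κ x)) (surfaceMeasure B) :=
    hc.aestronglyMeasurable isClosed_frontier.measurableSet
  have hev := (isBoundedBilinearMap_apply (𝕜 := ℝ) (E := E3) (F := ℂ)).continuous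
  refine ⟨hev.comp_aestronglyMeasurable (hm.prodMk hB.aestronglyMeasurable_outerNormal), C, ?_⟩
  filter_upwards [ae_mem_frontier B] with z hz
  exact ((fderiv ℝ (greenFun κ x) z).le_of_opNorm_le_of_le (hC z hz)
    (norm_outerNormal_le B z)).trans_eq (mul_one C)

end Kernels

/-- The density of the boundary integral representing the scattered wave at `x`. -/
def waveDensity {Ω : Type*} (κ : ℝ) (B : Set E3) (us : Ω → E3 → ℂ) (x : E3) (p : Ω × E3) : ℂ :=
  greenNormal κ B x p.2 * us p.1 p.2 - greenFun κ x p.2 * normalDeriv B (us p.1) p.2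

section Density

variable {Ω : Type*} [MeasurableSpace Ω] {P : Measure Ω} {κ : ℝ} {B : Set E3}
  {us : Ω → E3 → ℂ}

/-- The representation formula is applied for each `ω` with `K = closure (D ω)`, compact because it
lies in the bounded set `B`. -/
theorem IsLipschitzDomain.ae_eq_integral_waveDensity (hκ : 0 < κ) {d : E3} (hd : ‖d‖ = 1)
    (hB : IsLipschitzDomain B) {D : Ω → Set E3} (hDB : ∀ᵐ ω ∂P, closure (D ω) ⊆ B)
    (hus : ∀ᵐ ω ∂P, IsScatteredWave κ d (D ω) (us ω)) {x : E3} (hx : x ∉ closure B) :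
    ∀ᵐ ω ∂P, us ω x = ∫ z, waveDensity κ B us x (ω, z) ∂surfaceMeasure B := by
  filter_upwards [hDB, hus] with ω h1 h2
  have hK : IsCompact (closure (D ω)) :=
    Metric.isCompact_of_isClosed_isBounded isClosed_closure (hB.isBounded.subset h1)
  rw [hB.representation hκ hK h1 (h2.isHelmholtzOn hd) h2.radiation hx]
  refine integral_congr_ae (ae_of_all _ fun z => ?_)
  simp only [waveDensity, mul_comm (us ω z)]

theorem IsLipschitzDomain.memLp_waveDensity (hB : IsLipschitzDomain B) (κ : ℝ)
    (hdir : MemLp (fun p : Ω × E3 => us p.1 p.2) 2 (P.prod (surfaceMeasure B)))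
    (hneu : MemLp (fun p : Ω × E3 => normalDeriv B (us p.1) p.2) 2
      (P.prod (surfaceMeasure B))) {x : E3} (hx : x ∉ closure B) :
    MemLp (waveDensity κ B us x) 2 (P.prod (surfaceMeasure B)) := by
  have := hB.isFiniteMeasure_surfaceMeasure
  obtain ⟨m1, C1, h1⟩ := hB.greenNormal_bdd κ hx
  obtain ⟨m2, C2, h2⟩ := hB.greenFun_bdd κ hx
  exact (MemLp.bdd_snd_mul m1 h1 hdir).sub (MemLp.bdd_snd_mul m2 h2 hneu)

variable [IsProbabilityMeasure P]

theorem IsLipschitzDomain.meanIntegrand_ae_eq (hB : IsLipschitzDomain B) (κ : ℝ)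
    (hdir : MemLp (fun p : Ω × E3 => us p.1 p.2) 2 (P.prod (surfaceMeasure B)))
    (hneu : MemLp (fun p : Ω × E3 => normalDeriv B (us p.1) p.2) 2
      (P.prod (surfaceMeasure B))) (x : E3) :
    ∀ᵐ z ∂surfaceMeasure B,
      ∫ ω, waveDensity κ B us x (ω, z) ∂P = meanIntegrand κ B P us x z := by
  have := hB.isFiniteMeasure_surfaceMeasure
  filter_upwards [MemLp.ae_section hdir, MemLp.ae_section hneu] with z h1 h2
  simp only [waveDensity]
  rw [integral_sub ((h1.integrable one_le_two).const_mul _)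
    ((h2.integrable one_le_two).const_mul _), integral_const_mul, integral_const_mul]
  rfl

/-- The kernels are deterministic and leave the expectation. Equality holds only almost everywhere,
since the Cauchy data at a fixed boundary point are known to be square integrable only for almost
every point. -/
theorem IsLipschitzDomain.corIntegrand_ae_eq (hB : IsLipschitzDomain B) (κ : ℝ)
    (hdir : MemLp (fun p : Ω × E3 => us p.1 p.2) 2 (P.prod (surfaceMeasure B)))
    (hneu : MemLp (fun p : Ω × E3 => normalDeriv B (us p.1) p.2) 2
      (P.prod (surfaceMeasure B))) (x x' : E3) :
    ∀ᵐ q ∂(surfaceMeasure B).prod (surfaceMeasure B),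
      ∫ ω, waveDensity κ B us x (ω, q.1) * conj (waveDensity κ B us x' (ω, q.2)) ∂P =
        corIntegrand κ B P us x x' q.1 q.2 := by
  have := hB.isFiniteMeasure_surfaceMeasure
  have hs := (MemLp.ae_section hdir).and (MemLp.ae_section hneu)
  filter_upwards [Measure.quasiMeasurePreserving_fst.ae hs,
    Measure.quasiMeasurePreserving_snd.ae hs]
  rintro ⟨z, z'⟩ ⟨h1, h2⟩ ⟨h1', h2'⟩
  dsimp only at h1 h2 h1' h2' ⊢
  have i11 : Integrable (fun ω => us ω z * conj (us ω z')) P := h1.integrable_mul h1'.star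
  have i12 : Integrable (fun ω => us ω z * conj (normalDeriv B (us ω) z')) P :=
    h1.integrable_mul h2'.star
  have i21 : Integrable (fun ω => normalDeriv B (us ω) z * conj (us ω z')) P :=
    h2.integrable_mul h1'.star
  have i22 : Integrable (fun ω => normalDeriv B (us ω) z * conj (normalDeriv B (us ω) z')) P :=
    h2.integrable_mul h2'.star
  have e : ∀ ω, waveDensity κ B us x (ω, z) * conj (waveDensity κ B us x' (ω, z')) =
      greenFun κ x z * conj (greenFun κ x' z') *
          (normalDeriv B (us ω) z * conj (normalDeriv B (us ω) z'))
        - greenFun κ x z * conj (greenNormal κ B x' z') *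
          (normalDeriv B (us ω) z * conj (us ω z'))
        - greenNormal κ B x z * conj (greenFun κ x' z') *
          (us ω z * conj (normalDeriv B (us ω) z'))
        + greenNormal κ B x z * conj (greenNormal κ B x' z') * (us ω z * conj (us ω z')) := by
    intro ω
    simp only [waveDensity, map_sub, map_mul]
    ring
  simp only [e]
  rw [integral_sub_sub_add (i22.const_mul _) (i21.const_mul _) (i12.const_mul _)
    (i11.const_mul _)]
  simp only [integral_const_mul]
  rfl

end Density

end RandomScattering

end

/-! ### Assembly of the moment formulas -/

open RandomScattering in
theorem mainTheorem2 {Ω : Type*} [MeasurableSpace Ω] (P : Measure Ω) [IsProbabilityMeasure P]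
    (κ : ℝ) (hκ : 0 < κ) (d : E3) (hd : ‖d‖ = 1)
    -- the region `B` enclosed by the interface `T = ∂B`
    (B : Set E3) (hB : IsLipschitzDomain B)
    -- the random obstacle and its scattered wave
    (D : Ω → Set E3) (us : Ω → E3 → ℂ)
    (hD : ∀ᵐ ω ∂P, IsLipschitzDomain (D ω))
    (hDB : ∀ᵐ ω ∂P, closure (D ω) ⊆ B)
    (hus : ∀ᵐ ω ∂P, IsScatteredWave κ d (D ω) (us ω))
    -- the Cauchy data on the interface have second moments
    (hdir : MemLp (fun p : Ω × E3 => us p.1 p.2) 2 (P.prod (surfaceMeasure B)))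
    (hneu : MemLp (fun p : Ω × E3 => normalDeriv B (us p.1) p.2) 2
      (P.prod (surfaceMeasure B)))
    (x x' : E3) (hx : x ∉ closure B) (hx' : x' ∉ closure B) :
    -- the wave has second moments at `x`
    MemLp (fun ω => us ω x) 2 P ∧
    -- mean
    (Integrable (meanIntegrand κ B P us x) (surfaceMeasure B) ∧
      mean P us x = ∫ z, meanIntegrand κ B P us x z ∂(surfaceMeasure B)) ∧
    -- correlation
    (Integrable (fun q : E3 × E3 => corIntegrand κ B P us x x' q.1 q.2)
        ((surfaceMeasure B).prod (surfaceMeasure B)) ∧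
      cor P us us x x' =
        ∫ z, ∫ z', corIntegrand κ B P us x x' z z' ∂(surfaceMeasure B) ∂(surfaceMeasure B)) ∧
    -- covariance and variance
    cov P us x x' = cor P us us x x' - mean P us x * conj (mean P us x') ∧
    (var P us x : ℂ) = cov P us x x ∧
    cov P us x x = cor P us us x x - (‖mean P us x‖ : ℂ) ^ 2 := by
  have := hB.isFiniteMeasure_surfaceMeasure
  have hF := hB.memLp_waveDensity κ hdir hneu hx
  have hF' := hB.memLp_waveDensity κ hdir hneu hx'
  have hr := hB.ae_eq_integral_waveDensity hκ hd hDB hus hx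
  have hr' := hB.ae_eq_integral_waveDensity hκ hd hDB hus hx'
  have hm : MemLp (fun ω => us ω x) 2 P :=
    (memLp_congr_ae hr).2 (RandomScattering.MemLp.integral_prod_right hF)
  have hm' : MemLp (fun ω => us ω x') 2 P :=
    (memLp_congr_ae hr').2 (RandomScattering.MemLp.integral_prod_right hF')
  have hFi : Integrable (waveDensity κ B us x) (P.prod (surfaceMeasure B)) :=
    hF.integrable one_le_two
  have hmean := hB.meanIntegrand_ae_eq κ hdir hneu x
  have hcor := hB.corIntegrand_ae_eq κ hdir hneu x x'
  refine ⟨hm, ⟨hFi.integral_prod_right.congr hmean, ?_⟩, ⟨?_, ?_⟩, cov_eq_cor_sub hm hm',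
    var_eq_cov us x, ?_⟩
  · rw [← integral_congr_ae hmean]
    -- The wave at `x` is replaced by its boundary integral, and expectation and surface integral
    -- are exchanged.
    exact (integral_congr_ae hr).trans (integral_integral_swap hFi)
  · exact (RandomScattering.MemLp.integrable_expectation_mul_conj hF hF').congr hcor
  · rw [integral_congr_ae ((Measure.ae_ae_of_ae_prod hcor).mono fun z hz => (integral_congr_ae hz).symm),
      RandomScattering.MemLp.integral_integral_expectation_mul_conj hF hF']
    refine integral_congr_ae ?_
    filter_upwards [hr, hr'] with ω h h'
    rw [h, h']
  · rw [cov_eq_cor_sub hm hm, Complex.mul_conj, Complex.normSq_eq_norm_sq, Complex.ofReal_pow]
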